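/- Let $0<\ell\le\infty$, $1<p<\infty$, $\frac1p+\frac1{p'}=1$, $0\le\lambda<1$ and $\alpha\in\mathbb{R}$; for $\ell=\infty$ read $[0,\ell]$ as $[0,\infty)$. Let $\mathcal{L}^{p,\lambda}([0,\ell])$ be the Morrey space of (classes of) measurable real- or complex-valued functions on $[0,\ell]$ with finite norm $$\|f\|_{p,\lambda}=\sup_{x\in[0,\ell],\,r>0}\Big(\frac1{r^\lambda}\int_{\{y\in[0,\ell]:\,|y-x|<r\}}|f(y)|^p\,dy\Big)^{1/p}.$$ Consider the weighted singular operator $$S_\alpha f(x)=\frac{x^\alpha}{\pi}\int_0^\ell\frac{f(t)\,dt}{t^\alpha(t-x)} :=\lim_{\varepsilon\to0+}\frac{x^\alpha}{\pi}\int_{\{t\in[0,\ell]:\,|t-x|>\varepsilon\}}\frac{f(t)\,dt}{t^\alpha(t-x)},$$ where $S_\alpha f(x)$ is said to exist if the truncated integrals converge absolutely for all $\varepsilon>0$ and the limit exists and is finite. Then $S_\alpha$ is bounded in $\mathcal{L}^{p,\lambda}([0,\ell])$ (that is, for every $f\in\mathcal{L}^{p,\lambda}([0,\ell])$ the value $S_\alpha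 f(x)$ exists for almost every $x\in[0,\ell]$ and $\|S_\alpha f\|_{p,\lambda}\le C\|f\|_{p,\lambda}$ with a finite constant $C$ independent of $f$) if and only if $$-\frac1p<\alpha-\frac{\lambda}{p}<\frac1{p'}.$$ -/

import Mathlib

open MeasureTheory Filter Topology
open scoped ENNReal NNReal

noncomputable section

/-- The interval `[0, ℓ]`, as a set of real numbers; it is `[0, ∞)` when `ℓ = ∞`. -/
def segment0 (ℓ : EReal) : Set ℝ := {t : ℝ | 0 ≤ t ∧ (t : EReal) ≤ ℓ}

/-- The Morrey norm
`‖f‖_{p,lam} = sup_{x ∈ [0,ℓ], r > 0} (r^{-lam} ∫_{B(x,r)} |f(y)|^p dy)^{1/p}`,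
where `B(x,r)` is the ball in `[0,ℓ]`. Values of `f` outside `[0,ℓ]` play no role. -/
def morreyNorm {𝕜 : Type*} [RCLike 𝕜] (p lam : ℝ) (ℓ : EReal) (f : ℝ → 𝕜) : ℝ≥0∞ :=
  ⨆ x ∈ segment0 ℓ, ⨆ r ∈ Set.Ioi (0 : ℝ),
    (ENNReal.ofReal (r ^ (-lam)) *
      ∫⁻ y in Metric.ball x r ∩ segment0 ℓ, ‖f y‖ₑ ^ p) ^ (1 / p)

/-- Membership in the Morrey space `L^{p,lam}([0,ℓ])`. -/
def MemMorrey {𝕜 : Type*} [RCLike 𝕜] (p lam : ℝ) (ℓ : EReal) (f : ℝ → 𝕜) : Prop :=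
  AEStronglyMeasurable f (volume.restrict (segment0 ℓ)) ∧ morreyNorm p lam ℓ f < ∞

/-- The set `[0,ℓ]` with the symmetric `ε`-neighbourhood of `x` removed. -/
def truncatedSegment (ℓ : EReal) (x ε : ℝ) : Set ℝ := {t ∈ segment0 ℓ | ε < |t - x|}

/-- The integrand `f(t) / (t^α (t - x))`. -/
def singularIntegrand {𝕜 : Type*} [RCLike 𝕜] (α : ℝ) (f : ℝ → 𝕜) (x t : ℝ) : 𝕜 :=
  (t ^ α * (t - x))⁻¹ • f t

/-- The truncation `(x^α / π) ∫_{t ∈ [0,ℓ], |t - x| > ε} f(t) / (t^α (t - x)) dt`. -/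
def truncatedSingularOperator {𝕜 : Type*} [RCLike 𝕜] (α : ℝ) (ℓ : EReal) (f : ℝ → 𝕜)
    (x ε : ℝ) : 𝕜 :=
  (x ^ α / Real.pi) • ∫ t in truncatedSegment ℓ x ε, singularIntegrand α f x t

/-- The singular integral `S_α f(x)` exists: all its truncations are (absolutely convergent)
Lebesgue integrals, and they have a limit in `𝕜` as `ε → 0+`. -/
def SingularIntegralExists {𝕜 : Type*} [RCLike 𝕜] (α : ℝ) (ℓ : EReal) (f : ℝ → 𝕜)
    (x : ℝ) : Prop :=
  (∀ ε : ℝ, 0 < ε → IntegrableOn (singularIntegrand α f x) (truncatedSegment ℓ x ε)) ∧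
    ∃ v : 𝕜, Tendsto (truncatedSingularOperator α ℓ f x) (𝓝[>] 0) (𝓝 v)

/-- The weighted singular operator
`S_α f(x) = (x^α / π) p.v. ∫_0^ℓ f(t) / (t^α (t - x)) dt`; the value is meaningful at the points
`x` where `SingularIntegralExists α ℓ f x` holds. -/
def singularOperator {𝕜 : Type*} [RCLike 𝕜] (α : ℝ) (ℓ : EReal) (f : ℝ → 𝕜) (x : ℝ) : 𝕜 :=
  limUnder (𝓝[>] 0) (truncatedSingularOperator α ℓ f x)

/-- `S_α` is bounded in `L^{p,lam}([0,ℓ])` (functions with values in `𝕜`): for every `f` of the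
space, `S_α f` exists almost everywhere and is in the space, and
`‖S_α f‖_{p,lam} ≤ C ‖f‖_{p,lam}` with a finite constant `C` independent of `f`. -/
def SingularOperatorIsBounded (𝕜 : Type*) [RCLike 𝕜] (α p lam : ℝ) (ℓ : EReal) : Prop :=
  ∃ C : ℝ≥0, ∀ f : ℝ → 𝕜, MemMorrey p lam ℓ f →
    (∀ᵐ x ∂(volume.restrict (segment0 ℓ)), SingularIntegralExists α ℓ f x) ∧
    MemMorrey p lam ℓ (singularOperator α ℓ f) ∧
    morreyNorm p lam ℓ (singularOperator α ℓ f) ≤ C * morreyNorm p lam ℓ f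

end

/-! Put γ = (1 - λ)/p. Then 1/p - λ/p = γ, and the condition on α reads -γ < α < 1 - γ. The number γ
is the critical exponent of the space: replacing f by f(s·) on the half line multiplies the Morrey
norm by s^(-γ).

Sufficiency. Write (x/t)^α / (t - x) = 1/(t - x) + k(x,t) with k(x,t) = ((x/t)^α - 1)/(t - x). The
correction k is homogeneous of degree -1 and has no singularity on the diagonal of the positive
quadrant. It acts as a superposition of dilations, with norm at most ∫ |k(1,s)| s^(-γ) ds, and this
integral converges at 0 because α < 1 - γ and at ∞ because α > -γ (`lintegral_weightKer_lt_top`,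
`lintegral_diffMajorant_rpow_le`). What is left is the Hilbert transform of the function extended by
zero to the line. It is bounded in Morrey spaces (`exists_hilbert_morrey`): on a ball, the part of f
in the double ball is controlled by the L^p theorem, and the remaining part by summing over dyadic
rings, where λ < 1 gives a convergent geometric series.

The L^p theorem (`exists_truncHilbert_limit`) is M. Riesz' theorem, including almost everywhere
existence of the principal value. For 1 < p ≤ 2 and f ≥ 0, the Cauchy integral F of f has Re F > 0
on the upper half plane, so F^p is analytic there and its integral over the line vanishes. The
pointwise inequality |Im w|^p ≤ A (Re w)^p - B Re(w^p) (`exists_abs_im_rpow_le`) then bounds the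
conjugate Poisson integral, uniformly in the height ε. Duality covers p > 2. For the principal
value, an L^p function h is constructed whose Poisson integrals are π times the conjugate Poisson
integrals of f (`exists_hilbert`). At Lebesgue points of h these converge, and at Lebesgue points of
f they differ from the truncated Hilbert transforms by o(1).

Necessity. Test on t^(-γ) cut off to (δ, a], and let L = log(a/δ). The p-th power of its norm is at
most of order 1 + L (`exists_lintegral_truncPower_le`). If α ≥ 1 - γ, its image is at least a
multiple of L on a fixed interval to the right of a. If α ≤ -γ, its image is at least a multiple of
δ^(-γ) L on (0, δ/2), an interval whose length compensates the factor δ^(-γ). Boundedness would give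
L^p ≤ M (1 + L) for all L > 0, which is false for p > 1. -/

noncomputable section

/-! ### Poisson kernels, dyadic bounds and Lebesgue points -/

/-- A weighted Hölder inequality: `(∫ w g)^p ≤ (∫ w)^{p-1} ∫ w g^p`. -/
theorem lintegral_mul_rpow_le {X : Type*} [MeasurableSpace X] {μ : Measure X} {p : ℝ} (hp : 1 < p)
    {w g : X → ℝ≥0∞} (hw : AEMeasurable w μ) (hg : AEMeasurable g μ) :
    (∫⁻ x, w x * g x ∂μ) ^ p ≤ (∫⁻ x, w x ∂μ) ^ (p - 1) * ∫⁻ x, w x * g x ^ p ∂μ := by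
  have hpq : (Real.conjExponent p).HolderConjugate p :=
    (Real.HolderConjugate.conjExponent hp).symm
  set q := Real.conjExponent p
  have hp0 : 0 < p := by linarith
  have hq0 : 0 < q := hpq.pos
  have hsum : 1 / q + 1 / p = 1 := by simpa using hpq.inv_add_inv_eq_one
  have hpq' : 1 / q * p = p - 1 := by
    have : 1 / q = 1 - 1 / p := by linarith
    rw [this]; field_simp
  have h := ENNReal.lintegral_mul_le_Lp_mul_Lq μ hpq (f := fun x => w x ^ (1 / q))
    (g := fun x => w x ^ (1 / p) * g x) (hw.pow_const _) ((hw.pow_const _).mul hg)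
  have e1 : ∀ x, w x ^ (1 / q) * (w x ^ (1 / p) * g x) = w x * g x := fun x => by
    rw [← mul_assoc, ← ENNReal.rpow_add_of_nonneg _ _ (by positivity) (by positivity), hsum,
      ENNReal.rpow_one]
  have e2 : ∀ x, (w x ^ (1 / q)) ^ q = w x := fun x => by
    rw [← ENNReal.rpow_mul, one_div_mul_cancel hq0.ne', ENNReal.rpow_one]
  have e3 : ∀ x, (w x ^ (1 / p) * g x) ^ p = w x * g x ^ p := fun x => by
    rw [ENNReal.mul_rpow_of_nonneg _ _ hp0.le, ← ENNReal.rpow_mul, one_div_mul_cancel hp0.ne',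
      ENNReal.rpow_one]
  simp only [Pi.mul_apply, e1, e2, e3] at h
  calc _ ≤ ((∫⁻ x, w x ∂μ) ^ (1 / q) * (∫⁻ x, w x * g x ^ p ∂μ) ^ (1 / p)) ^ p := by gcongr
    _ = _ := by
      rw [ENNReal.mul_rpow_of_nonneg _ _ hp0.le, ← ENNReal.rpow_mul, ← ENNReal.rpow_mul,
        one_div_mul_cancel hp0.ne', ENNReal.rpow_one, hpq']

/-- The (unnormalised) Poisson kernel of the upper half plane. -/
def poissonKer (ε s : ℝ) : ℝ := ε / (s ^ 2 + ε ^ 2)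

/-- The (unnormalised) conjugate Poisson kernel of the upper half plane. -/
def conjPoissonKer (ε s : ℝ) : ℝ := s / (s ^ 2 + ε ^ 2)

theorem poissonKer_nonneg {ε : ℝ} (hε : 0 < ε) (s : ℝ) : 0 ≤ poissonKer ε s := by
  unfold poissonKer; positivity

theorem poissonKer_pos {ε : ℝ} (hε : 0 < ε) (s : ℝ) : 0 < poissonKer ε s := by
  unfold poissonKer; positivity

theorem continuous_poissonKer {ε : ℝ} (hε : 0 < ε) : Continuous (poissonKer ε) := by
  unfold poissonKer
  exact continuous_const.div (by fun_prop) fun s => by positivity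

theorem continuous_conjPoissonKer {ε : ℝ} (hε : 0 < ε) : Continuous (conjPoissonKer ε) := by
  unfold conjPoissonKer
  exact continuous_id.div (by fun_prop) fun s => by positivity

theorem lintegral_poissonKer {ε : ℝ} (hε : 0 < ε) :
    ∫⁻ s, ENNReal.ofReal (poissonKer ε s) = ENNReal.ofReal Real.pi := by
  have e : poissonKer ε = fun s => ε⁻¹ * (1 + (s / ε) ^ 2)⁻¹ := by
    ext s; unfold poissonKer; field_simp; ring
  have hi : Integrable (poissonKer ε) := by
    rw [e]; exact (integrable_inv_one_add_sq.comp_div hε.ne').const_mul _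
  rw [← ofReal_integral_eq_lintegral_ofReal hi (.of_forall (poissonKer_nonneg hε)), e,
    integral_const_mul, Measure.integral_comp_div (fun s : ℝ => (1 + s ^ 2)⁻¹),
    integral_univ_inv_one_add_sq, abs_of_pos hε, smul_eq_mul, inv_mul_cancel_left₀ hε.ne']

theorem lintegral_poissonKer_sub_left {ε : ℝ} (hε : 0 < ε) (t : ℝ) :
    ∫⁻ x, ENNReal.ofReal (poissonKer ε (t - x)) = ENNReal.ofReal Real.pi := by
  rw [lintegral_sub_left_eq_self (fun s => ENNReal.ofReal (poissonKer ε s)) t,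
    lintegral_poissonKer hε]

theorem lintegral_poissonKer_sub_right {ε : ℝ} (hε : 0 < ε) (x : ℝ) :
    ∫⁻ t, ENNReal.ofReal (poissonKer ε (t - x)) = ENNReal.ofReal Real.pi := by
  rw [lintegral_sub_right_eq_self (fun s => ENNReal.ofReal (poissonKer ε s)) x,
    lintegral_poissonKer hε]

/-- Take k = 0 when |s| ≤ ε. Otherwise 2^(k-1) ε ≤ |s| < 2^k ε for some k ≥ 1, and ε/s² ≤ 4 ·
4^(-k)/ε. -/
theorem poissonKer_le_dyadic {ε : ℝ} (hε : 0 < ε) (s : ℝ) :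
    ∃ k : ℕ, |s| ≤ 2 ^ k * ε ∧ poissonKer ε s ≤ 4 * (4⁻¹) ^ k / ε := by
  unfold poissonKer
  rcases le_or_gt |s| ε with h | h
  · refine ⟨0, by simpa using h, ?_⟩
    rw [div_le_div_iff₀ (by positivity) hε]
    nlinarith [sq_nonneg s, sq_nonneg ε]
  · obtain ⟨n, hn1, hn2⟩ := exists_nat_pow_near (x := |s| / ε) (y := 2)
      (by rw [le_div_iff₀ hε]; linarith) (by norm_num)
    rw [le_div_iff₀ hε] at hn1
    rw [div_lt_iff₀ hε] at hn2
    refine ⟨n + 1, hn2.le, ?_⟩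
    have h4 : (4 : ℝ) * 4⁻¹ ^ (n + 1) / ε = ε / (2 ^ n * ε) ^ 2 := by
      have : (4 : ℝ) = 2 ^ 2 := by norm_num
      rw [pow_succ, inv_pow, this]; field_simp
      rw [← pow_mul, ← pow_mul, mul_comm]
    rw [h4]
    have : (2 ^ n * ε) ^ 2 ≤ s ^ 2 := by
      rw [← sq_abs s]; gcongr
    gcongr
    nlinarith [sq_nonneg ε]

theorem inv_abs_le_dyadic {r : ℝ} (hr : 0 < r) {s : ℝ} (hs : r ≤ |s|) :
    ∃ k : ℕ, |s| < 2 ^ (k + 1) * r ∧ |s|⁻¹ ≤ (2 ^ k * r)⁻¹ := by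
  obtain ⟨n, hn1, hn2⟩ := exists_nat_pow_near (x := |s| / r) (y := 2)
    (by rw [le_div_iff₀ hr]; linarith) (by norm_num)
  rw [le_div_iff₀ hr] at hn1
  rw [div_lt_iff₀ hr] at hn2
  exact ⟨n, hn2, by gcongr⟩

/-- At each t a single term of the series, the one given by `poissonKer_le_dyadic`, already
dominates the integrand. The others are nonnegative. -/
theorem lintegral_poissonKer_mul_le {ε : ℝ} (hε : 0 < ε) (x : ℝ) (φ : ℝ → ℝ≥0∞)
    (hφ : AEMeasurable φ) :
    ∫⁻ t, ENNReal.ofReal (poissonKer ε (t - x)) * φ t ≤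
      ∑' k : ℕ, ENNReal.ofReal (4 * (4⁻¹) ^ k / ε) * ∫⁻ t in Metric.closedBall x (2 ^ k * ε), φ t := by
  have h1 : ∀ k : ℕ, ENNReal.ofReal (4 * (4⁻¹) ^ k / ε) *
      ∫⁻ t in Metric.closedBall x (2 ^ k * ε), φ t =
      ∫⁻ t, ENNReal.ofReal (4 * (4⁻¹) ^ k / ε) *
        (Metric.closedBall x (2 ^ k * ε)).indicator φ t := fun k => by
    rw [lintegral_const_mul' _ _ ENNReal.ofReal_ne_top,
      lintegral_indicator Metric.isClosed_closedBall.measurableSet]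
  simp_rw [h1]
  rw [← lintegral_tsum]
  · refine lintegral_mono fun t => ?_
    obtain ⟨k, hk, hk'⟩ := poissonKer_le_dyadic hε (t - x)
    refine le_trans ?_ (ENNReal.le_tsum k)
    rw [Set.indicator_of_mem (by simpa [Real.dist_eq] using hk)]
    gcongr
  · intro k
    exact (hφ.indicator Metric.isClosed_closedBall.measurableSet).const_mul _

theorem lintegral_tail_le {r : ℝ} (hr : 0 < r) (x : ℝ) (φ : ℝ → ℝ≥0∞) (hφ : AEMeasurable φ) :
    ∫⁻ t in {t | r ≤ |t - x|}, ENNReal.ofReal |t - x|⁻¹ * φ t ≤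
      ∑' k : ℕ, ENNReal.ofReal (2 ^ k * r)⁻¹ * ∫⁻ t in Metric.ball x (2 ^ (k + 1) * r), φ t := by
  have h1 : ∀ k : ℕ, ENNReal.ofReal (2 ^ k * r)⁻¹ *
      ∫⁻ t in Metric.ball x (2 ^ (k + 1) * r), φ t =
      ∫⁻ t, ENNReal.ofReal (2 ^ k * r)⁻¹ *
        (Metric.ball x (2 ^ (k + 1) * r)).indicator φ t := fun k => by
    rw [lintegral_const_mul' _ _ ENNReal.ofReal_ne_top,
      lintegral_indicator Metric.isOpen_ball.measurableSet]
  have hm : MeasurableSet {t | r ≤ |t - x|} := measurableSet_le (by fun_prop) (by fun_prop)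
  simp_rw [h1]
  rw [← lintegral_tsum, ← lintegral_indicator hm]
  · refine lintegral_mono fun t => ?_
    by_cases ht : r ≤ |t - x|
    · rw [Set.indicator_of_mem (by exact ht)]
      obtain ⟨k, hk, hk'⟩ := inv_abs_le_dyadic hr ht
      refine le_trans ?_ (ENNReal.le_tsum k)
      rw [Set.indicator_of_mem (by simpa [Real.dist_eq] using hk)]
      gcongr
    · rw [Set.indicator_of_notMem (by exact ht)]; exact zero_le
  · intro k
    exact (hφ.indicator Metric.isOpen_ball.measurableSet).const_mul _

/-- Poisson integrals of `‖f - f x‖` tend to zero at almost every point `x`. -/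
theorem ae_tendsto_lintegral_poissonKer_enorm_sub {E : Type*} [NormedAddCommGroup E] {f : ℝ → E}
    (hf : LocallyIntegrable f) {C : ℝ → ℝ≥0∞} (hCt : ∀ x, C x ≠ ∞)
    (hC : ∀ x r, 1 ≤ r → ∫⁻ t in Metric.closedBall x r, ‖f t‖ₑ ≤ C x * ENNReal.ofReal r) :
    ∀ᵐ x, Tendsto (fun ε => ∫⁻ t, ENNReal.ofReal (poissonKer ε (t - x)) * ‖f t - f x‖ₑ)
      (𝓝[>] 0) (𝓝 0) := by
  filter_upwards [(IsUnifLocDoublingMeasure.vitaliFamily (volume : Measure ℝ)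
    1).ae_tendsto_lintegral_enorm_sub_div hf] with x hx
  have hfm := hf.aestronglyMeasurable
  set A : ℝ → ℝ≥0∞ := fun ρ => ∫⁻ t in Metric.closedBall x ρ, ‖f t - f x‖ₑ with hA
  have hlim : Tendsto (fun ρ => A ρ / ENNReal.ofReal ρ) (𝓝[>] 0) (𝓝 0) := by
    have h1 := hx.comp (IsUnifLocDoublingMeasure.tendsto_closedBall_filterAt
      (volume : Measure ℝ) (K := 1) (x := x) (fun _ : ℝ => x) (fun ρ => ρ) tendsto_id
      (by filter_upwards [self_mem_nhdsWithin] with ρ hρ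
          exact Metric.mem_closedBall_self (by simpa using (le_of_lt hρ))))
    have h2 := ENNReal.Tendsto.const_mul (a := 2) h1 (Or.inr ENNReal.ofNat_ne_top)
    rw [mul_zero] at h2
    refine h2.congr' ?_
    filter_upwards [self_mem_nhdsWithin] with ρ hρ
    have hρ' : (0 : ℝ) < ρ := hρ
    simp only [Function.comp, Real.volume_closedBall, hA]
    rw [ENNReal.ofReal_mul (by norm_num), ENNReal.ofReal_ofNat, ← mul_div_assoc]
    exact ENNReal.mul_div_mul_left _ _ (by norm_num) (by norm_num)
  have hAadd : ∀ ρ, A ρ ≤ (∫⁻ t in Metric.closedBall x ρ, ‖f t‖ₑ) + ‖f x‖ₑ * ENNReal.ofReal (2 * ρ) :=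
    fun ρ => by
    calc A ρ ≤ ∫⁻ t in Metric.closedBall x ρ, (‖f t‖ₑ + ‖f x‖ₑ) :=
          lintegral_mono fun t => enorm_sub_le
      _ = _ := by
        rw [lintegral_add_right _ measurable_const, setLIntegral_const, Real.volume_closedBall]
  -- A bound valid at every scale is needed for dominated convergence in k. Scales up to δ use the
  -- limit, scales from 1 on use the growth hypothesis, and between them `A ρ` is compared with `A
  -- 1` while ρ stays above δ.
  obtain ⟨M, hM, hMA⟩ : ∃ M : ℝ≥0∞, M ≠ ∞ ∧ ∀ ρ, 0 < ρ → A ρ / ENNReal.ofReal ρ ≤ M := by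
    have h1 : ∀ᶠ ρ in 𝓝[>] (0 : ℝ), A ρ / ENNReal.ofReal ρ ≤ 1 :=
      (hlim.eventually (gt_mem_nhds one_pos)).mono fun _ h => h.le
    obtain ⟨δ, hδ, hδ1⟩ := mem_nhdsGT_iff_exists_Ioc_subset.1 h1
    have hδ0 : (0 : ℝ) < δ := hδ
    refine ⟨1 + (C x + ‖f x‖ₑ * 2) + (C x + ‖f x‖ₑ * 2) / ENNReal.ofReal δ, ?_, fun ρ hρ => ?_⟩
    · have h2 : C x + ‖f x‖ₑ * 2 ≠ ∞ :=
        ENNReal.add_ne_top.2 ⟨hCt x, ENNReal.mul_ne_top enorm_ne_top (by norm_num)⟩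
      exact ENNReal.add_ne_top.2 ⟨ENNReal.add_ne_top.2 ⟨by norm_num, h2⟩,
        ENNReal.div_ne_top h2 (by simpa using hδ0)⟩
    · have hbig : ∀ r, 1 ≤ r → A r ≤ (C x + ‖f x‖ₑ * 2) * ENNReal.ofReal r := fun r hr => by
        refine (hAadd r).trans ?_
        rw [add_mul, ENNReal.ofReal_mul (by norm_num), ENNReal.ofReal_ofNat, mul_assoc]
        gcongr
        exact hC x r hr
      rcases le_or_gt ρ δ with h | h
      · exact (hδ1 ⟨hρ, h⟩).trans (by rw [add_assoc]; exact le_self_add)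
      rcases le_or_gt 1 ρ with h' | h'
      · refine (ENNReal.div_le_of_le_mul (hbig ρ h')).trans ?_
        rw [add_right_comm]; exact le_add_self
      · refine le_trans ?_ le_add_self
        have h2 := hbig 1 le_rfl
        rw [ENNReal.ofReal_one, mul_one] at h2
        have : A ρ ≤ A 1 := lintegral_mono_set (Metric.closedBall_subset_closedBall h'.le)
        exact ENNReal.div_le_div (this.trans h2) (ENNReal.ofReal_le_ofReal h.le)
  -- The decay 4^(-k)/ε of the kernel leaves 2^(-k) after normalising by the radius 2^k ε: a
  -- summable weight times an average.
  have key : ∀ ε : ℝ, 0 < ε →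
      ∫⁻ t, ENNReal.ofReal (poissonKer ε (t - x)) * ‖f t - f x‖ₑ ≤
      ∑' k : ℕ, ENNReal.ofReal (4 * 2⁻¹ ^ k) * (A (2 ^ k * ε) / ENNReal.ofReal (2 ^ k * ε)) := by
    intro ε hε
    refine (lintegral_poissonKer_mul_le hε x _
      (hfm.sub aestronglyMeasurable_const).enorm).trans (ENNReal.tsum_le_tsum fun k => ?_)
    rw [mul_div, ENNReal.mul_div_right_comm, ← ENNReal.ofReal_div_of_pos (by positivity)]
    refine le_of_eq ?_
    congr 2
    have : (4 : ℝ) = 2 * 2 := by norm_num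
    rw [this, mul_inv, mul_pow, inv_pow]
    field_simp
  have hz : Tendsto (fun ε : ℝ => ∑' k : ℕ,
      ENNReal.ofReal (4 * 2⁻¹ ^ k) * (A (2 ^ k * ε) / ENNReal.ofReal (2 ^ k * ε)))
      (𝓝[>] 0) (𝓝 0) := by
    simp_rw [← lintegral_count]
    have hb : ∑' k : ℕ, ENNReal.ofReal (4 * 2⁻¹ ^ k) ≠ ∞ := by
      rw [← ENNReal.ofReal_tsum_of_nonneg (fun k => by positivity)]
      · exact ENNReal.ofReal_ne_top
      · exact (summable_geometric_of_lt_one (by norm_num) (by norm_num)).mul_left _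
    have := tendsto_lintegral_filter_of_dominated_convergence (μ := Measure.count (α := ℕ))
      (l := 𝓝[>] (0 : ℝ)) (F := fun ε k => ENNReal.ofReal (4 * 2⁻¹ ^ k) *
        (A (2 ^ k * ε) / ENNReal.ofReal (2 ^ k * ε))) (f := fun _ => 0)
      (fun k => ENNReal.ofReal (4 * 2⁻¹ ^ k) * M)
      (.of_forall fun _ => measurable_of_countable _) ?_ ?_ ?_
    · simpa using this
    · filter_upwards [self_mem_nhdsWithin] with ε hε
      refine .of_forall fun k => ?_
      gcongr
      exact hMA _ (mul_pos (by positivity) hε)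
    · rw [lintegral_count, ENNReal.tsum_mul_right]
      exact ENNReal.mul_ne_top hb hM
    · refine .of_forall fun k => ?_
      have h1 : Tendsto (fun ε : ℝ => 2 ^ k * ε) (𝓝[>] 0) (𝓝[>] 0) := by
        refine tendsto_nhdsWithin_iff.2 ⟨?_, ?_⟩
        · have : Tendsto (fun ε : ℝ => 2 ^ k * ε) (𝓝 0) (𝓝 (2 ^ k * 0)) :=
            (continuous_const.mul continuous_id).tendsto 0
          rw [mul_zero] at this
          exact this.mono_left nhdsWithin_le_nhds
        · filter_upwards [self_mem_nhdsWithin] with ε hε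
          exact Set.mem_Ioi.2 (mul_pos (by positivity) (Set.mem_Ioi.1 hε))
      simpa using ENNReal.Tendsto.const_mul (hlim.comp h1)
        (Or.inr (ENNReal.ofReal_ne_top (r := 4 * 2⁻¹ ^ k)))
  refine tendsto_of_tendsto_of_tendsto_of_le_of_le' tendsto_const_nhds hz
    (.of_forall fun _ => zero_le) ?_
  filter_upwards [self_mem_nhdsWithin] with ε hε using key ε hε

end

/-! ### Cauchy's theorem in the upper half plane and the semigroup identity -/

noncomputable section

/-- Cauchy's theorem on the upper half plane for functions with integrable decay. -/
theorem integral_eq_zero_of_differentiableAt_upperHalfPlane {ψ : ℂ → ℂ} {C q : ℝ} (hq : 1 < q)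
    (hd : ∀ z : ℂ, 0 ≤ z.im → DifferentiableAt ℂ ψ z)
    (hb : ∀ z : ℂ, 0 ≤ z.im → ‖ψ z‖ ≤ C * (1 + ‖z‖) ^ (-q)) :
    Integrable (fun x : ℝ => ψ x) ∧ ∫ x : ℝ, ψ x = 0 := by
  have hcont : Continuous fun x : ℝ => ψ x := continuous_iff_continuousAt.2 fun x =>
    (hd x (by simp)).continuousAt.comp Complex.continuous_ofReal.continuousAt
  have hint : Integrable fun x : ℝ => ψ x := by
    refine Integrable.mono' (g := fun x : ℝ => C * (1 + ‖x‖) ^ (-q))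
      ((integrable_one_add_norm (by simpa using hq)).const_mul C) hcont.aestronglyMeasurable
      (.of_forall fun x => ?_)
    simpa using hb x (by simp)
  refine ⟨hint, ?_⟩
  have hC : 0 ≤ C := by
    have := (norm_nonneg _).trans (hb 0 (by simp))
    simpa using this
  have hlim := intervalIntegral_tendsto_integral hint tendsto_neg_atTop_atBot tendsto_id
  have hsmall : ∀ R : ℝ, 0 < R → ∀ z : ℂ, 0 ≤ z.im → R ≤ ‖z‖ → ‖ψ z‖ ≤ C * R ^ (-q) :=
    fun R hR z hz hRz => (hb z hz).trans (by
      have := Real.rpow_le_rpow_of_nonpos hR (by linarith : R ≤ 1 + ‖z‖) (by linarith : -q ≤ 0)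
      gcongr)
  -- The contour is the rectangle with corners -R and R + iR. Its three sides off the real axis have
  -- total length 4R and stay at distance at least R from 0. Their contribution is of order R^(1-q),
  -- which tends to 0.
  have hbound : ∀ R : ℝ, 0 < R → ‖∫ x in (-R)..R, ψ x‖ ≤ 4 * C * R ^ (1 - q) := by
    intro R hR
    have h := Complex.integral_boundary_rect_eq_zero_of_differentiableOn ψ (-R : ℂ) (R + R * Complex.I)
      (fun z hz => (hd z (by
        rw [Complex.mem_reProdIm] at hz
        have := hz.2
        simp only [Complex.neg_im, Complex.ofReal_im, neg_zero, Complex.add_im, Complex.mul_im,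
          Complex.ofReal_re, Complex.I_im, mul_one, Complex.I_re, mul_zero, add_zero, zero_add,
          Set.uIcc_of_le hR.le] at this
        exact this.1)).differentiableWithinAt)
    simp only [Complex.neg_re, Complex.neg_im, Complex.ofReal_im, neg_zero, Complex.add_im,
      Complex.mul_im, Complex.mul_re, Complex.add_re,
      Complex.ofReal_re, Complex.I_im, mul_one, Complex.I_re, mul_zero, add_zero, zero_add,
      Complex.ofReal_zero, zero_mul, sub_self] at h
    have h1 : ‖∫ x in (-R)..R, ψ (x + R * Complex.I)‖ ≤ C * R ^ (-q) * |R - -R| :=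
      intervalIntegral.norm_integral_le_of_norm_le_const fun x _ =>
        hsmall R hR _ (by simpa using hR.le) (by
          have := Complex.abs_im_le_norm (x + R * Complex.I)
          simp only [Complex.add_im, Complex.ofReal_im, Complex.mul_im, Complex.ofReal_re,
            Complex.I_im, mul_one, Complex.I_re, mul_zero, add_zero, zero_add] at this
          exact (le_abs_self R).trans this)
    have hre : ∀ s : ℝ, |s| = R → ∀ y ∈ Set.uIoc 0 R, ‖ψ (s + y * Complex.I)‖ ≤ C * R ^ (-q) := by
      intro s hs y hy
      rw [Set.uIoc_of_le hR.le] at hy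
      refine hsmall R hR _ (by simpa using hy.1.le) ?_
      have := Complex.abs_re_le_norm (s + y * Complex.I)
      simp only [Complex.add_re, Complex.ofReal_im, Complex.mul_re, Complex.ofReal_re,
        Complex.I_im, mul_one, Complex.I_re, mul_zero, add_zero, sub_self] at this
      rwa [hs] at this
    have h2 : ‖∫ y in (0:ℝ)..R, ψ (R + y * Complex.I)‖ ≤ C * R ^ (-q) * |R - 0| :=
      intervalIntegral.norm_integral_le_of_norm_le_const (hre R (abs_of_pos hR))
    have h3 : ‖∫ y in (0:ℝ)..R, ψ (-R + y * Complex.I)‖ ≤ C * R ^ (-q) * |R - 0| :=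
      intervalIntegral.norm_integral_le_of_norm_le_const (by
        simpa using hre (-R) (by rw [abs_neg, abs_of_pos hR]))
    have heq : ∫ x in (-R)..R, ψ x = (∫ x in (-R)..R, ψ (x + R * Complex.I)) -
        Complex.I * (∫ y in (0:ℝ)..R, ψ (R + y * Complex.I)) +
        Complex.I * (∫ y in (0:ℝ)..R, ψ (-R + y * Complex.I)) := by
      simp only [smul_eq_mul, Complex.ofReal_neg] at h
      linear_combination h
    have hpow : R ^ (1 - q) = R ^ (-q) * R := by
      rw [show 1 - q = -q + 1 by ring, Real.rpow_add hR, Real.rpow_one]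
    rw [heq, hpow]
    refine (norm_add_le _ _).trans ((add_le_add_left (norm_sub_le _ _) _).trans ?_)
    rw [norm_mul, norm_mul, Complex.norm_I, one_mul, one_mul]
    rw [sub_zero, abs_of_pos hR] at h2 h3
    rw [show R - -R = 2 * R by ring, abs_of_pos (by linarith)] at h1
    linarith
  refine tendsto_nhds_unique hlim (squeeze_zero_norm' (a := fun R : ℝ => 4 * C * R ^ (1 - q)) ?_ ?_)
  · filter_upwards [eventually_gt_atTop 0] with R hR using hbound R hR
  · have := (tendsto_rpow_neg_atTop (by linarith : 0 < q - 1)).const_mul (4 * C)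
    simpa using this

/-- The pole a - δi lies at distance at least δ below the closed half plane, so the distance to the
pole is comparable there with 1 + |w|. This supplies the decay required by the Cauchy theorem. -/
theorem one_add_norm_le_mul_norm_sub {δ : ℝ} (hδ : 0 < δ) (a : ℝ) {w : ℂ} (hw : 0 ≤ w.im) :
    1 + ‖w‖ ≤ ((1 + |a|) / δ + 1) * ‖(a : ℂ) - w - δ * Complex.I‖ := by
  have h1 : δ ≤ ‖(a : ℂ) - w - δ * Complex.I‖ := by
    have := Complex.abs_im_le_norm ((a : ℂ) - w - δ * Complex.I)
    simp only [Complex.sub_im, Complex.ofReal_im, Complex.mul_im, Complex.ofReal_re,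
      Complex.I_im, mul_one, Complex.I_re, mul_zero, add_zero, zero_sub] at this
    rw [abs_of_nonpos (by linarith)] at this
    linarith
  have h2 : ‖w‖ ≤ ‖w + δ * Complex.I‖ := by
    rw [Complex.norm_def, Complex.norm_def]
    refine Real.sqrt_le_sqrt ?_
    simp only [Complex.normSq_apply, Complex.add_re, Complex.mul_re, Complex.ofReal_re,
      Complex.I_re, mul_zero, Complex.ofReal_im, Complex.I_im, mul_one, sub_self, add_zero,
      Complex.add_im, Complex.mul_im]
    nlinarith
  have h3 : ‖w + δ * Complex.I‖ ≤ |a| + ‖(a : ℂ) - w - δ * Complex.I‖ := by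
    have := norm_sub_le (a : ℂ) ((a : ℂ) - w - δ * Complex.I)
    rw [Complex.norm_real, Real.norm_eq_abs] at this
    refine le_trans (le_of_eq ?_) this
    congr 1; ring
  have h4 : 1 + |a| ≤ (1 + |a|) / δ * ‖(a : ℂ) - w - δ * Complex.I‖ := by
    rw [div_mul_eq_mul_div, le_div_iff₀ hδ]
    gcongr
  linarith

theorem norm_inv_sub_le {δ : ℝ} (hδ : 0 < δ) (a : ℝ) {w : ℂ} (hw : 0 ≤ w.im) :
    ‖((a : ℂ) - w - δ * Complex.I)⁻¹‖ ≤ ((1 + |a|) / δ + 1) * (1 + ‖w‖)⁻¹ := by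
  have h := one_add_norm_le_mul_norm_sub hδ a hw
  have h0 : 0 < 1 + ‖w‖ := by positivity
  have h1 : 0 < ‖(a : ℂ) - w - δ * Complex.I‖ := by
    by_contra h'
    have := le_antisymm (not_lt.1 h') (norm_nonneg _)
    rw [this, mul_zero] at h
    linarith
  rw [norm_inv, inv_le_iff_one_le_mul₀ h1, mul_right_comm, ← div_eq_mul_inv, le_div_iff₀ h0]
  linarith

theorem sub_sub_mul_I_ne_zero {δ : ℝ} (hδ : 0 < δ) (a : ℝ) {w : ℂ} (hw : 0 ≤ w.im) :
    (a : ℂ) - w - δ * Complex.I ≠ 0 := by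
  intro h
  have := congrArg Complex.im h
  simp at this
  linarith

/-- Both Poisson kernels come from one analytic Cauchy kernel, so statements about them become
statements in complex analysis. -/
theorem inv_sub_mul_I_eq {ε : ℝ} (hε : 0 < ε) (s : ℝ) :
    ((s : ℂ) - ε * Complex.I)⁻¹ = conjPoissonKer ε s + poissonKer ε s * Complex.I := by
  have h1 : (s : ℂ) - ε * Complex.I ≠ 0 := by
    simpa using sub_sub_mul_I_ne_zero hε s (w := 0) (by simp)
  have h2 : ((s : ℂ) ^ 2 + (ε : ℂ) ^ 2) ≠ 0 := by
    have : (s : ℝ) ^ 2 + ε ^ 2 ≠ 0 := by positivity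
    exact_mod_cast this
  unfold conjPoissonKer poissonKer
  push_cast
  refine inv_eq_of_mul_eq_one_right ?_
  field_simp
  linear_combination (-(ε : ℂ) ^ 2) * Complex.I_sq

/-- The semigroup identity for the conjugate Poisson kernel. -/
theorem integral_poissonKer_mul_conjPoissonKer {ε δ : ℝ} (hε : 0 < ε) (hδ : 0 < δ) (t x : ℝ) :
    ∫ y, poissonKer ε (y - x) * conjPoissonKer δ (t - y) =
      Real.pi * conjPoissonKer (ε + δ) (t - x) := by
  set c : ℂ := ((t - x : ℝ) : ℂ) - ((ε + δ : ℝ) : ℂ) * Complex.I with hc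
  have hc0 : c ≠ 0 := by
    simpa [hc] using sub_sub_mul_I_ne_zero (add_pos hε hδ) (t - x) (w := 0) (by simp)
  obtain ⟨hi, h0⟩ := integral_eq_zero_of_differentiableAt_upperHalfPlane
    (ψ := fun w => ((t : ℂ) - w - δ * Complex.I)⁻¹ * ((x : ℂ) - w - ε * Complex.I)⁻¹)
    (C := ((1 + |t|) / δ + 1) * ((1 + |x|) / ε + 1)) (q := 2) (by norm_num)
    (fun z hz => by
      have h1 := sub_sub_mul_I_ne_zero hδ t hz
      have h2 := sub_sub_mul_I_ne_zero hε x hz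
      fun_prop (disch := assumption))
    (fun z hz => by
      rw [norm_mul]
      have := mul_le_mul (norm_inv_sub_le hδ t hz) (norm_inv_sub_le hε x hz) (norm_nonneg _)
        (by positivity)
      refine this.trans (le_of_eq ?_)
      rw [Real.rpow_neg (by positivity), Real.rpow_ofNat]
      field_simp)
  have hP : Integrable fun y : ℝ => poissonKer ε (y - x) := by
    have := lintegral_poissonKer_sub_right hε x
    refine ⟨((continuous_poissonKer hε).comp (by fun_prop)).aestronglyMeasurable, ?_⟩
    rw [hasFiniteIntegral_iff_ofReal (.of_forall fun y => poissonKer_nonneg hε _), this]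
    exact ENNReal.ofReal_lt_top
  have hPint : ∫ y : ℝ, poissonKer ε (y - x) = Real.pi := by
    rw [integral_eq_lintegral_of_nonneg_ae (.of_forall fun y => poissonKer_nonneg hε _)
      hP.aestronglyMeasurable, lintegral_poissonKer_sub_right hε, ENNReal.toReal_ofReal Real.pi_pos.le]
  -- A partial fraction decomposition: the first summand has a known integral. The second has only
  -- poles below the real axis, so it integrates to zero.
  have key : ∀ y : ℝ, (poissonKer ε (y - x) : ℂ) * ((t : ℂ) - y - δ * Complex.I)⁻¹ =
      c⁻¹ * poissonKer ε (y - x) - ε * c⁻¹ * (((t : ℂ) - y - δ * Complex.I)⁻¹ *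
        ((x : ℂ) - y - ε * Complex.I)⁻¹) := by
    intro y
    have h1 := sub_sub_mul_I_ne_zero hδ t (w := y) (by simp)
    have h2 := sub_sub_mul_I_ne_zero hε x (w := y) (by simp)
    have h3 : ((y - x : ℝ) : ℂ) ^ 2 + (ε : ℂ) ^ 2 ≠ 0 := by
      have : (y - x) ^ 2 + ε ^ 2 ≠ 0 := by positivity
      exact_mod_cast this
    unfold poissonKer
    push_cast at h3 ⊢
    field_simp
    rw [hc]
    push_cast
    ring_nf
    simp only [Complex.I_sq]
    ring
  have hPc : Integrable fun y : ℝ => (poissonKer ε (y - x) : ℂ) := hP.ofReal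
  have hcomplex : ∫ y : ℝ, (poissonKer ε (y - x) : ℂ) * ((t : ℂ) - y - δ * Complex.I)⁻¹ =
      c⁻¹ * Real.pi := by
    simp_rw [key]
    rw [integral_sub (hPc.const_mul _) (hi.const_mul _), integral_const_mul,
      integral_const_mul, h0, integral_complex_ofReal, hPint]
    simp
  have hintC : Integrable fun y : ℝ =>
      (poissonKer ε (y - x) : ℂ) * ((t : ℂ) - y - δ * Complex.I)⁻¹ := by
    simp_rw [key]
    exact (hPc.const_mul _).sub (hi.const_mul _)
  have hre : ∀ y : ℝ, ((poissonKer ε (y - x) : ℂ) * ((t : ℂ) - y - δ * Complex.I)⁻¹).re =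
      poissonKer ε (y - x) * conjPoissonKer δ (t - y) := fun y => by
    have := inv_sub_mul_I_eq hδ (t - y)
    push_cast at this
    rw [this]
    simp
  have h := congrArg Complex.re hcomplex
  have h' := integral_re hintC
  simp only [RCLike.re_to_complex] at h'
  rw [← h'] at h
  simp_rw [hre] at h
  rw [h, hc, inv_sub_mul_I_eq (add_pos hε hδ)]
  simp [mul_comm]

end

/-! ### M. Riesz' inequality for nonnegative functions, 1 < p ≤ 2 -/

noncomputable section

/-- The elementary inequality behind M. Riesz' theorem. -/
theorem exists_abs_im_rpow_le {p : ℝ} (hp : 1 < p) (hp2 : p ≤ 2) :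
    ∃ A B : ℝ, 0 ≤ A ∧ ∀ w : ℂ, 0 < w.re →
      |w.im| ^ p ≤ A * w.re ^ p - B * (w ^ (p : ℂ)).re := by
  have hπ := Real.pi_pos
  have hcos : Real.cos (p * (Real.pi / 2)) < 0 :=
    Real.cos_neg_of_pi_div_two_lt_of_lt (by nlinarith) (by nlinarith)
  -- With this B the left side equals 1 - 2 < 0 at θ = π/2, hence is negative nearby. Away from π/2
  -- the cosine is bounded below, and A absorbs everything. The condition 1 < p ≤ 2 puts pπ/2 in
  -- (π/2, π], where the cosine is negative.
  set B : ℝ := 2 / (-Real.cos (p * (Real.pi / 2))) with hB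
  have hB0 : 0 < B := div_pos two_pos (by linarith)
  have hcont : Continuous fun θ : ℝ => |Real.sin θ| ^ p + B * Real.cos (p * θ) := by
    refine Continuous.add ?_ (by fun_prop)
    exact (continuous_abs.comp Real.continuous_sin).rpow_const fun _ => Or.inr (by linarith)
  have hneg : |Real.sin (Real.pi / 2)| ^ p + B * Real.cos (p * (Real.pi / 2)) < 0 := by
    have h1 : B * Real.cos (p * (Real.pi / 2)) = -2 := by
      rw [hB, div_mul_eq_mul_div, div_eq_iff (by linarith)]; ring
    rw [h1, Real.sin_pi_div_two, abs_one, Real.one_rpow]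
    norm_num
  obtain ⟨η, hη, hηlt⟩ := Metric.eventually_nhds_iff.1
    ((hcont.tendsto (Real.pi / 2)).eventually (gt_mem_nhds hneg))
  set η' := min η (Real.pi / 2) with hη'
  have hη'0 : 0 < η' := lt_min hη (by positivity)
  have hη'π : η' ≤ Real.pi / 2 := min_le_right _ _
  have hsin : 0 < Real.sin η' := Real.sin_pos_of_pos_of_lt_pi hη'0 (by linarith)
  set A : ℝ := (1 + B) / Real.sin η' ^ p with hA
  have hA0 : 0 ≤ A := by positivity
  have main : ∀ θ : ℝ, 0 ≤ θ → θ < Real.pi / 2 →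
      |Real.sin θ| ^ p + B * Real.cos (p * θ) ≤ A * Real.cos θ ^ p := by
    intro θ h0 h1
    have hc : 0 < Real.cos θ := Real.cos_pos_of_mem_Ioo ⟨by linarith, h1⟩
    rcases lt_or_ge (Real.pi / 2 - θ) η' with h | h
    · have := hηlt (y := θ) (by
        rw [Real.dist_eq, abs_sub_comm, abs_of_pos (by linarith)]
        exact h.trans_le (min_le_left _ _))
      exact this.le.trans (by positivity)
    · have h2 : Real.sin η' ≤ Real.cos θ := by
        rw [← Real.sin_pi_div_two_sub]
        exact Real.sin_le_sin_of_le_of_le_pi_div_two (by linarith) (by linarith) h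
      have h3 : |Real.sin θ| ^ p ≤ 1 :=
        Real.rpow_le_one (abs_nonneg _) (Real.abs_sin_le_one θ) (by linarith)
      have h4 : B * Real.cos (p * θ) ≤ B := by nlinarith [Real.cos_le_one (p * θ)]
      calc _ ≤ 1 + B := by linarith
        _ = A * Real.sin η' ^ p := by rw [hA]; field_simp
        _ ≤ _ := by gcongr
  refine ⟨A, B, hA0, fun w hw => ?_⟩
  have hw0 : w ≠ 0 := fun h => by simp [h] at hw
  have hn : 0 < ‖w‖ := norm_pos_iff.2 hw0
  have harg : |Complex.arg w| < Real.pi / 2 := Complex.abs_arg_lt_pi_div_two_iff.2 (Or.inl hw)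
  have hm := main |Complex.arg w| (abs_nonneg _) harg
  have e1 : abs (Real.sin (abs (Complex.arg w))) = abs (Real.sin (Complex.arg w)) := by
    rcases abs_choice (Complex.arg w) with h | h <;> simp [h]
  have e2 : Real.cos (p * |Complex.arg w|) = Real.cos (Complex.arg w * p) := by
    rw [← Real.cos_abs (Complex.arg w * p), abs_mul, abs_of_pos (by linarith : 0 < p), mul_comm]
  rw [e1, e2, Real.cos_abs] at hm
  have him : |w.im| = ‖w‖ * |Real.sin (Complex.arg w)| := by
    rw [Complex.sin_arg, abs_div, abs_of_pos hn]; field_simp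
  have hre : w.re = ‖w‖ * Real.cos (Complex.arg w) := by
    rw [Complex.cos_arg hw0]; field_simp
  have hcn : 0 ≤ Real.cos (Complex.arg w) := by
    rw [Complex.cos_arg hw0]; positivity
  rw [Complex.cpow_ofReal_re, him, hre, Real.mul_rpow hn.le (abs_nonneg _), Real.mul_rpow hn.le hcn]
  have := mul_le_mul_of_nonneg_left hm (Real.rpow_nonneg hn.le p)
  linarith

theorem integrable_conjPoissonKer_mul {f : ℝ → ℝ} (hf : Integrable f) {ε : ℝ} (hε : 0 < ε) (x : ℝ) :
    Integrable fun t => conjPoissonKer ε (t - x) * f t := by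
  refine hf.bdd_mul (c := 1 / ε) (((continuous_conjPoissonKer hε).comp
    (by fun_prop)).aestronglyMeasurable) (.of_forall fun t => ?_)
  unfold conjPoissonKer
  rw [Real.norm_eq_abs, abs_div, abs_of_pos (by positivity : 0 < (t - x) ^ 2 + ε ^ 2),
    div_le_div_iff₀ (by positivity) hε, one_mul, ← sq_abs (t - x)]
  nlinarith [sq_nonneg (|t - x| - ε), abs_nonneg (t - x)]

theorem integrable_poissonKer_mul {f : ℝ → ℝ} (hf : Integrable f) {ε : ℝ} (hε : 0 < ε) (x : ℝ) :
    Integrable fun t => poissonKer ε (t - x) * f t := by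
  refine hf.bdd_mul (c := 1 / ε) (((continuous_poissonKer hε).comp
    (by fun_prop)).aestronglyMeasurable) (.of_forall fun t => ?_)
  rw [Real.norm_eq_abs, abs_of_nonneg (poissonKer_nonneg hε _)]
  unfold poissonKer
  rw [div_le_div_iff₀ (by positivity) hε, one_mul]
  nlinarith [sq_nonneg (t - x)]

/-- The analytic function on the upper half plane whose real part is the Poisson integral of `f`,
shifted by `ε i`. -/
def shiftedCauchy (ε : ℝ) (f : ℝ → ℝ) (w : ℂ) : ℂ :=
  ∫ t : ℝ, -Complex.I * (((t : ℂ) - w - ε * Complex.I)⁻¹ * f t)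

/-- The point w may lie as low as -ε/2, which leaves room for a full complex neighbourhood of each
real point when differentiating under the integral. -/
theorem norm_inv_sub_mul_I_le {ε : ℝ} (hε : 0 < ε) (t : ℝ) {w : ℂ} (hw : -(ε / 2) ≤ w.im) :
    ‖((t : ℂ) - w - ε * Complex.I)⁻¹‖ ≤ 2 / ε := by
  have h1 : ε / 2 ≤ ‖(t : ℂ) - w - ε * Complex.I‖ := by
    have := Complex.abs_im_le_norm ((t : ℂ) - w - ε * Complex.I)
    simp only [Complex.sub_im, Complex.ofReal_im, Complex.mul_im, Complex.ofReal_re,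
      Complex.I_im, mul_one, Complex.I_re, mul_zero, add_zero, zero_sub] at this
    rw [abs_of_nonpos (by linarith)] at this
    linarith
  rw [norm_inv, inv_le_comm₀ (by linarith) (by positivity), inv_div]
  exact h1

theorem continuous_sub_inv {ε : ℝ} (hε : 0 < ε) {w : ℂ} (hw : -(ε / 2) ≤ w.im) :
    Continuous fun t : ℝ => ((t : ℂ) - w - ε * Complex.I)⁻¹ := by
  refine Continuous.inv₀ (by fun_prop) fun t h => ?_
  have := congrArg Complex.im h
  simp at this
  linarith

theorem shiftedCauchy_differentiableAt {f : ℝ → ℝ} (hf : Integrable f) {ε : ℝ} (hε : 0 < ε)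
    {z : ℂ} (hz : 0 ≤ z.im) : DifferentiableAt ℂ (shiftedCauchy ε f) z := by
  have hball : ∀ w ∈ Metric.ball z (ε / 2), -(ε / 2) ≤ w.im := fun w hw => by
    have := (Complex.abs_im_le_norm (w - z)).trans_lt (by simpa [dist_eq_norm] using hw)
    rw [Complex.sub_im] at this
    linarith [(abs_lt.1 this).1]
  have hfc : Integrable fun t => (f t : ℂ) := hf.ofReal
  have h := hasDerivAt_integral_of_dominated_loc_of_deriv_le (μ := volume) (𝕜 := ℂ)
    (F := fun w (t : ℝ) => -Complex.I * (((t : ℂ) - w - ε * Complex.I)⁻¹ * f t))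
    (F' := fun w t => -Complex.I * ((((t : ℂ) - w - ε * Complex.I)⁻¹) ^ 2 * f t)) (x₀ := z)
    (s := Metric.ball z (ε / 2)) (bound := fun t => (2 / ε) ^ 2 * ‖f t‖)
    (Metric.ball_mem_nhds _ (by positivity)) ?_ ?_ ?_ ?_ ?_ ?_
  · exact h.2.differentiableAt
  · filter_upwards [Metric.ball_mem_nhds z (half_pos hε)] with w hw
    exact ((continuous_sub_inv hε (hball w hw)).aestronglyMeasurable.mul
      hfc.aestronglyMeasurable).const_mul _
  · exact (hfc.bdd_mul (c := 2 / ε) (continuous_sub_inv hε (by linarith)).aestronglyMeasurable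
      (.of_forall fun t => norm_inv_sub_mul_I_le hε t (by linarith))).const_mul _
  · exact (((continuous_sub_inv hε (by linarith)).pow 2).aestronglyMeasurable.mul
      hfc.aestronglyMeasurable).const_mul _
  · refine .of_forall fun t w hw => ?_
    rw [norm_mul, norm_neg, Complex.norm_I, one_mul, norm_mul, norm_pow, Complex.norm_real]
    have := norm_inv_sub_mul_I_le hε t (hball w hw)
    gcongr
  · exact (hf.norm).const_mul _
  · refine .of_forall fun t w hw => ?_
    have hne : (t : ℂ) - w - ε * Complex.I ≠ 0 := fun h => by
      have h1 := congrArg Complex.im h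
      have h2 := hball w hw
      simp at h1
      linarith
    have h1 : HasDerivAt (fun w : ℂ => (t : ℂ) - w - ε * Complex.I) (-1) w := by
      simpa using ((hasDerivAt_id w).const_sub (t : ℂ)).sub_const (ε * Complex.I)
    refine (((h1.fun_inv hne).mul_const (f t : ℂ)).const_mul (-Complex.I)).congr_deriv ?_
    rw [neg_neg, inv_pow, one_div]

/-- Bounded support makes the comparison constant uniform in t. The constant depends on R and ε but
serves only to justify Cauchy's theorem, and it does not enter the final inequality. -/
theorem norm_shiftedCauchy_le {f : ℝ → ℝ} (hf : Integrable f) {R : ℝ}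
    (hfR : ∀ t, R < |t| → f t = 0) {ε : ℝ} (hε : 0 < ε) {w : ℂ} (hw : 0 ≤ w.im) :
    ‖shiftedCauchy ε f w‖ ≤ ((1 + R) / ε + 1) * (∫ t, ‖f t‖) * (1 + ‖w‖)⁻¹ := by
  unfold shiftedCauchy
  refine (norm_integral_le_of_norm_le (hf.norm.const_mul
    (((1 + R) / ε + 1) * (1 + ‖w‖)⁻¹)) (.of_forall fun t => ?_)).trans ?_
  · rw [norm_mul, norm_neg, Complex.norm_I, one_mul, norm_mul, Complex.norm_real]
    rcases lt_or_ge R |t| with h | h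
    · simp [hfR t h]
    · gcongr
      refine (norm_inv_sub_le hε t hw).trans ?_
      gcongr
  · rw [integral_const_mul]
    exact le_of_eq (by ring)

theorem shiftedCauchy_integrable {f : ℝ → ℝ} (hf : Integrable f) {ε : ℝ} (hε : 0 < ε)
    {w : ℂ} (hw : 0 ≤ w.im) :
    Integrable fun t : ℝ => -Complex.I * (((t : ℂ) - w - ε * Complex.I)⁻¹ * f t) :=
  ((hf.ofReal (𝕜 := ℂ)).bdd_mul (c := 2 / ε)
    (continuous_sub_inv hε (by linarith)).aestronglyMeasurable
    (.of_forall fun t => norm_inv_sub_mul_I_le hε t (by linarith))).const_mul _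

/-- The real part is the Poisson integral at height Im w + ε of a nonnegative function that does not
vanish almost everywhere. Strict positivity keeps the values off the branch cut of w ↦ w^p. -/
theorem shiftedCauchy_re_pos {f : ℝ → ℝ} (hf : Integrable f) (hf0 : ∀ t, 0 ≤ f t)
    (hne : ¬ f =ᵐ[volume] 0) {ε : ℝ} (hε : 0 < ε) {w : ℂ} (hw : 0 ≤ w.im) :
    0 < (shiftedCauchy ε f w).re := by
  have hi := shiftedCauchy_integrable hf hε hw
  have h := integral_re hi
  simp only [RCLike.re_to_complex] at h
  have hδ : 0 < w.im + ε := by linarith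
  have e : ∀ t : ℝ, (-Complex.I * (((t : ℂ) - w - ε * Complex.I)⁻¹ * f t)).re =
      poissonKer (w.im + ε) (t - w.re) * f t := fun t => by
    have h1 : (t : ℂ) - w - ε * Complex.I = ((t - w.re : ℝ) : ℂ) - ((w.im + ε : ℝ) : ℂ) * Complex.I := by
      apply Complex.ext <;> simp; ring
    rw [h1, inv_sub_mul_I_eq hδ]
    simp
  unfold shiftedCauchy
  rw [← h]
  simp_rw [e]
  rw [integral_pos_iff_support_of_nonneg
    (fun t => mul_nonneg (poissonKer_nonneg hδ _) (hf0 t)) (integrable_poissonKer_mul hf hδ _)]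
  have hs : Function.support (fun t => poissonKer (w.im + ε) (t - w.re) * f t) =
      Function.support f := by
    ext t
    simp [(poissonKer_pos hδ (t - w.re)).ne']
  rw [hs, pos_iff_ne_zero]
  exact fun h0 => hne ((Measure.measure_support_eq_zero_iff volume).1 h0)

theorem shiftedCauchy_ofReal {f : ℝ → ℝ} (hf : Integrable f) {ε : ℝ} (hε : 0 < ε) (x : ℝ) :
    shiftedCauchy ε f x = (∫ t, poissonKer ε (t - x) * f t) -
      (∫ t, conjPoissonKer ε (t - x) * f t) * Complex.I := by
  have e : ∀ t : ℝ, -Complex.I * (((t : ℂ) - x - ε * Complex.I)⁻¹ * f t) =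
      ((poissonKer ε (t - x) * f t : ℝ) : ℂ) -
        ((conjPoissonKer ε (t - x) * f t : ℝ) : ℂ) * Complex.I := fun t => by
    have := inv_sub_mul_I_eq hε (t - x)
    push_cast at this
    rw [this]
    push_cast
    linear_combination (-(poissonKer ε (t - x) : ℂ) * f t) * Complex.I_sq
  unfold shiftedCauchy
  simp_rw [e]
  have i1 : Integrable fun t => ((poissonKer ε (t - x) * f t : ℝ) : ℂ) :=
    (integrable_poissonKer_mul hf hε x).ofReal
  have i2 : Integrable fun t => ((conjPoissonKer ε (t - x) * f t : ℝ) : ℂ) :=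
    (integrable_conjPoissonKer_mul hf hε x).ofReal
  rw [integral_sub i1 (i2.mul_const _), integral_mul_const, integral_complex_ofReal,
    integral_complex_ofReal]

/-- Poisson integrals contract `L^p` up to the normalising factor. -/
theorem lintegral_poisson_rpow_le {p : ℝ} (hp : 1 < p) {ε : ℝ} (hε : 0 < ε) {φ : ℝ → ℝ≥0∞}
    (hφ : AEMeasurable φ) :
    ∫⁻ x, (∫⁻ t, ENNReal.ofReal (poissonKer ε (t - x)) * φ t) ^ p ≤
      ENNReal.ofReal Real.pi ^ p * ∫⁻ t, φ t ^ p := by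
  have hk : Measurable fun z : ℝ × ℝ => ENNReal.ofReal (poissonKer ε (z.2 - z.1)) :=
    ((continuous_poissonKer hε).comp (continuous_snd.sub continuous_fst)).measurable.ennreal_ofReal
  have hm : AEMeasurable (Function.uncurry fun x t : ℝ => ENNReal.ofReal (poissonKer ε (t - x)) * φ t ^ p)
      (volume.prod volume) := hk.aemeasurable.mul (hφ.pow_const p).comp_snd
  have hπ1 : ENNReal.ofReal Real.pi ^ (p - 1) ≠ ∞ :=
    ENNReal.rpow_ne_top_of_nonneg (by linarith) ENNReal.ofReal_ne_top
  calc _ ≤ ∫⁻ x, ENNReal.ofReal Real.pi ^ (p - 1) *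
        ∫⁻ t, ENNReal.ofReal (poissonKer ε (t - x)) * φ t ^ p := by
        refine lintegral_mono fun x => ?_
        have := lintegral_mul_rpow_le (μ := volume) hp
          (w := fun t => ENNReal.ofReal (poissonKer ε (t - x)))
          ((continuous_poissonKer hε).comp
            (continuous_id.sub continuous_const)).measurable.ennreal_ofReal.aemeasurable hφ
        rwa [lintegral_poissonKer_sub_right hε] at this
    _ = ENNReal.ofReal Real.pi ^ (p - 1) *
        ∫⁻ t, ∫⁻ x, ENNReal.ofReal (poissonKer ε (t - x)) * φ t ^ p := by
        rw [lintegral_const_mul' _ _ hπ1, lintegral_lintegral_swap hm]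
    _ = ENNReal.ofReal Real.pi ^ (p - 1) * (ENNReal.ofReal Real.pi * ∫⁻ t, φ t ^ p) := by
        congr 1
        rw [← lintegral_const_mul' _ _ ENNReal.ofReal_ne_top]
        refine lintegral_congr fun t => ?_
        have hk' : Measurable fun x => ENNReal.ofReal (poissonKer ε (t - x)) :=
          ((continuous_poissonKer hε).comp (continuous_const.sub continuous_id)).measurable.ennreal_ofReal
        rw [lintegral_mul_const _ hk', lintegral_poissonKer_sub_left hε]
    _ = _ := by
        rw [← mul_assoc]
        congr 1
        have h0 : ENNReal.ofReal Real.pi ≠ 0 := by simp [Real.pi_pos]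
        conv_lhs => rw [← ENNReal.rpow_one (ENNReal.ofReal Real.pi), ← ENNReal.rpow_mul, one_mul,
          ← ENNReal.rpow_add _ _ h0 ENNReal.ofReal_ne_top, sub_add_cancel]

/-- M. Riesz' inequality for nonnegative integrable functions with bounded support. -/
theorem exists_lintegral_conjPoisson_le_of_nonneg {p : ℝ} (hp : 1 < p) (hp2 : p ≤ 2) :
    ∃ C : ℝ≥0, ∀ (f : ℝ → ℝ) (R : ℝ), Integrable f → (∀ t, 0 ≤ f t) →
      (∀ t, R < |t| → f t = 0) → ∀ ε : ℝ, 0 < ε →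
      ∫⁻ x, ‖∫ t, conjPoissonKer ε (t - x) * f t‖ₑ ^ p ≤ C * ∫⁻ t, ‖f t‖ₑ ^ p := by
  obtain ⟨A, B, hA, hAB⟩ := exists_abs_im_rpow_le hp hp2
  have hp0 : 0 < p := by linarith
  refine ⟨A.toNNReal * (Real.pi.toNNReal) ^ p, fun f R hf hf0 hfR ε hε => ?_⟩
  by_cases hne : f =ᵐ[volume] 0
  · have : ∀ x, ∫ t, conjPoissonKer ε (t - x) * f t = 0 := fun x => by
      rw [integral_eq_zero_of_ae]
      filter_upwards [hne] with t ht
      simp [ht]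
    simp [this, hp0]
  set F := shiftedCauchy ε f
  have hFre : ∀ z : ℂ, 0 ≤ z.im → 0 < (F z).re := fun z hz => shiftedCauchy_re_pos hf hf0 hne hε hz
  -- The maximum guards against a negative R, so that M is nonnegative.
  set M := ((1 + max R 0) / ε + 1) * (∫ t, ‖f t‖) with hM
  have hM0 : 0 ≤ M := mul_nonneg (by positivity) (integral_nonneg fun _ => norm_nonneg _)
  have hFb : ∀ z : ℂ, 0 ≤ z.im → ‖F z‖ ≤ M * (1 + ‖z‖)⁻¹ := fun z hz =>
    norm_shiftedCauchy_le hf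
      (fun t ht => hfR t ((le_max_left _ _).trans_lt ht)) hε hz
  have hFp : ∀ z : ℂ, 0 ≤ z.im → ‖F z‖ ^ p ≤ M ^ p * (1 + ‖z‖) ^ (-p) := fun z hz => by
    have := Real.rpow_le_rpow (norm_nonneg _) (hFb z hz) hp0.le
    rwa [Real.mul_rpow hM0 (by positivity), Real.inv_rpow (by positivity),
      ← Real.rpow_neg (by positivity)] at this
  obtain ⟨hi, h0⟩ := integral_eq_zero_of_differentiableAt_upperHalfPlane
    (ψ := fun z => F z ^ (p : ℂ)) (C := M ^ p) hp
    (fun z hz => (shiftedCauchy_differentiableAt hf hε hz).cpow (by fun_prop)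
      (Complex.mem_slitPlane_iff.2 (Or.inl (hFre z hz))))
    (fun z hz => by
      rw [Complex.norm_cpow_real]
      exact hFp z hz)
  have hFc : Continuous fun x : ℝ => F x := continuous_iff_continuousAt.2 fun x =>
    (shiftedCauchy_differentiableAt hf hε (z := x) (by simp)).continuousAt.comp
      Complex.continuous_ofReal.continuousAt
  have hFip : Integrable fun x : ℝ => ‖F x‖ ^ p := by
    refine Integrable.mono' (g := fun x : ℝ => M ^ p * (1 + ‖x‖) ^ (-p))
      ((integrable_one_add_norm (by simpa using hp)).const_mul _)
      (hFc.norm.rpow_const fun _ => Or.inr hp0.le).aestronglyMeasurable (.of_forall fun x => ?_)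
    rw [Real.norm_of_nonneg (by positivity)]
    simpa using hFp x (by simp)
  have hre : Integrable fun x : ℝ => (F x).re ^ p := by
    refine hFip.mono' ((Complex.continuous_re.comp hFc).rpow_const
      fun _ => Or.inr hp0.le).aestronglyMeasurable (.of_forall fun x => ?_)
    have := (hFre x (by simp)).le
    rw [Real.norm_of_nonneg (by positivity)]
    gcongr
    exact Complex.re_le_norm _
  have him : Integrable fun x : ℝ => |(F x).im| ^ p := by
    refine hFip.mono' (((Complex.continuous_im.comp hFc).abs).rpow_const
      fun _ => Or.inr hp0.le).aestronglyMeasurable (.of_forall fun x => ?_)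
    rw [Real.norm_of_nonneg (by positivity)]
    gcongr
    exact Complex.abs_im_le_norm _
  have hire : Integrable fun x : ℝ => (F x ^ (p : ℂ)).re := hi.re
  have h0' : ∫ x : ℝ, (F x ^ (p : ℂ)).re = 0 := by
    have := integral_re hi
    simp only [RCLike.re_to_complex] at this
    rw [this, h0, Complex.zero_re]
  -- Integrating the pointwise inequality removes the term with B, because Re F^p integrates to
  -- zero.
  have hmain : ∫ x : ℝ, |(F x).im| ^ p ≤ A * ∫ x : ℝ, (F x).re ^ p := by
    have := integral_mono him ((hre.const_mul A).sub (hire.const_mul B))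
      (fun x => hAB (F x) (hFre x (by simp)))
    simp only [Pi.sub_apply] at this
    rwa [integral_sub (hre.const_mul A) (hire.const_mul B), integral_const_mul, integral_const_mul,
      h0', mul_zero, sub_zero] at this
  have eim : ∀ x : ℝ, ‖∫ t, conjPoissonKer ε (t - x) * f t‖ₑ ^ p =
      ENNReal.ofReal (|(F x).im| ^ p) := fun x => by
    have : (F x).im = -∫ t, conjPoissonKer ε (t - x) * f t := by
      simp only [F]
      rw [shiftedCauchy_ofReal hf hε]
      simp
    rw [this, abs_neg, ← ENNReal.ofReal_rpow_of_nonneg (abs_nonneg _) hp0.le,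
      Real.enorm_eq_ofReal_abs]
  have ere : ∀ x : ℝ, ENNReal.ofReal ((F x).re ^ p) =
      (∫⁻ t, ENNReal.ofReal (poissonKer ε (t - x)) * ‖f t‖ₑ) ^ p := fun x => by
    have : (F x).re = ∫ t, poissonKer ε (t - x) * f t := by
      simp only [F]
      rw [shiftedCauchy_ofReal hf hε]
      simp
    rw [← ENNReal.ofReal_rpow_of_nonneg (hFre x (by simp)).le hp0.le, this,
      ofReal_integral_eq_lintegral_ofReal (integrable_poissonKer_mul hf hε x)
        (.of_forall fun t => mul_nonneg (poissonKer_nonneg hε _) (hf0 t))]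
    congr 1
    refine lintegral_congr fun t => ?_
    rw [ENNReal.ofReal_mul (poissonKer_nonneg hε _), Real.enorm_of_nonneg (hf0 t)]
  simp_rw [eim]
  rw [← ofReal_integral_eq_lintegral_ofReal him (.of_forall fun x => by positivity)]
  refine (ENNReal.ofReal_le_ofReal hmain).trans ?_
  rw [ENNReal.ofReal_mul hA, ofReal_integral_eq_lintegral_ofReal hre
    (.of_forall fun x => Real.rpow_nonneg (hFre x (by simp)).le _)]
  simp_rw [ere]
  rw [ENNReal.coe_mul, mul_assoc]
  refine mul_le_mul' le_rfl ((lintegral_poisson_rpow_le hp hε hf.1.enorm).trans (le_of_eq ?_))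
  rw [ENNReal.coe_rpow_of_nonneg _ hp0.le]
  rfl

end

/-! ### Extension to signed L^p functions, 1 < p ≤ 2 -/

noncomputable section

theorem abs_conjPoissonKer_le {ε : ℝ} (hε : 0 < ε) (s : ℝ) :
    |conjPoissonKer ε s| ≤ (1 / ε + 1) * (1 + ‖s‖)⁻¹ := by
  have h0 : 0 < s ^ 2 + ε ^ 2 := by positivity
  have h1 : 0 < 1 + |s| := by positivity
  unfold conjPoissonKer
  rw [Real.norm_eq_abs, abs_div, abs_of_pos h0, ← div_eq_mul_inv, div_le_div_iff₀ h0 h1, ← sq_abs s,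
    div_add_one hε.ne', div_mul_eq_mul_div, le_div_iff₀ hε]
  have h2 : 0 ≤ |s| := abs_nonneg s
  nlinarith [mul_nonneg h2 (sq_nonneg (|s| - ε)), mul_nonneg hε.le (sq_nonneg (|s| - ε)),
    sq_nonneg (|s| - ε), mul_nonneg h2 hε.le, mul_pos hε hε, mul_nonneg h2 h2,
    mul_nonneg hε.le (sq_nonneg ε), mul_nonneg h2 (sq_nonneg ε)]

theorem lintegral_one_add_norm_rpow_lt_top {q : ℝ} (hq : 1 < q) (c : ℝ) :
    ∫⁻ s : ℝ, ENNReal.ofReal (c * (1 + ‖s‖)⁻¹) ^ q < ∞ := by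
  have hq0 : 0 < q := by linarith
  have h := (integrable_one_add_norm (E := ℝ) (μ := volume) (by simpa using hq)).lintegral_lt_top
  calc _ = ∫⁻ s : ℝ, ENNReal.ofReal c ^ q * ENNReal.ofReal ((1 + ‖s‖) ^ (-q)) := by
        refine lintegral_congr fun s => ?_
        rw [ENNReal.ofReal_mul' (by positivity), ENNReal.mul_rpow_of_nonneg _ _ hq0.le,
          ENNReal.ofReal_rpow_of_nonneg (x := (1 + ‖s‖)⁻¹) (by positivity) hq0.le, Real.inv_rpow (by positivity),
          ← Real.rpow_neg (by positivity)]
    _ < ∞ := by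
        rw [lintegral_const_mul' _ _ (by finiteness)]
        finiteness

theorem lintegral_conjPoissonKer_rpow_lt_top {q : ℝ} (hq : 1 < q) {ε : ℝ} (hε : 0 < ε) :
    ∫⁻ s, ‖conjPoissonKer ε s‖ₑ ^ q < ∞ := by
  refine lt_of_le_of_lt (lintegral_mono fun s => ?_)
    (lintegral_one_add_norm_rpow_lt_top hq (1 / ε + 1))
  rw [Real.enorm_eq_ofReal_abs]
  exact ENNReal.rpow_le_rpow (ENNReal.ofReal_le_ofReal (abs_conjPoissonKer_le hε s)) (by linarith)

theorem poissonKer_le_inv {ε : ℝ} (hε : 0 < ε) (s : ℝ) : poissonKer ε s ≤ 1 / ε := by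
  unfold poissonKer
  rw [div_le_div_iff₀ (by positivity) hε]
  nlinarith [sq_nonneg s]

theorem lintegral_poissonKer_rpow_lt_top {q : ℝ} (hq : 1 < q) {ε : ℝ} (hε : 0 < ε) :
    ∫⁻ s, ‖poissonKer ε s‖ₑ ^ q < ∞ := by
  calc _ ≤ ∫⁻ s, ENNReal.ofReal (1 / ε) ^ (q - 1) * ENNReal.ofReal (poissonKer ε s) := by
        refine lintegral_mono fun s => ?_
        rw [Real.enorm_of_nonneg (poissonKer_nonneg hε s)]
        have h0 : ENNReal.ofReal (poissonKer ε s) ≠ 0 := by simpa using poissonKer_pos hε s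
        calc ENNReal.ofReal (poissonKer ε s) ^ q
            = ENNReal.ofReal (poissonKer ε s) ^ (q - 1) * ENNReal.ofReal (poissonKer ε s) := by
              conv_rhs => enter [2]; rw [← ENNReal.rpow_one (ENNReal.ofReal (poissonKer ε s))]
              rw [← ENNReal.rpow_add _ _ h0 ENNReal.ofReal_ne_top, sub_add_cancel]
          _ ≤ _ := by
              gcongr
              exact poissonKer_le_inv hε s
    _ < ∞ := by
        have : ENNReal.ofReal (1 / ε) ^ (q - 1) ≠ ∞ :=
          ENNReal.rpow_ne_top_of_nonneg (by linarith) ENNReal.ofReal_ne_top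
        rw [lintegral_const_mul' _ _ this, lintegral_poissonKer hε]
        exact ENNReal.mul_lt_top this.lt_top ENNReal.ofReal_lt_top

variable {𝕜 : Type*} [RCLike 𝕜]

/-- Hölder's inequality for scalar multiplication by a real kernel. -/
theorem lintegral_enorm_smul_le {X : Type*} [MeasurableSpace X] {μ : Measure X} {p q : ℝ}
    (hpq : q.HolderConjugate p) {k : X → ℝ}
    {f : X → 𝕜} (hk : AEStronglyMeasurable k μ) (hf : AEStronglyMeasurable f μ) :
    ∫⁻ t, ‖k t • f t‖ₑ ∂μ ≤ (∫⁻ t, ‖k t‖ₑ ^ q ∂μ) ^ (1 / q) * (∫⁻ t, ‖f t‖ₑ ^ p ∂μ) ^ (1 / p) := by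
  simpa only [enorm_smul, Pi.mul_apply] using ENNReal.lintegral_mul_le_Lp_mul_Lq μ hpq hk.enorm hf.enorm

theorem integrable_smul_of_lintegral_rpow {X : Type*} [MeasurableSpace X] {μ : Measure X} {p q : ℝ}
    (hpq : q.HolderConjugate p) {k : X → ℝ} {f : X → 𝕜} (hk : AEStronglyMeasurable k μ)
    (hf : AEStronglyMeasurable f μ) (hk' : ∫⁻ t, ‖k t‖ₑ ^ q ∂μ < ∞)
    (hf' : ∫⁻ t, ‖f t‖ₑ ^ p ∂μ < ∞) : Integrable (fun t => k t • f t) μ :=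
  ⟨hk.smul hf, (lintegral_enorm_smul_le hpq hk hf).trans_lt (ENNReal.mul_lt_top
    (ENNReal.rpow_lt_top_of_nonneg (one_div_nonneg.2 hpq.nonneg) hk'.ne)
    (ENNReal.rpow_lt_top_of_nonneg (one_div_nonneg.2 hpq.symm.nonneg) hf'.ne))⟩

theorem aestronglyMeasurable_conjPoissonKer {ε : ℝ} (hε : 0 < ε) (x : ℝ) :
    AEStronglyMeasurable fun t => conjPoissonKer ε (t - x) :=
  ((continuous_conjPoissonKer hε).comp (continuous_id.sub continuous_const)).aestronglyMeasurable

theorem aestronglyMeasurable_poissonKer {ε : ℝ} (hε : 0 < ε) (x : ℝ) :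
    AEStronglyMeasurable fun t => poissonKer ε (t - x) :=
  ((continuous_poissonKer hε).comp (continuous_id.sub continuous_const)).aestronglyMeasurable

theorem integrable_conjPoisson {p : ℝ} (hp : 1 < p) {f : ℝ → 𝕜} (hf : AEStronglyMeasurable f)
    (hfp : ∫⁻ t, ‖f t‖ₑ ^ p < ∞) {ε : ℝ} (hε : 0 < ε) (x : ℝ) :
    Integrable fun t => conjPoissonKer ε (t - x) • f t := by
  have hpq := (Real.HolderConjugate.conjExponent hp).symm
  refine integrable_smul_of_lintegral_rpow hpq (aestronglyMeasurable_conjPoissonKer hε x) hf ?_ hfp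
  rw [lintegral_sub_right_eq_self (fun s => ‖conjPoissonKer ε s‖ₑ ^ _) x]
  exact lintegral_conjPoissonKer_rpow_lt_top hpq.lt hε

theorem integrable_poisson {p : ℝ} (hp : 1 < p) {f : ℝ → 𝕜} (hf : AEStronglyMeasurable f)
    (hfp : ∫⁻ t, ‖f t‖ₑ ^ p < ∞) {ε : ℝ} (hε : 0 < ε) (x : ℝ) :
    Integrable fun t => poissonKer ε (t - x) • f t := by
  have hpq := (Real.HolderConjugate.conjExponent hp).symm
  refine integrable_smul_of_lintegral_rpow hpq (aestronglyMeasurable_poissonKer hε x) hf ?_ hfp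
  rw [lintegral_sub_right_eq_self (fun s => ‖poissonKer ε s‖ₑ ^ _) x]
  exact lintegral_poissonKer_rpow_lt_top hpq.lt hε

/-- The (unnormalised) conjugate Poisson integral. -/
def conjPoisson (ε : ℝ) (f : ℝ → 𝕜) (x : ℝ) : 𝕜 := ∫ t, conjPoissonKer ε (t - x) • f t

theorem aestronglyMeasurable_conjPoisson {f : ℝ → 𝕜} (hf : AEStronglyMeasurable f) {ε : ℝ}
    (hε : 0 < ε) : AEStronglyMeasurable (conjPoisson ε f) := by
  refine AEStronglyMeasurable.integral_prod_right'
    (f := fun z : ℝ × ℝ => conjPoissonKer ε (z.2 - z.1) • f z.2) ?_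
  exact ((continuous_conjPoissonKer hε).comp
    (continuous_snd.sub continuous_fst)).aestronglyMeasurable.smul hf.comp_snd

/-- Fatou's lemma: a uniform bound passes to pointwise limits of the conjugate Poisson integrals. -/
theorem lintegral_conjPoisson_le_of_liminf {p ε : ℝ} {C : ℝ≥0∞}
    {f : ℝ → 𝕜} {g : ℕ → ℝ → 𝕜} (hε : 0 < ε) (hg : ∀ n, AEStronglyMeasurable (g n))
    (hlim : ∀ x, Tendsto (fun n => conjPoisson ε (g n) x) atTop (𝓝 (conjPoisson ε f x)))
    (hC : ∀ n, ∫⁻ x, ‖conjPoisson ε (g n) x‖ₑ ^ p ≤ C) :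
    ∫⁻ x, ‖conjPoisson ε f x‖ₑ ^ p ≤ C := by
  calc _ = ∫⁻ x, liminf (fun n => ‖conjPoisson ε (g n) x‖ₑ ^ p) atTop := by
        refine lintegral_congr fun x => (Tendsto.liminf_eq ?_).symm
        exact (ENNReal.continuous_rpow_const.tendsto _).comp
          ((continuous_enorm.tendsto _).comp (hlim x))
    _ ≤ liminf (fun n => ∫⁻ x, ‖conjPoisson ε (g n) x‖ₑ ^ p) atTop :=
        lintegral_liminf_le' fun n => (aestronglyMeasurable_conjPoisson (hg n) hε).enorm.pow_const p
    _ ≤ C := liminf_le_of_frequently_le' (Frequently.of_forall hC)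

/-- It suffices to prove `L^p` bounds for functions with bounded support. -/
theorem lintegral_conjPoisson_le_of_indicator {p : ℝ} (hp : 1 < p) {C : ℝ≥0} {f : ℝ → 𝕜}
    (hf : AEStronglyMeasurable f) (hfp : ∫⁻ t, ‖f t‖ₑ ^ p < ∞) {ε : ℝ} (hε : 0 < ε)
    (h : ∀ n : ℕ, Integrable ((Metric.closedBall 0 n).indicator f) →
      ∫⁻ x, ‖conjPoisson ε ((Metric.closedBall 0 n).indicator f) x‖ₑ ^ p ≤
        C * ∫⁻ t, ‖(Metric.closedBall 0 n).indicator f t‖ₑ ^ p) :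
    ∫⁻ x, ‖conjPoisson ε f x‖ₑ ^ p ≤ C * ∫⁻ t, ‖f t‖ₑ ^ p := by
  have hp0 : 0 < p := by linarith
  have hms : ∀ n : ℕ, MeasurableSet (Metric.closedBall (0 : ℝ) n) :=
    fun n => Metric.isClosed_closedBall.measurableSet
  refine lintegral_conjPoisson_le_of_liminf hε (fun n => hf.indicator (hms n)) (fun x => ?_)
    (fun n => (h n ?_).trans ?_)
  · refine tendsto_integral_of_dominated_convergence (fun t => ‖conjPoissonKer ε (t - x) • f t‖)
      (fun n => (aestronglyMeasurable_conjPoissonKer hε x).smul (hf.indicator (hms n)))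
      (integrable_conjPoisson hp hf hfp hε x).norm (fun n => .of_forall fun t => ?_)
      (.of_forall fun t => ?_)
    · rw [norm_smul, norm_smul]
      gcongr
      exact norm_indicator_le_norm_self _ _
    · refine tendsto_const_nhds.congr' ?_
      filter_upwards [eventually_ge_atTop ⌈|t|⌉₊] with n hn
      rw [Set.indicator_of_mem]
      simpa using (Nat.ceil_le.1 hn)
  · rw [integrable_indicator_iff (hms n)]
    have : IsFiniteMeasure (volume.restrict (Metric.closedBall (0 : ℝ) n)) :=
      ⟨by rw [Measure.restrict_apply_univ]; exact measure_closedBall_lt_top⟩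
    have : MemLp f (ENNReal.ofReal p) (volume.restrict (Metric.closedBall 0 n)) := by
      refine ⟨hf.restrict, ?_⟩
      rw [eLpNorm_lt_top_iff_lintegral_rpow_enorm_lt_top (by simpa using hp0) ENNReal.ofReal_ne_top,
        ENNReal.toReal_ofReal hp0.le]
      exact (lintegral_mono' Measure.restrict_le_self le_rfl).trans_lt hfp
    exact this.integrable (by simpa using hp.le)
  · gcongr with t
    exact enorm_indicator_le_enorm_self _ _

/-- M. Riesz' inequality for real functions, `1 < p ≤ 2`. -/
theorem exists_lintegral_conjPoisson_le_real {p : ℝ} (hp : 1 < p) (hp2 : p ≤ 2) :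
    ∃ C : ℝ≥0, ∀ f : ℝ → ℝ, AEStronglyMeasurable f → ∫⁻ t, ‖f t‖ₑ ^ p < ∞ → ∀ ε : ℝ, 0 < ε →
      ∫⁻ x, ‖conjPoisson ε f x‖ₑ ^ p ≤ C * ∫⁻ t, ‖f t‖ₑ ^ p := by
  obtain ⟨C, hC⟩ := exists_lintegral_conjPoisson_le_of_nonneg hp hp2
  have hp0 : 0 < p := by linarith
  have hnn : ∀ f : ℝ → ℝ, AEStronglyMeasurable f → ∫⁻ t, ‖f t‖ₑ ^ p < ∞ → (∀ t, 0 ≤ f t) →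
      ∀ ε : ℝ, 0 < ε → ∫⁻ x, ‖conjPoisson ε f x‖ₑ ^ p ≤ C * ∫⁻ t, ‖f t‖ₑ ^ p := by
    intro f hf hfp hf0 ε hε
    refine lintegral_conjPoisson_le_of_indicator hp hf hfp hε fun n hn => ?_
    refine hC _ n hn (fun t => Set.indicator_nonneg (fun t _ => hf0 t) t) (fun t ht => ?_) ε hε
    exact Set.indicator_of_notMem (by simpa using ht) _
  -- Splitting into positive and negative parts costs 2^(p-1) by convexity, and each part
  -- contributes C: in total 2^(p-1) · 2C.
  refine ⟨2 ^ p * C, fun f hf hfp ε hε => ?_⟩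
  have m1 : AEStronglyMeasurable fun t => max (f t) 0 :=
    (continuous_id.max continuous_const).comp_aestronglyMeasurable hf
  have m2 : AEStronglyMeasurable fun t => max (-f t) 0 :=
    (continuous_neg.max continuous_const).comp_aestronglyMeasurable hf
  have le1 : ∀ t, ‖max (f t) 0‖ₑ ^ p ≤ ‖f t‖ₑ ^ p := fun t => by
    refine ENNReal.rpow_le_rpow ?_ hp0.le
    rw [enorm_le_iff_norm_le, Real.norm_of_nonneg (le_max_right _ _), Real.norm_eq_abs]
    exact max_le (le_abs_self _) (abs_nonneg _)
  have le2 : ∀ t, ‖max (-f t) 0‖ₑ ^ p ≤ ‖f t‖ₑ ^ p := fun t => by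
    refine ENNReal.rpow_le_rpow ?_ hp0.le
    rw [enorm_le_iff_norm_le, Real.norm_of_nonneg (le_max_right _ _), Real.norm_eq_abs]
    exact max_le (neg_le_abs _) (abs_nonneg _)
  have i1 := (lintegral_mono le1).trans_lt hfp
  have i2 := (lintegral_mono le2).trans_lt hfp
  have hsub : ∀ x, conjPoisson ε f x = conjPoisson ε (fun t => max (f t) 0) x -
      conjPoisson ε (fun t => max (-f t) 0) x := fun x => by
    unfold conjPoisson
    rw [← integral_sub (integrable_conjPoisson hp m1 i1 hε x) (integrable_conjPoisson hp m2 i2 hε x)]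
    congr 1
    ext t
    rw [← smul_sub]
    congr 1
    rcases le_total (f t) 0 with h | h <;> simp [h]
  calc ∫⁻ x, ‖conjPoisson ε f x‖ₑ ^ p
      ≤ ∫⁻ x, 2 ^ (p - 1) * (‖conjPoisson ε (fun t => max (f t) 0) x‖ₑ ^ p +
          ‖conjPoisson ε (fun t => max (-f t) 0) x‖ₑ ^ p) := by
        refine lintegral_mono fun x => ?_
        rw [hsub]
        exact (ENNReal.rpow_le_rpow enorm_sub_le hp0.le).trans
          (ENNReal.rpow_add_le_mul_rpow_add_rpow _ _ hp.le)
    _ = 2 ^ (p - 1) * ((∫⁻ x, ‖conjPoisson ε (fun t => max (f t) 0) x‖ₑ ^ p) +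
          ∫⁻ x, ‖conjPoisson ε (fun t => max (-f t) 0) x‖ₑ ^ p) := by
        rw [lintegral_const_mul' _ _ (by finiteness), lintegral_add_left']
        exact (aestronglyMeasurable_conjPoisson m1 hε).enorm.pow_const p
    _ ≤ 2 ^ (p - 1) * (C * (∫⁻ t, ‖f t‖ₑ ^ p) + C * ∫⁻ t, ‖f t‖ₑ ^ p) := by
        gcongr
        · exact (hnn _ m1 i1 (fun t => le_max_right _ _) ε hε).trans (mul_le_mul' le_rfl (lintegral_mono le1))
        · exact (hnn _ m2 i2 (fun t => le_max_right _ _) ε hε).trans (mul_le_mul' le_rfl (lintegral_mono le2))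
    _ = _ := by
        rw [← two_mul, ← mul_assoc, ← mul_assoc, ENNReal.coe_mul,
          ENNReal.coe_rpow_of_nonneg _ hp0.le]
        congr 2
        conv_lhs => enter [2]; rw [← ENNReal.rpow_one 2]
        rw [← ENNReal.rpow_add _ _ (by norm_num) (by norm_num), sub_add_cancel]
        rfl

end

/-! ### Duality, and M. Riesz' inequality for all p > 1 -/

noncomputable section

theorem conjPoissonKer_neg (ε s : ℝ) : conjPoissonKer ε (-s) = -conjPoissonKer ε s := by
  unfold conjPoissonKer
  rw [neg_sq, neg_div]

/-- Young's inequality, with f in L^1 and the kernel in L^p. The bound depends on ε, but finiteness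
is all that the duality argument needs in order to divide. -/
theorem lintegral_conjPoisson_lt_top_of_integrable {p : ℝ} (hp : 1 < p) {f : ℝ → ℝ}
    (hf : Integrable f) {ε : ℝ} (hε : 0 < ε) : ∫⁻ x, ‖conjPoisson ε f x‖ₑ ^ p < ∞ := by
  have hm : AEMeasurable (Function.uncurry fun x t : ℝ => ‖f t‖ₑ * ‖conjPoissonKer ε (t - x)‖ₑ ^ p)
      (volume.prod volume) := by
    refine hf.1.enorm.comp_snd.mul (AEMeasurable.pow_const ?_ _)
    exact ((continuous_conjPoissonKer hε).comp
      (continuous_snd.sub continuous_fst)).aestronglyMeasurable.enorm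
  have hfin : (∫⁻ t, ‖f t‖ₑ) ^ (p - 1) ≠ ∞ :=
    ENNReal.rpow_ne_top_of_nonneg (by linarith) hf.2.ne
  calc _ ≤ ∫⁻ x, (∫⁻ t, ‖f t‖ₑ) ^ (p - 1) * ∫⁻ t, ‖f t‖ₑ * ‖conjPoissonKer ε (t - x)‖ₑ ^ p := by
        refine lintegral_mono fun x => ?_
        refine le_trans ?_ (lintegral_mul_rpow_le hp hf.1.enorm
          (aestronglyMeasurable_conjPoissonKer hε x).enorm)
        refine ENNReal.rpow_le_rpow ?_ (by linarith)
        refine (enorm_integral_le_lintegral_enorm _).trans (lintegral_mono fun t => ?_)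
        rw [enorm_smul, mul_comm]
    _ = (∫⁻ t, ‖f t‖ₑ) ^ (p - 1) * ((∫⁻ t, ‖f t‖ₑ) * ∫⁻ s, ‖conjPoissonKer ε s‖ₑ ^ p) := by
        rw [lintegral_const_mul' _ _ hfin, lintegral_lintegral_swap hm,
          ← lintegral_mul_const'' _ hf.1.enorm]
        congr 1
        refine lintegral_congr fun t => ?_
        rw [lintegral_const_mul' _ _ enorm_ne_top,
          lintegral_sub_left_eq_self (fun s => ‖conjPoissonKer ε s‖ₑ ^ p) t]
    _ < ∞ := by
        exact ENNReal.mul_lt_top hfin.lt_top (ENNReal.mul_lt_top hf.2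
          (lintegral_conjPoissonKer_rpow_lt_top hp hε))

/-- The conjugate Poisson integral is antisymmetric. -/
theorem integral_conjPoisson_mul {p q : ℝ} (hpq : p.HolderConjugate q) {f w : ℝ → ℝ}
    (hf : Integrable f) (hw : AEStronglyMeasurable w) (hwq : ∫⁻ t, ‖w t‖ₑ ^ q < ∞)
    {ε : ℝ} (hε : 0 < ε) :
    ∫ x, w x * conjPoisson ε f x = -∫ t, f t * conjPoisson ε w t := by
  set K : ℝ → ℝ → ℝ := fun t x => f t * (conjPoissonKer ε (t - x) * w x) with hK
  have hKm : AEStronglyMeasurable (Function.uncurry K) (volume.prod volume) := by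
    refine hf.1.comp_fst.mul (AEStronglyMeasurable.mul ?_ hw.comp_snd)
    exact ((continuous_conjPoissonKer hε).comp
      (continuous_fst.sub continuous_snd)).aestronglyMeasurable
  have hb : ∀ t, ∫⁻ x, ‖conjPoissonKer ε (t - x)‖ₑ * ‖w x‖ₑ ≤
      (∫⁻ s, ‖conjPoissonKer ε s‖ₑ ^ p) ^ (1 / p) * (∫⁻ x, ‖w x‖ₑ ^ q) ^ (1 / q) := fun t => by
    have hkt : AEStronglyMeasurable fun x => conjPoissonKer ε (t - x) :=
      ((continuous_conjPoissonKer hε).comp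
        (continuous_const.sub continuous_id)).aestronglyMeasurable
    have := lintegral_enorm_smul_le hpq hkt hw
    simp only [enorm_smul] at this
    rwa [lintegral_sub_left_eq_self (fun s => ‖conjPoissonKer ε s‖ₑ ^ p) t] at this
  have hKint : Integrable (Function.uncurry K) (volume.prod volume) := by
    refine ⟨hKm, ?_⟩
    rw [HasFiniteIntegral, lintegral_prod _ hKm.enorm]
    calc _ = ∫⁻ t, ‖f t‖ₑ * ∫⁻ x, ‖conjPoissonKer ε (t - x)‖ₑ * ‖w x‖ₑ := by
          refine lintegral_congr fun t => ?_
          simp only [Function.uncurry, hK, enorm_mul]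
          rw [lintegral_const_mul' _ _ enorm_ne_top]
      _ ≤ ∫⁻ t, ‖f t‖ₑ * ((∫⁻ s, ‖conjPoissonKer ε s‖ₑ ^ p) ^ (1 / p) *
            (∫⁻ x, ‖w x‖ₑ ^ q) ^ (1 / q)) := by
          gcongr with t; exact hb t
      _ < ∞ := by
          rw [lintegral_mul_const'' _ hf.1.enorm]
          exact ENNReal.mul_lt_top hf.2 (ENNReal.mul_lt_top
            (ENNReal.rpow_lt_top_of_nonneg (one_div_nonneg.2 hpq.nonneg)
              (lintegral_conjPoissonKer_rpow_lt_top hpq.lt hε).ne)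
            (ENNReal.rpow_lt_top_of_nonneg (one_div_nonneg.2 hpq.symm.nonneg) hwq.ne))
  calc ∫ x, w x * conjPoisson ε f x = ∫ x, ∫ t, K t x := by
        refine integral_congr_ae (.of_forall fun x => ?_)
        simp only [conjPoisson, hK, smul_eq_mul]
        rw [← integral_const_mul]
        refine integral_congr_ae (.of_forall fun t => ?_)
        ring
    _ = ∫ t, ∫ x, K t x := (integral_integral_swap hKint).symm
    _ = _ := by
        rw [← integral_neg]
        refine integral_congr_ae (.of_forall fun t => ?_)
        simp only [conjPoisson, hK, smul_eq_mul]
        rw [integral_const_mul, ← mul_neg, ← integral_neg]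
        congr 1
        refine integral_congr_ae (.of_forall fun x => ?_)
        simp only
        rw [← neg_sub x t, conjPoissonKer_neg]
        ring

/-- Transfer of the `L^q` bound for conjugate Poisson integrals to the dual exponent. -/
theorem lintegral_conjPoisson_le_of_dual {p q : ℝ} (hpq : p.HolderConjugate q) {C : ℝ≥0}
    (hC : ∀ f : ℝ → ℝ, AEStronglyMeasurable f → ∫⁻ t, ‖f t‖ₑ ^ q < ∞ → ∀ ε : ℝ, 0 < ε →
      ∫⁻ x, ‖conjPoisson ε f x‖ₑ ^ q ≤ C * ∫⁻ t, ‖f t‖ₑ ^ q)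
    {f : ℝ → ℝ} (hf : AEStronglyMeasurable f) (hfp : ∫⁻ t, ‖f t‖ₑ ^ p < ∞) {ε : ℝ} (hε : 0 < ε) :
    ∫⁻ x, ‖conjPoisson ε f x‖ₑ ^ p ≤ (C ^ (p / q) : ℝ≥0) * ∫⁻ t, ‖f t‖ₑ ^ p := by
  have hp := hpq.lt
  have hp0 := hpq.pos
  have hq0 := hpq.symm.pos
  refine lintegral_conjPoisson_le_of_indicator hp hf hfp hε fun n hn => ?_
  set g := (Metric.closedBall (0 : ℝ) n).indicator f
  set u := conjPoisson ε g with hu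
  have hum : AEStronglyMeasurable u := aestronglyMeasurable_conjPoisson hn.1 hε
  set U := ∫⁻ x, ‖u x‖ₑ ^ p with hUdef
  have hU : U < ∞ := lintegral_conjPoisson_lt_top_of_integrable hp hn hε
  -- The extremal function for L^p duality: wu = |u|^p and |w|^q ≤ |u|^p.
  set w : ℝ → ℝ := fun x => SignType.sign (u x) * |u x| ^ (p - 1) with hw
  have hwu : ∀ x, w x * u x = |u x| ^ p := fun x => by
    rw [hw]
    simp only
    rw [mul_right_comm, sign_mul_self]
    rcases eq_or_ne (u x) 0 with h | h
    · simp [h, hp0.ne']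
    · rw [← Real.rpow_one_add' (abs_nonneg _) (by linarith), add_sub_cancel]
  have hsign : Measurable fun y : ℝ => ((SignType.sign y : SignType) : ℝ) := by
    have : (fun y : ℝ => ((SignType.sign y : SignType) : ℝ)) =
        fun y => if 0 < y then 1 else if y < 0 then -1 else 0 := by
      ext y
      rw [sign_apply]
      split_ifs <;> simp
    rw [this]
    exact Measurable.ite measurableSet_Ioi measurable_const
      (Measurable.ite measurableSet_Iio measurable_const measurable_const)
  have hwm : AEStronglyMeasurable w := by
    refine AEMeasurable.aestronglyMeasurable ?_
    exact (hsign.comp_aemeasurable hum.aemeasurable).mul (hum.norm.aemeasurable.pow_const _)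
  have hwle : ∀ x, ‖w x‖ₑ ^ q ≤ ‖u x‖ₑ ^ p := fun x => by
    have h1 : ‖w x‖ₑ ≤ ‖u x‖ₑ ^ (p - 1) := by
      rw [hw]
      simp only
      rw [enorm_mul, Real.enorm_eq_ofReal_abs, Real.enorm_eq_ofReal_abs, Real.enorm_eq_ofReal_abs,
        abs_of_nonneg (a := |u x| ^ (p - 1)) (by positivity),
        ENNReal.ofReal_rpow_of_nonneg (abs_nonneg _) (by linarith)]
      refine (mul_le_mul' (?_ : _ ≤ (1 : ℝ≥0∞)) le_rfl).trans (one_mul _).le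
      rw [ENNReal.ofReal_le_one]
      rcases SignType.trichotomy (SignType.sign (u x)) with h | h | h <;> simp [h]
    calc ‖w x‖ₑ ^ q ≤ (‖u x‖ₑ ^ (p - 1)) ^ q := ENNReal.rpow_le_rpow h1 hq0.le
      _ = _ := by rw [← ENNReal.rpow_mul, hpq.sub_one_mul_conj]
  have hwq : ∫⁻ x, ‖w x‖ₑ ^ q ≤ U := lintegral_mono hwle
  have hdual := integral_conjPoisson_mul hpq hn hwm (hwq.trans_lt hU) hε
  have hUeq : U = ENNReal.ofReal (∫ x, w x * u x) := by
    rw [integral_congr_ae (.of_forall hwu), ofReal_integral_eq_lintegral_ofReal]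
    · refine lintegral_congr fun x => ?_
      rw [Real.enorm_eq_ofReal_abs, ENNReal.ofReal_rpow_of_nonneg (abs_nonneg _) hp0.le]
    · refine ⟨((hum.norm).aemeasurable.pow_const p).aestronglyMeasurable, ?_⟩
      rw [hasFiniteIntegral_iff_ofReal (.of_forall fun x => by positivity)]
      refine lt_of_le_of_lt (lintegral_mono fun x => ?_) hU
      rw [Real.enorm_eq_ofReal_abs, ENNReal.ofReal_rpow_of_nonneg (abs_nonneg _) hp0.le]
    · exact .of_forall fun x => by positivity
  have hle : U ≤ (∫⁻ t, ‖g t‖ₑ ^ p) ^ (1 / p) * (C * U) ^ (1 / q) := by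
    calc U ≤ ‖∫ x, w x * u x‖ₑ := by
          rw [hUeq, Real.enorm_eq_ofReal_abs]; exact ENNReal.ofReal_le_ofReal (le_abs_self _)
      _ ≤ ∫⁻ t, ‖g t • conjPoisson ε w t‖ₑ := by
          rw [hdual, enorm_neg]; exact enorm_integral_le_lintegral_enorm _
      _ ≤ (∫⁻ t, ‖g t‖ₑ ^ p) ^ (1 / p) * (∫⁻ t, ‖conjPoisson ε w t‖ₑ ^ q) ^ (1 / q) :=
          lintegral_enorm_smul_le hpq hn.1 (aestronglyMeasurable_conjPoisson hwm hε)
      _ ≤ _ := by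
          gcongr
          exact (hC w hwm (hwq.trans_lt hU) ε hε).trans (by gcongr)
  rcases eq_or_ne U 0 with h0 | h0
  · rw [h0]; exact zero_le
  have hsum : 1 / p + 1 / q = 1 := by simpa using hpq.inv_add_inv_eq_one
  have hUp : U ^ (1 / p) * U ^ (1 / q) = U := by
    rw [← ENNReal.rpow_add _ _ h0 hU.ne, hsum, ENNReal.rpow_one]
  have hUq0 : U ^ (1 / q) ≠ 0 := by simp [h0, hU.ne]
  have hUqt : U ^ (1 / q) ≠ ∞ := ENNReal.rpow_ne_top_of_nonneg (by positivity) hU.ne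
  -- The inequality U ≤ ‖g‖_p (C U)^(1/q) is divided by U^(1/q), which is neither 0 nor ∞.
  have h1 : U ^ (1 / p) ≤ (∫⁻ t, ‖g t‖ₑ ^ p) ^ (1 / p) * (C : ℝ≥0∞) ^ (1 / q) := by
    rw [← ENNReal.mul_le_mul_iff_left hUq0 hUqt, hUp]
    rwa [ENNReal.mul_rpow_of_nonneg _ _ (by positivity), ← mul_assoc] at hle
  have h2 := ENNReal.rpow_le_rpow h1 hp0.le
  rw [← ENNReal.rpow_mul, one_div_mul_cancel hp0.ne', ENNReal.rpow_one,
    ENNReal.mul_rpow_of_nonneg _ _ hp0.le, ← ENNReal.rpow_mul, one_div_mul_cancel hp0.ne',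
    ENNReal.rpow_one, ← ENNReal.rpow_mul] at h2
  refine h2.trans (le_of_eq ?_)
  rw [mul_comm, ENNReal.coe_rpow_of_nonneg _ (by positivity)]
  congr 2
  ring

/-- M. Riesz' inequality for real functions. -/
theorem exists_lintegral_conjPoisson_le_real' {p : ℝ} (hp : 1 < p) :
    ∃ C : ℝ≥0, ∀ f : ℝ → ℝ, AEStronglyMeasurable f → ∫⁻ t, ‖f t‖ₑ ^ p < ∞ → ∀ ε : ℝ, 0 < ε →
      ∫⁻ x, ‖conjPoisson ε f x‖ₑ ^ p ≤ C * ∫⁻ t, ‖f t‖ₑ ^ p := by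
  rcases le_total p 2 with h | h
  · exact exists_lintegral_conjPoisson_le_real hp h
  · have hpq := Real.HolderConjugate.conjExponent hp
    have hq : Real.conjExponent p ≤ 2 := by
      unfold Real.conjExponent
      rw [div_le_iff₀ (by linarith)]
      linarith
    obtain ⟨C, hC⟩ := exists_lintegral_conjPoisson_le_real hpq.symm.lt hq
    exact ⟨_, fun f hf hfp ε hε => lintegral_conjPoisson_le_of_dual hpq hC hf hfp hε⟩

variable (𝕜 : Type*) [RCLike 𝕜]

/-- M. Riesz' inequality, in terms of conjugate Poisson integrals. -/
theorem exists_lintegral_conjPoisson_le {p : ℝ} (hp : 1 < p) :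
    ∃ C : ℝ≥0, ∀ f : ℝ → 𝕜, AEStronglyMeasurable f → ∫⁻ t, ‖f t‖ₑ ^ p < ∞ → ∀ ε : ℝ, 0 < ε →
      ∫⁻ x, ‖conjPoisson ε f x‖ₑ ^ p ≤ C * ∫⁻ t, ‖f t‖ₑ ^ p := by
  obtain ⟨C, hC⟩ := exists_lintegral_conjPoisson_le_real' hp
  have hp0 : 0 < p := by linarith
  refine ⟨2 ^ p * C, fun f hf hfp ε hε => ?_⟩
  have m1 : AEStronglyMeasurable fun t => RCLike.re (f t) :=
    RCLike.continuous_re.comp_aestronglyMeasurable hf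
  have m2 : AEStronglyMeasurable fun t => RCLike.im (f t) :=
    RCLike.continuous_im.comp_aestronglyMeasurable hf
  have le1 : ∀ t, ‖RCLike.re (f t)‖ₑ ^ p ≤ ‖f t‖ₑ ^ p := fun t =>
    ENNReal.rpow_le_rpow (enorm_le_iff_norm_le.2 (RCLike.norm_re_le_norm _)) hp0.le
  have le2 : ∀ t, ‖RCLike.im (f t)‖ₑ ^ p ≤ ‖f t‖ₑ ^ p := fun t =>
    ENNReal.rpow_le_rpow (enorm_le_iff_norm_le.2 (RCLike.norm_im_le_norm _)) hp0.le
  have i1 := (lintegral_mono le1).trans_lt hfp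
  have i2 := (lintegral_mono le2).trans_lt hfp
  have hre : ∀ x, RCLike.re (conjPoisson ε f x) = conjPoisson ε (fun t => RCLike.re (f t)) x :=
    fun x => by
      unfold conjPoisson
      rw [← integral_re (integrable_conjPoisson hp hf hfp hε x)]
      simp_rw [RCLike.smul_re, smul_eq_mul]
  have him : ∀ x, RCLike.im (conjPoisson ε f x) = conjPoisson ε (fun t => RCLike.im (f t)) x :=
    fun x => by
      unfold conjPoisson
      rw [← integral_im (integrable_conjPoisson hp hf hfp hε x)]
      simp_rw [RCLike.smul_im, smul_eq_mul]
  calc ∫⁻ x, ‖conjPoisson ε f x‖ₑ ^ p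
      ≤ ∫⁻ x, 2 ^ (p - 1) * (‖conjPoisson ε (fun t => RCLike.re (f t)) x‖ₑ ^ p +
          ‖conjPoisson ε (fun t => RCLike.im (f t)) x‖ₑ ^ p) := by
        refine lintegral_mono fun x => ?_
        refine le_trans (ENNReal.rpow_le_rpow ?_ hp0.le)
          (ENNReal.rpow_add_le_mul_rpow_add_rpow _ _ hp.le)
        rw [← hre, ← him]
        have h : ‖conjPoisson ε f x‖ ≤ |RCLike.re (conjPoisson ε f x)| +
            |RCLike.im (conjPoisson ε f x)| := by
          refine abs_le_of_sq_le_sq' ?_ (by positivity) |>.2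
          rw [RCLike.norm_sq_eq_def, add_sq, sq_abs, sq_abs]
          nlinarith [abs_nonneg (RCLike.re (conjPoisson ε f x)),
            abs_nonneg (RCLike.im (conjPoisson ε f x)),
            mul_nonneg (abs_nonneg (RCLike.re (conjPoisson ε f x)))
              (abs_nonneg (RCLike.im (conjPoisson ε f x)))]
        rw [← ofReal_norm, Real.enorm_eq_ofReal_abs, Real.enorm_eq_ofReal_abs,
          ← ENNReal.ofReal_add (abs_nonneg _) (abs_nonneg _)]
        exact ENNReal.ofReal_le_ofReal h
    _ = 2 ^ (p - 1) * ((∫⁻ x, ‖conjPoisson ε (fun t => RCLike.re (f t)) x‖ₑ ^ p) +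
          ∫⁻ x, ‖conjPoisson ε (fun t => RCLike.im (f t)) x‖ₑ ^ p) := by
        rw [lintegral_const_mul' _ _ (by finiteness), lintegral_add_left']
        exact (aestronglyMeasurable_conjPoisson m1 hε).enorm.pow_const p
    _ ≤ 2 ^ (p - 1) * (C * (∫⁻ t, ‖f t‖ₑ ^ p) + C * ∫⁻ t, ‖f t‖ₑ ^ p) := by
        gcongr
        · exact (hC _ m1 i1 ε hε).trans (mul_le_mul' le_rfl (lintegral_mono le1))
        · exact (hC _ m2 i2 ε hε).trans (mul_le_mul' le_rfl (lintegral_mono le2))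
    _ = _ := by
        rw [← two_mul, ← mul_assoc, ← mul_assoc, ENNReal.coe_mul,
          ENNReal.coe_rpow_of_nonneg _ hp0.le]
        congr 2
        conv_lhs => enter [2]; rw [← ENNReal.rpow_one 2]
        rw [← ENNReal.rpow_add _ _ (by norm_num) (by norm_num), sub_add_cancel]
        rfl

end

/-! ### The Hilbert transform of Lipschitz functions and its Poisson integrals -/

noncomputable section

theorem eLpNorm_ofReal_eq {X E : Type*} [MeasurableSpace X] [NormedAddCommGroup E] {μ : Measure X}
    {p : ℝ} (hp : 0 < p) (f : X → E) :
    eLpNorm f (ENNReal.ofReal p) μ = (∫⁻ t, ‖f t‖ₑ ^ p ∂μ) ^ (1 / p) := by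
  rw [eLpNorm_eq_lintegral_rpow_enorm_toReal (by simpa using hp) ENNReal.ofReal_ne_top,
    ENNReal.toReal_ofReal hp.le]

theorem memLp_ofReal_iff {X E : Type*} [MeasurableSpace X] [NormedAddCommGroup E] {μ : Measure X}
    {p : ℝ} (hp : 0 < p) {f : X → E} (hf : AEStronglyMeasurable f μ) :
    MemLp f (ENNReal.ofReal p) μ ↔ ∫⁻ t, ‖f t‖ₑ ^ p ∂μ < ∞ := by
  rw [MemLp, and_iff_right hf, eLpNorm_ofReal_eq hp]
  exact ENNReal.rpow_lt_top_iff_of_pos (by positivity)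

theorem integral_eq_zero_of_odd {E : Type*} [NormedAddCommGroup E] [NormedSpace ℝ E] {φ : ℝ → E}
    (h : ∀ s, φ (-s) = -φ s) : ∫ s, φ s = 0 := by
  have h1 := integral_neg_eq_self φ volume
  simp_rw [h, integral_neg] at h1
  have h2 : (2 : ℝ) • ∫ s, φ s = 0 := by
    rw [two_smul]
    nth_rewrite 1 [← h1]
    exact neg_add_cancel _
  exact (smul_eq_zero.1 h2).resolve_left two_ne_zero

theorem integral_sub_eq_zero_of_odd {E : Type*} [NormedAddCommGroup E] [NormedSpace ℝ E] {φ : ℝ → E}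
    (h : ∀ s, φ (-s) = -φ s) (x : ℝ) : ∫ t, φ (t - x) = 0 := by
  rw [integral_sub_right_eq_self φ x, integral_eq_zero_of_odd h]

theorem abs_conjPoissonKer_le_inv {ε : ℝ} (hε : 0 < ε) (s : ℝ) : |conjPoissonKer ε s| ≤ 1 / ε := by
  unfold conjPoissonKer
  rw [abs_div, abs_of_pos (by positivity : 0 < s ^ 2 + ε ^ 2),
    div_le_div_iff₀ (by positivity) hε, one_mul, ← sq_abs s]
  nlinarith [sq_nonneg (|s| - ε), abs_nonneg s]

theorem abs_conjPoissonKer_le_inv_abs (ε s : ℝ) : |conjPoissonKer ε s| ≤ |s|⁻¹ := by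
  rcases eq_or_ne s 0 with rfl | hs
  · simp [conjPoissonKer]
  unfold conjPoissonKer
  have hs' : 0 < |s| := abs_pos.2 hs
  have h : 0 < s ^ 2 := by positivity
  rw [abs_div, abs_of_pos (by positivity : 0 < s ^ 2 + ε ^ 2), ← one_div,
    div_le_div_iff₀ (by positivity) hs', ← sq, sq_abs, one_mul]
  nlinarith [sq_nonneg ε]

theorem tendsto_conjPoissonKer (s : ℝ) :
    Tendsto (fun ε => conjPoissonKer ε s) (𝓝[>] 0) (𝓝 s⁻¹) := by
  rcases eq_or_ne s 0 with rfl | hs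
  · simp [conjPoissonKer]
  have h : ContinuousAt (fun ε => conjPoissonKer ε s) 0 := by
    unfold conjPoissonKer
    exact continuousAt_const.div (by fun_prop) (by positivity)
  have h1 := h.tendsto.mono_left (nhdsWithin_le_nhds (s := Set.Ioi 0))
  have e : conjPoissonKer 0 s = s⁻¹ := by
    unfold conjPoissonKer; field_simp; ring
  rwa [e] at h1

variable {𝕜 : Type*} [RCLike 𝕜]

/-- The Hilbert transform of a Lipschitz integrable function, as an absolutely convergent
integral. -/
def smoothHilbert (f : ℝ → 𝕜) (x : ℝ) : 𝕜 :=
  ∫ t, (t - x)⁻¹ • (f t - (Metric.closedBall x 1).indicator (fun _ => f x) t)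

/-- The kernel is odd about x, so subtracting the constant f(x) on a ball centred at x changes
nothing. The subtraction tames the singularity that appears as ε tends to 0. -/
theorem conjPoisson_eq_integral_sub {f : ℝ → 𝕜} (hf : Integrable f) {ε : ℝ} (hε : 0 < ε) (x : ℝ) :
    conjPoisson ε f x = ∫ t, conjPoissonKer ε (t - x) •
      (f t - (Metric.closedBall x 1).indicator (fun _ => f x) t) := by
  have h1 : Integrable fun t => conjPoissonKer ε (t - x) • f t :=
    hf.bdd_smul (C := 1 / ε) (aestronglyMeasurable_conjPoissonKer hε x)
      (.of_forall fun t => abs_conjPoissonKer_le_inv hε _)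
  have h2 : Integrable ((Metric.closedBall x 1).indicator fun _ : ℝ => f x) := by
    rw [integrable_indicator_iff Metric.isClosed_closedBall.measurableSet]
    exact integrableOn_const measure_closedBall_lt_top.ne
  have h3 : Integrable fun t => conjPoissonKer ε (t - x) •
      (Metric.closedBall x 1).indicator (fun _ => f x) t :=
    h2.bdd_smul (C := 1 / ε) (aestronglyMeasurable_conjPoissonKer hε x)
      (.of_forall fun t => abs_conjPoissonKer_le_inv hε _)
  have h4 : ∫ t, conjPoissonKer ε (t - x) • (Metric.closedBall x 1).indicator (fun _ => f x) t = 0 := by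
    have := integral_sub_eq_zero_of_odd (φ := fun s => conjPoissonKer ε s •
      (Metric.closedBall (0 : ℝ) 1).indicator (fun _ => f x) s) (fun s => by
        have : (Metric.closedBall (0 : ℝ) 1).indicator (fun _ => f x) (-s) =
            (Metric.closedBall (0 : ℝ) 1).indicator (fun _ => f x) s := by
          classical
          simp only [Set.indicator_apply, mem_closedBall_zero_iff, norm_neg]
        rw [conjPoissonKer_neg, neg_smul, this]) x
    rw [← this]
    refine integral_congr_ae (.of_forall fun t => ?_)
    classical
    simp only [Set.indicator_apply, Metric.mem_closedBall, dist_eq_norm, sub_zero]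
  simp_rw [smul_sub]
  rw [integral_sub h1 h3, h4, sub_zero]
  rfl

/-- Within distance 1 the Lipschitz bound cancels |t - x|^(-1); farther away the kernel is at most
1. The majorant is independent of k, so it serves all ε at once. -/
theorem norm_kernel_smul_le {f : ℝ → 𝕜} {L : ℝ≥0} (hL : LipschitzWith L f) {k x : ℝ} {t : ℝ}
    (hk : |k| ≤ |t - x|⁻¹) :
    ‖k • (f t - (Metric.closedBall x 1).indicator (fun _ => f x) t)‖ ≤
      (Metric.closedBall x 1).indicator (fun _ => (L : ℝ)) t + ‖f t‖ := by
  rw [norm_smul, Real.norm_eq_abs]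
  by_cases ht : t ∈ Metric.closedBall x 1
  · rw [Set.indicator_of_mem ht, Set.indicator_of_mem ht]
    have h1 := hL.dist_le_mul t x
    rw [dist_eq_norm, Real.dist_eq] at h1
    calc _ ≤ |t - x|⁻¹ * (L * |t - x|) := by gcongr
      _ ≤ L := by
        rcases eq_or_ne (|t - x|) 0 with h | h
        · simp [h]
        · field_simp; rfl
      _ ≤ _ := by linarith [norm_nonneg (f t)]
  · rw [Set.indicator_of_notMem ht, Set.indicator_of_notMem ht, sub_zero, zero_add]
    rw [Metric.mem_closedBall, Real.dist_eq, not_le] at ht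
    have : |k| ≤ 1 := hk.trans (inv_le_one_of_one_le₀ ht.le)
    nlinarith [norm_nonneg (f t)]

theorem integrable_indicator_add_norm {f : ℝ → 𝕜} (hf : Integrable f) (L : ℝ≥0) (x : ℝ) :
    Integrable fun t => (Metric.closedBall x 1).indicator (fun _ => (L : ℝ)) t + ‖f t‖ := by
  refine Integrable.add ?_ hf.norm
  rw [integrable_indicator_iff Metric.isClosed_closedBall.measurableSet]
  exact integrableOn_const measure_closedBall_lt_top.ne

theorem tendsto_conjPoisson_smoothHilbert {f : ℝ → 𝕜} (hf : Integrable f) {L : ℝ≥0}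
    (hL : LipschitzWith L f) (x : ℝ) :
    Tendsto (fun ε => conjPoisson ε f x) (𝓝[>] 0) (𝓝 (smoothHilbert f x)) := by
  have h : Tendsto (fun ε => ∫ t, conjPoissonKer ε (t - x) •
      (f t - (Metric.closedBall x 1).indicator (fun _ => f x) t)) (𝓝[>] 0)
      (𝓝 (smoothHilbert f x)) := by
    refine tendsto_integral_filter_of_dominated_convergence _ ?_
      (.of_forall fun ε => .of_forall fun t =>
        norm_kernel_smul_le hL (abs_conjPoissonKer_le_inv_abs ε _))
      (integrable_indicator_add_norm hf L x)
      (.of_forall fun t => (tendsto_conjPoissonKer _).smul_const _)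
    filter_upwards [self_mem_nhdsWithin] with ε hε
    exact (aestronglyMeasurable_conjPoissonKer hε x).smul (hf.1.sub
      (aestronglyMeasurable_const.indicator Metric.isClosed_closedBall.measurableSet))
  refine h.congr' ?_
  filter_upwards [self_mem_nhdsWithin] with ε hε
  rw [conjPoisson_eq_integral_sub hf hε]

/-- A bound uniform in both ε and x, used as the dominating constant when δ tends to 0 under a
Poisson integral. -/
theorem norm_conjPoisson_le {f : ℝ → 𝕜} (hf : Integrable f) {L : ℝ≥0}
    (hL : LipschitzWith L f) {ε : ℝ} (hε : 0 < ε) (x : ℝ) :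
    ‖conjPoisson ε f x‖ ≤ 2 * L + ∫ t, ‖f t‖ := by
  rw [conjPoisson_eq_integral_sub hf hε]
  refine (norm_integral_le_of_norm_le (integrable_indicator_add_norm hf L x)
    (.of_forall fun t => norm_kernel_smul_le hL (abs_conjPoissonKer_le_inv_abs ε _))).trans ?_
  rw [integral_add ((integrable_indicator_iff Metric.isClosed_closedBall.measurableSet).2
    (integrableOn_const measure_closedBall_lt_top.ne)) hf.norm,
    integral_indicator Metric.isClosed_closedBall.measurableSet, setIntegral_const]
  simp [Measure.real, Real.volume_closedBall]

theorem integrable_poissonKer_sub {ε : ℝ} (hε : 0 < ε) (x : ℝ) :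
    Integrable fun t => poissonKer ε (t - x) := by
  refine ⟨aestronglyMeasurable_poissonKer hε x, ?_⟩
  rw [hasFiniteIntegral_iff_ofReal (.of_forall fun t => poissonKer_nonneg hε _),
    lintegral_poissonKer_sub_right hε]
  exact ENNReal.ofReal_lt_top

theorem integral_poissonKer_sub {ε : ℝ} (hε : 0 < ε) (x : ℝ) :
    ∫ t, poissonKer ε (t - x) = Real.pi := by
  rw [integral_eq_lintegral_of_nonneg_ae (.of_forall fun y => poissonKer_nonneg hε _)
    (aestronglyMeasurable_poissonKer hε x), lintegral_poissonKer_sub_right hε,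
    ENNReal.toReal_ofReal Real.pi_pos.le]

/-- Fubini reduces this to the semigroup identity for the kernels. Letting δ tend to 0 gives
`integral_poissonKer_smul_smoothHilbert`. -/
theorem integral_poissonKer_smul_conjPoisson {f : ℝ → 𝕜} (hf : Integrable f) {ε δ : ℝ}
    (hε : 0 < ε) (hδ : 0 < δ) (x : ℝ) :
    ∫ y, poissonKer ε (y - x) • conjPoisson δ f y = Real.pi • conjPoisson (ε + δ) f x := by
  set K : ℝ → ℝ → 𝕜 := fun y t => (poissonKer ε (y - x) * conjPoissonKer δ (t - y)) • f t with hK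
  have hKm : AEStronglyMeasurable (Function.uncurry K) (volume.prod volume) := by
    refine AEStronglyMeasurable.smul (Continuous.aestronglyMeasurable ?_) hf.1.comp_snd
    exact ((continuous_poissonKer hε).comp (continuous_fst.sub continuous_const)).mul
      ((continuous_conjPoissonKer hδ).comp (continuous_snd.sub continuous_fst))
  have hKint : Integrable (Function.uncurry K) (volume.prod volume) := by
    refine Integrable.mono' (((integrable_poissonKer_sub hε x).mul_const (1 / δ)).mul_prod hf.norm)
      hKm (.of_forall fun z => ?_)
    simp only [Function.uncurry, hK]
    rw [norm_smul, norm_mul, Real.norm_of_nonneg (poissonKer_nonneg hε _), Real.norm_eq_abs]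
    have := abs_conjPoissonKer_le_inv hδ (z.2 - z.1)
    have := poissonKer_nonneg hε (z.1 - x)
    gcongr
  calc _ = ∫ y, ∫ t, K y t := by
        refine integral_congr_ae (.of_forall fun y => ?_)
        simp only [conjPoisson, hK, mul_smul]
        rw [integral_smul]
    _ = ∫ t, ∫ y, K y t := integral_integral_swap hKint
    _ = _ := by
        unfold conjPoisson
        rw [← integral_smul]
        refine integral_congr_ae (.of_forall fun t => ?_)
        simp only [hK]
        rw [integral_smul_const, integral_poissonKer_mul_conjPoissonKer hε hδ, mul_smul]

theorem integral_poissonKer_smul_smoothHilbert {f : ℝ → 𝕜} (hf : Integrable f) {L : ℝ≥0}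
    (hL : LipschitzWith L f) {ε : ℝ} (hε : 0 < ε) (x : ℝ) :
    ∫ y, poissonKer ε (y - x) • smoothHilbert f y = Real.pi • conjPoisson ε f x := by
  have h1 : Tendsto (fun δ => ∫ y, poissonKer ε (y - x) • conjPoisson δ f y) (𝓝[>] 0)
      (𝓝 (∫ y, poissonKer ε (y - x) • smoothHilbert f y)) := by
    refine tendsto_integral_filter_of_dominated_convergence
      (fun y => poissonKer ε (y - x) * (2 * L + ∫ t, ‖f t‖)) ?_ ?_
      ((integrable_poissonKer_sub hε x).mul_const _)
      (.of_forall fun y => (tendsto_conjPoisson_smoothHilbert hf hL y).const_smul _)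
    · filter_upwards [self_mem_nhdsWithin] with δ hδ
      exact (aestronglyMeasurable_poissonKer hε x).smul (aestronglyMeasurable_conjPoisson hf.1 hδ)
    · filter_upwards [self_mem_nhdsWithin] with δ hδ
      refine .of_forall fun y => ?_
      rw [norm_smul, Real.norm_of_nonneg (poissonKer_nonneg hε _)]
      exact mul_le_mul_of_nonneg_left (norm_conjPoisson_le hf hL hδ y) (poissonKer_nonneg hε _)
  have h2 : Tendsto (fun δ => Real.pi • conjPoisson (ε + δ) f x) (𝓝[>] 0)
      (𝓝 (Real.pi • conjPoisson ε f x)) := by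
    refine Tendsto.const_smul ?_ _
    refine tendsto_integral_filter_of_dominated_convergence (fun t => 1 / ε * ‖f t‖) ?_ ?_
      (hf.norm.const_mul _) (.of_forall fun t => Tendsto.smul_const ?_ _)
    · filter_upwards [self_mem_nhdsWithin] with δ hδ
      exact (aestronglyMeasurable_conjPoissonKer (add_pos hε hδ) x).smul hf.1
    · filter_upwards [self_mem_nhdsWithin] with δ hδ
      have hδ' : 0 < δ := hδ
      refine .of_forall fun t => ?_
      rw [norm_smul]
      gcongr
      refine (abs_conjPoissonKer_le_inv (add_pos hε hδ) _).trans ?_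
      gcongr
      linarith
    · have : ContinuousAt (fun δ => conjPoissonKer (ε + δ) (t - x)) 0 := by
        unfold conjPoissonKer
        exact continuousAt_const.div (by fun_prop) (by positivity)
      simpa using this.tendsto.mono_left (nhdsWithin_le_nhds (s := Set.Ioi 0))
  refine tendsto_nhds_unique h1 (h2.congr' ?_)
  filter_upwards [self_mem_nhdsWithin] with δ hδ
  rw [integral_poissonKer_smul_conjPoisson hf hε hδ]

end

/-! ### Principal values in L^p -/

noncomputable section

variable {𝕜 : Type*} [RCLike 𝕜]

/-- The truncated (unnormalised) Hilbert transform. -/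
def truncHilbert (ε : ℝ) (f : ℝ → 𝕜) (x : ℝ) : 𝕜 := ∫ t in {t | ε < |t - x|}, (t - x)⁻¹ • f t

/-- The difference of the conjugate Poisson kernel and the truncated Hilbert kernel. -/
def truncError (ε s : ℝ) : ℝ := conjPoissonKer ε s - {s : ℝ | ε < |s|}.indicator (fun s => s⁻¹) s

theorem measurableSet_lt_abs (ε : ℝ) : MeasurableSet {s : ℝ | ε < |s|} :=
  measurableSet_lt measurable_const continuous_abs.measurable

theorem measurableSet_lt_abs_sub (ε x : ℝ) : MeasurableSet {t : ℝ | ε < |t - x|} :=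
  measurableSet_lt measurable_const (continuous_abs.measurable.comp (measurable_id.sub_const x))

theorem measurable_truncError {ε : ℝ} (hε : 0 < ε) : Measurable (truncError ε) :=
  (continuous_conjPoissonKer hε).measurable.sub
    (measurable_inv.indicator (measurableSet_lt_abs ε))

/-- For |s| > ε the difference equals -ε²/(s(s² + ε²)) and ε/|s| < 1; for |s| ≤ ε only the conjugate
kernel is present, with numerator at most ε. -/
theorem abs_truncError_le {ε : ℝ} (hε : 0 < ε) (s : ℝ) : |truncError ε s| ≤ poissonKer ε s := by
  have h0 : 0 < s ^ 2 + ε ^ 2 := by positivity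
  unfold truncError poissonKer conjPoissonKer
  by_cases h : ε < |s|
  · rw [Set.indicator_of_mem (by exact h)]
    have hs : s ≠ 0 := fun h' => by rw [h', abs_zero] at h; linarith
    have hs' : 0 < |s| := abs_pos.2 hs
    have e : s / (s ^ 2 + ε ^ 2) - s⁻¹ = -(ε ^ 2 / s / (s ^ 2 + ε ^ 2)) := by field_simp; ring
    rw [e, abs_neg, abs_div, abs_of_pos h0, abs_div, abs_of_pos (by positivity : 0 < ε ^ 2)]
    gcongr
    rw [div_le_iff₀ hs']
    nlinarith
  · rw [Set.indicator_of_notMem (by exact h), sub_zero, abs_div, abs_of_pos h0]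
    gcongr
    exact not_lt.1 h

theorem truncError_neg (ε s : ℝ) : truncError ε (-s) = -truncError ε s := by
  classical
  unfold truncError
  rw [conjPoissonKer_neg]
  simp only [Set.indicator_apply, Set.mem_ofPred_eq, abs_neg]
  split_ifs <;> simp [inv_neg]; ring

theorem integrable_truncError_smul {p : ℝ} (hp : 1 < p) {f : ℝ → 𝕜} (hf : AEStronglyMeasurable f)
    (hfp : ∫⁻ t, ‖f t‖ₑ ^ p < ∞) {ε : ℝ} (hε : 0 < ε) (x : ℝ) :
    Integrable fun t => truncError ε (t - x) • f t := by
  refine (integrable_poisson hp hf hfp hε x).norm.mono'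
    (((measurable_truncError hε).comp (measurable_id.sub_const x)).aestronglyMeasurable.smul hf)
    (.of_forall fun t => ?_)
  rw [norm_smul, norm_smul, Real.norm_of_nonneg (poissonKer_nonneg hε _), Real.norm_eq_abs]
  gcongr
  exact abs_truncError_le hε _

theorem integrable_indicator_inv_smul {p : ℝ} (hp : 1 < p) {f : ℝ → 𝕜}
    (hf : AEStronglyMeasurable f) (hfp : ∫⁻ t, ‖f t‖ₑ ^ p < ∞) {ε : ℝ} (hε : 0 < ε) (x : ℝ) :
    IntegrableOn (fun t => (t - x)⁻¹ • f t) {t | ε < |t - x|} := by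
  rw [← integrable_indicator_iff (measurableSet_lt_abs_sub ε x)]
  refine ((integrable_conjPoisson hp hf hfp hε x).sub
    (integrable_truncError_smul hp hf hfp hε x)).congr (.of_forall fun t => ?_)
  simp only [Pi.sub_apply]
  rw [← sub_smul, truncError, sub_sub_cancel]
  by_cases h : ε < |t - x|
  · rw [Set.indicator_of_mem (by exact h), Set.indicator_of_mem (by exact h)]
  · rw [Set.indicator_of_notMem (by exact h), Set.indicator_of_notMem (by exact h), zero_smul]

/-- The error kernel is odd and integrable, so its integral vanishes and f(x) may be subtracted.
Lebesgue points of f then make the difference vanish in the limit. -/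
theorem conjPoisson_sub_truncHilbert {p : ℝ} (hp : 1 < p) {f : ℝ → 𝕜}
    (hf : AEStronglyMeasurable f) (hfp : ∫⁻ t, ‖f t‖ₑ ^ p < ∞) {ε : ℝ} (hε : 0 < ε) (x : ℝ) :
    conjPoisson ε f x - truncHilbert ε f x = ∫ t, truncError ε (t - x) • (f t - f x) := by
  have h1 : Integrable fun t => truncError ε (t - x) := by
    refine (integrable_poissonKer_sub hε x).mono'
      ((measurable_truncError hε).comp (measurable_id.sub_const x)).aestronglyMeasurable
      (.of_forall fun t => abs_truncError_le hε _)
  have h2 : ∫ t, truncError ε (t - x) = 0 :=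
    integral_sub_eq_zero_of_odd (φ := truncError ε) (truncError_neg ε) x
  simp_rw [smul_sub]
  rw [integral_sub (integrable_truncError_smul hp hf hfp hε x) (h1.smul_const _),
    integral_smul_const, h2, zero_smul, sub_zero]
  unfold truncHilbert conjPoisson
  rw [← integral_indicator (measurableSet_lt_abs_sub ε x), ← integral_sub
    (integrable_conjPoisson hp hf hfp hε x) ((integrable_indicator_iff
      (measurableSet_lt_abs_sub ε x)).2 (integrable_indicator_inv_smul hp hf hfp hε x))]
  refine integral_congr_ae (.of_forall fun t => ?_)
  simp only [truncError, sub_smul]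
  congr 1
  by_cases h : ε < |t - x|
  · rw [Set.indicator_of_mem (by exact h), Set.indicator_of_mem (by exact h)]
  · rw [Set.indicator_of_notMem (by exact h), Set.indicator_of_notMem (by exact h), zero_smul]

theorem ae_tendsto_poisson_enorm_sub_of_rpow {p : ℝ} (hp : 1 < p) {f : ℝ → 𝕜}
    (hf : AEStronglyMeasurable f) (hfp : ∫⁻ t, ‖f t‖ₑ ^ p < ∞) :
    ∀ᵐ x, Tendsto (fun ε => ∫⁻ t, ENNReal.ofReal (poissonKer ε (t - x)) * ‖f t - f x‖ₑ)
      (𝓝[>] 0) (𝓝 0) := by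
  have hp0 : 0 < p := by linarith
  have hloc : LocallyIntegrable f :=
    ((memLp_ofReal_iff hp0 hf).2 hfp).locallyIntegrable (by simpa using hp.le)
  set N := (∫⁻ t, ‖f t‖ₑ ^ p) ^ (1 / p)
  have hN : N ≠ ∞ := ENNReal.rpow_ne_top_of_nonneg (by positivity) hfp.ne
  refine ae_tendsto_lintegral_poissonKer_enorm_sub hloc (C := fun _ => 2 * N)
    (fun _ => by finiteness) fun x r hr => ?_
  have h := lintegral_mul_rpow_le (μ := volume.restrict (Metric.closedBall x r)) hp
    (w := fun _ => 1) aemeasurable_const hf.enorm.restrict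
  simp only [one_mul, lintegral_const, Measure.restrict_apply_univ, Real.volume_closedBall] at h
  -- Hölder gives the growth (2r)^(1-1/p). Since 2r ≥ 1, this is at most 2r, and linear growth is
  -- all that the Lebesgue point lemma asks for.
  have h1 : (1 : ℝ≥0∞) ≤ ENNReal.ofReal (2 * r) := by
    rw [ENNReal.one_le_ofReal]; linarith
  have h2 : (∫⁻ t in Metric.closedBall x r, ‖f t‖ₑ) ^ p ≤ (2 * N * ENNReal.ofReal r) ^ p := by
    refine h.trans ?_
    rw [mul_right_comm, ENNReal.mul_rpow_of_nonneg _ _ hp0.le, ← ENNReal.rpow_mul,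
      one_div_mul_cancel hp0.ne', ENNReal.rpow_one]
    refine mul_le_mul' ?_ (lintegral_mono' Measure.restrict_le_self le_rfl)
    rw [ENNReal.ofReal_mul (by norm_num), ENNReal.ofReal_ofNat] at h1 ⊢
    exact ENNReal.rpow_le_rpow_of_exponent_le h1 (by linarith)
  exact (ENNReal.rpow_le_rpow_iff hp0).1 h2

theorem tendsto_truncHilbert_of_tendsto_conjPoisson {p : ℝ} (hp : 1 < p) {f : ℝ → 𝕜}
    (hf : AEStronglyMeasurable f) (hfp : ∫⁻ t, ‖f t‖ₑ ^ p < ∞) {x : ℝ} {v : 𝕜}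
    (hx : Tendsto (fun ε => ∫⁻ t, ENNReal.ofReal (poissonKer ε (t - x)) * ‖f t - f x‖ₑ)
      (𝓝[>] 0) (𝓝 0))
    (hv : Tendsto (fun ε => conjPoisson ε f x) (𝓝[>] 0) (𝓝 v)) :
    Tendsto (fun ε => truncHilbert ε f x) (𝓝[>] 0) (𝓝 v) := by
  have h : Tendsto (fun ε => conjPoisson ε f x - truncHilbert ε f x) (𝓝[>] 0) (𝓝 0) := by
    rw [tendsto_zero_iff_enorm_tendsto_zero]
    refine tendsto_of_tendsto_of_tendsto_of_le_of_le' tendsto_const_nhds hx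
      (.of_forall fun _ => zero_le) ?_
    filter_upwards [self_mem_nhdsWithin] with ε hε
    rw [conjPoisson_sub_truncHilbert hp hf hfp hε]
    refine (enorm_integral_le_lintegral_enorm _).trans (lintegral_mono fun t => ?_)
    rw [enorm_smul, Real.enorm_eq_ofReal_abs]
    gcongr
    exact abs_truncError_le hε _
  simpa using hv.sub h

theorem tendsto_one_div_add_one_nhdsGT_zero :
    Tendsto (fun n : ℕ => 1 / ((n : ℝ) + 1)) atTop (𝓝[>] 0) :=
  tendsto_nhdsWithin_iff.2 ⟨tendsto_one_div_add_atTop_nhds_zero_nat,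
    .of_forall fun _ => Set.mem_Ioi.2 Nat.one_div_pos_of_nat⟩

theorem lintegral_le_of_ae_tendsto_conjPoisson {p : ℝ} {C : ℝ≥0∞} {f h : ℝ → 𝕜}
    (hf : AEStronglyMeasurable f)
    (hC : ∀ ε : ℝ, 0 < ε → ∫⁻ x, ‖conjPoisson ε f x‖ₑ ^ p ≤ C)
    (hlim : ∀ᵐ x, Tendsto (fun ε => conjPoisson ε f x) (𝓝[>] 0) (𝓝 (h x))) :
    ∫⁻ x, ‖h x‖ₑ ^ p ≤ C := by
  have hseq := tendsto_one_div_add_one_nhdsGT_zero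
  calc _ = ∫⁻ x, liminf (fun n : ℕ => ‖conjPoisson (1 / ((n : ℝ) + 1)) f x‖ₑ ^ p) atTop := by
        refine lintegral_congr_ae ?_
        filter_upwards [hlim] with x hx
        exact (((ENNReal.continuous_rpow_const.tendsto _).comp
          ((continuous_enorm.tendsto _).comp (hx.comp hseq))).liminf_eq).symm
    _ ≤ liminf (fun n : ℕ => ∫⁻ x, ‖conjPoisson (1 / ((n : ℝ) + 1)) f x‖ₑ ^ p) atTop :=
        lintegral_liminf_le' fun n =>
          (aestronglyMeasurable_conjPoisson hf Nat.one_div_pos_of_nat).enorm.pow_const p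
    _ ≤ C := liminf_le_of_frequently_le'
        (Frequently.of_forall fun n => hC _ Nat.one_div_pos_of_nat)

theorem tendsto_integral_smul_of_tendsto_eLpNorm {p q : ℝ} (hpq : q.HolderConjugate p)
    {k : ℝ → ℝ} (hk : AEStronglyMeasurable k) (hkq : ∫⁻ t, ‖k t‖ₑ ^ q < ∞) {f : ℝ → 𝕜}
    {g : ℕ → ℝ → 𝕜} (hf : MemLp f (ENNReal.ofReal p) volume)
    (hg : ∀ n, MemLp (g n) (ENNReal.ofReal p) volume)
    (hlim : Tendsto (fun n => eLpNorm (g n - f) (ENNReal.ofReal p)) atTop (𝓝 0)) :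
    Tendsto (fun n => ∫ t, k t • g n t) atTop (𝓝 (∫ t, k t • f t)) := by
  have hp0 := hpq.symm.pos
  have hi : ∀ h : ℝ → 𝕜, MemLp h (ENNReal.ofReal p) volume → Integrable fun t => k t • h t :=
    fun h hh => integrable_smul_of_lintegral_rpow hpq hk hh.1 hkq ((memLp_ofReal_iff hp0 hh.1).1 hh)
  rw [tendsto_iff_enorm_sub_tendsto_zero]
  have hz := ENNReal.Tendsto.const_mul (a := (∫⁻ t, ‖k t‖ₑ ^ q) ^ (1 / q)) hlim
    (Or.inr (ENNReal.rpow_ne_top_of_nonneg (one_div_nonneg.2 hpq.nonneg) hkq.ne))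
  rw [mul_zero] at hz
  refine tendsto_of_tendsto_of_tendsto_of_le_of_le tendsto_const_nhds hz (fun _ => zero_le)
    fun n => ?_
  simp only
  rw [← integral_sub (hi _ (hg n)) (hi _ hf), eLpNorm_ofReal_eq hp0]
  simp_rw [← smul_sub]
  exact (enorm_integral_le_lintegral_enorm _).trans
    (lintegral_enorm_smul_le hpq hk ((hg n).1.sub hf.1))

/-- Every function in `L^p` has a Hilbert transform in `L^p`, whose Poisson integrals are the
conjugate Poisson integrals of the function. -/
theorem exists_hilbert {p : ℝ} (hp : 1 < p) {f : ℝ → 𝕜}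
    (hf : AEStronglyMeasurable f) (hfp : ∫⁻ t, ‖f t‖ₑ ^ p < ∞) :
    ∃ h : ℝ → 𝕜, AEStronglyMeasurable h ∧ ∫⁻ t, ‖h t‖ₑ ^ p < ∞ ∧
      ∀ ε : ℝ, 0 < ε → ∀ x, ∫ y, poissonKer ε (y - x) • h y = Real.pi • conjPoisson ε f x := by
  have hp0 : 0 < p := by linarith
  have hp1 : 1 ≤ ENNReal.ofReal p := by simpa using hp.le
  obtain ⟨C, hC⟩ := exists_lintegral_conjPoisson_le 𝕜 hp
  have hfL := (memLp_ofReal_iff hp0 hf).2 hfp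
  have happ : ∀ n : ℕ, ∃ g : ℝ → 𝕜, HasCompactSupport g ∧ ContDiff ℝ (⊤ : ℕ∞) g ∧
      eLpNorm (f - g) (ENNReal.ofReal p) volume ≤ ENNReal.ofReal ((1 / 2) ^ n) := fun n =>
    hfL.exist_eLpNorm_sub_le ENNReal.ofReal_ne_top hp1 (by positivity)
  choose g hgs hgd hgf using happ
  have hgL : ∀ n, MemLp (g n) (ENNReal.ofReal p) volume := fun n =>
    (hgd n).continuous.memLp_of_hasCompactSupport (hgs n)
  have hgi : ∀ n, Integrable (g n) := fun n =>
    (hgd n).continuous.integrable_of_hasCompactSupport (hgs n)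
  have hgp : ∀ n, ∫⁻ t, ‖g n t‖ₑ ^ p < ∞ := fun n => (memLp_ofReal_iff hp0 (hgL n).1).1 (hgL n)
  have hlip : ∀ n, ∃ L : ℝ≥0, LipschitzWith L (g n) := fun n =>
    (hgd n).lipschitzWith_of_hasCompactSupport (hgs n) (by simp)
  choose L hL using hlip
  have hm : ∀ n, AEStronglyMeasurable (smoothHilbert (g n)) := fun n => by
    have hseq := tendsto_one_div_add_one_nhdsGT_zero
    exact aestronglyMeasurable_of_tendsto_ae atTop
      (fun k => aestronglyMeasurable_conjPoisson (hgi n).1 Nat.one_div_pos_of_nat)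
      (.of_forall fun x => (tendsto_conjPoisson_smoothHilbert (hgi n) (hL n) x).comp hseq)
  have hHp : ∀ n, ∫⁻ x, ‖smoothHilbert (g n) x‖ₑ ^ p < ∞ := fun n =>
    (lintegral_le_of_ae_tendsto_conjPoisson (hgi n).1 (fun ε hε => hC _ (hgi n).1 (hgp n) ε hε)
      (.of_forall fun x => tendsto_conjPoisson_smoothHilbert (hgi n) (hL n) x)).trans_lt
      (ENNReal.mul_lt_top ENNReal.coe_lt_top (hgp n))
  have hHL : ∀ n, MemLp (smoothHilbert (g n)) (ENNReal.ofReal p) volume := fun n =>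
    (memLp_ofReal_iff hp0 (hm n)).2 (hHp n)
  -- The uniform L^p bound, applied to g n - g m, shows that their Hilbert transforms inherit the
  -- Cauchy property.
  have hdiff : ∀ n m, eLpNorm (smoothHilbert (g n) - smoothHilbert (g m)) (ENNReal.ofReal p) volume ≤
      (C : ℝ≥0∞) ^ (1 / p) * eLpNorm (g n - g m) (ENNReal.ofReal p) volume := fun n m => by
    have hnm := (memLp_ofReal_iff hp0 ((hgL n).1.sub (hgL m).1)).1 ((hgL n).sub (hgL m))
    rw [eLpNorm_ofReal_eq hp0, eLpNorm_ofReal_eq hp0, ← ENNReal.mul_rpow_of_nonneg _ _ (by positivity)]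
    refine ENNReal.rpow_le_rpow ?_ (by positivity)
    refine lintegral_le_of_ae_tendsto_conjPoisson (f := g n - g m) ((hgi n).1.sub (hgi m).1)
      (fun ε hε => hC _ ((hgi n).1.sub (hgi m).1) hnm ε hε) (.of_forall fun x => ?_)
    refine ((tendsto_conjPoisson_smoothHilbert (hgi n) (hL n) x).sub
      (tendsto_conjPoisson_smoothHilbert (hgi m) (hL m) x)).congr' ?_
    filter_upwards [self_mem_nhdsWithin] with ε hε
    unfold conjPoisson
    rw [← integral_sub (integrable_conjPoisson hp (hgi n).1 (hgp n) hε x)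
      (integrable_conjPoisson hp (hgi m).1 (hgp m) hε x)]
    simp_rw [← smul_sub]
    rfl
  -- The summand 1 turns the estimate into the strict inequality required by
  -- `Lp.cauchy_complete_eLpNorm`.
  set D : ℝ≥0∞ := (C : ℝ≥0∞) ^ (1 / p) * 2 + 1 with hD
  have hDt : D ≠ ∞ := by
    refine ENNReal.add_ne_top.2 ⟨ENNReal.mul_ne_top ?_ (by norm_num), by norm_num⟩
    exact ENNReal.rpow_ne_top_of_nonneg (by positivity) ENNReal.coe_ne_top
  have hcauchy : ∀ N n m : ℕ, N ≤ n → N ≤ m →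
      eLpNorm (smoothHilbert (g n) - smoothHilbert (g m)) (ENNReal.ofReal p) volume <
        D * ENNReal.ofReal ((1 / 2) ^ N) := fun N n m hn hm => by
    have hpow : ∀ k, N ≤ k → eLpNorm (f - g k) (ENNReal.ofReal p) volume ≤
        ENNReal.ofReal ((1 / 2) ^ N) := fun k hk => (hgf k).trans
      (ENNReal.ofReal_le_ofReal (pow_le_pow_of_le_one (by norm_num) (by norm_num) hk))
    have h1 : eLpNorm (g n - g m) (ENNReal.ofReal p) volume ≤ 2 * ENNReal.ofReal ((1 / 2) ^ N) := by
      have e : g n - g m = (f - g m) - (f - g n) := by abel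
      rw [e, two_mul]
      exact (eLpNorm_sub_le (hf.sub (hgL m).1) (hf.sub (hgL n).1) hp1).trans
        (add_le_add (hpow m hm) (hpow n hn))
    refine (hdiff n m).trans_lt ((mul_le_mul' le_rfl h1).trans_lt ?_)
    rw [hD, add_mul, ← mul_assoc, one_mul]
    refine ENNReal.lt_add_right (ENNReal.mul_ne_top (ENNReal.mul_ne_top ?_ (by norm_num))
      ENNReal.ofReal_ne_top) (by simp)
    exact ENNReal.rpow_ne_top_of_nonneg (by positivity) ENNReal.coe_ne_top
  obtain ⟨h, hhL, hh⟩ := Lp.cauchy_complete_eLpNorm hp1 hHL (B := fun N => D * ENNReal.ofReal ((1 / 2) ^ N))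
    (by
      rw [ENNReal.tsum_mul_left, ← ENNReal.ofReal_tsum_of_nonneg (fun k => by positivity)
        (summable_geometric_of_lt_one (by norm_num) (by norm_num))]
      exact ENNReal.mul_ne_top hDt ENNReal.ofReal_ne_top) hcauchy
  refine ⟨h, hhL.1, (memLp_ofReal_iff hp0 hhL.1).1 hhL, fun ε hε x => ?_⟩
  have hpq := (Real.HolderConjugate.conjExponent hp).symm
  have h1 := tendsto_integral_smul_of_tendsto_eLpNorm hpq (aestronglyMeasurable_poissonKer hε x)
    (by rw [lintegral_sub_right_eq_self (fun s => ‖poissonKer ε s‖ₑ ^ _) x]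
        exact lintegral_poissonKer_rpow_lt_top hpq.lt hε) hhL hHL hh
  have hgf' : Tendsto (fun n => eLpNorm (g n - f) (ENNReal.ofReal p) volume) atTop (𝓝 0) := by
    refine tendsto_of_tendsto_of_tendsto_of_le_of_le tendsto_const_nhds ?_ (fun _ => zero_le)
      (fun n => (eLpNorm_sub_comm (g n) f _ _).trans_le (hgf n))
    have := ENNReal.tendsto_ofReal (tendsto_pow_atTop_nhds_zero_of_lt_one
      (by norm_num : (0 : ℝ) ≤ 1 / 2) (by norm_num))
    simpa only [ENNReal.ofReal_zero] using this
  have h2 := (tendsto_integral_smul_of_tendsto_eLpNorm hpq (aestronglyMeasurable_conjPoissonKer hε x)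
    (by rw [lintegral_sub_right_eq_self (fun s => ‖conjPoissonKer ε s‖ₑ ^ _) x]
        exact lintegral_conjPoissonKer_rpow_lt_top hpq.lt hε) hfL hgL hgf').const_smul Real.pi
  -- For fixed ε and x both kernels lie in the dual space, so the identity known for the smooth
  -- functions passes to the L^p limit.
  refine tendsto_nhds_unique h1 (h2.congr fun n => ?_)
  exact (integral_poissonKer_smul_smoothHilbert (hgi n) (hL n) hε x).symm

theorem tendsto_poisson_of_lebesguePoint {p : ℝ} (hp : 1 < p) {h : ℝ → 𝕜}
    (hh : AEStronglyMeasurable h) (hhp : ∫⁻ t, ‖h t‖ₑ ^ p < ∞) {x : ℝ}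
    (hx : Tendsto (fun ε => ∫⁻ t, ENNReal.ofReal (poissonKer ε (t - x)) * ‖h t - h x‖ₑ)
      (𝓝[>] 0) (𝓝 0)) :
    Tendsto (fun ε => ∫ y, poissonKer ε (y - x) • h y) (𝓝[>] 0) (𝓝 (Real.pi • h x)) := by
  rw [tendsto_iff_enorm_sub_tendsto_zero]
  refine tendsto_of_tendsto_of_tendsto_of_le_of_le' tendsto_const_nhds hx
    (.of_forall fun _ => zero_le) ?_
  filter_upwards [self_mem_nhdsWithin] with ε hε
  rw [← integral_poissonKer_sub hε x, ← integral_smul_const,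
    ← integral_sub (integrable_poisson hp hh hhp hε x) ((integrable_poissonKer_sub hε x).smul_const _)]
  refine (enorm_integral_le_lintegral_enorm _).trans (lintegral_mono fun t => ?_)
  rw [← smul_sub, enorm_smul, Real.enorm_of_nonneg (poissonKer_nonneg hε _)]

variable (𝕜) in
/-- M. Riesz' theorem: the Hilbert transform of an `L^p` function exists almost everywhere as a
principal value, and is bounded in `L^p`. -/
theorem exists_truncHilbert_limit {p : ℝ} (hp : 1 < p) :
    ∃ C : ℝ≥0, ∀ f : ℝ → 𝕜, AEStronglyMeasurable f → ∫⁻ t, ‖f t‖ₑ ^ p < ∞ →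
      ∃ h : ℝ → 𝕜, AEStronglyMeasurable h ∧
        (∀ᵐ x, Tendsto (fun ε => truncHilbert ε f x) (𝓝[>] 0) (𝓝 (h x))) ∧
        ∫⁻ x, ‖h x‖ₑ ^ p ≤ C * ∫⁻ t, ‖f t‖ₑ ^ p := by
  obtain ⟨C, hC⟩ := exists_lintegral_conjPoisson_le 𝕜 hp
  refine ⟨C, fun f hf hfp => ?_⟩
  obtain ⟨h, hh, hhp, hP⟩ := exists_hilbert hp hf hfp
  have hlim : ∀ᵐ x, Tendsto (fun ε => conjPoisson ε f x) (𝓝[>] 0) (𝓝 (h x)) := by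
    filter_upwards [ae_tendsto_poisson_enorm_sub_of_rpow hp hh hhp] with x hx
    have := (tendsto_poisson_of_lebesguePoint hp hh hhp hx).const_smul Real.pi⁻¹
    rw [inv_smul_smul₀ Real.pi_pos.ne'] at this
    refine this.congr' ?_
    filter_upwards [self_mem_nhdsWithin] with ε hε
    rw [hP ε hε, inv_smul_smul₀ Real.pi_pos.ne']
  refine ⟨h, hh, ?_, lintegral_le_of_ae_tendsto_conjPoisson hf (fun ε hε => hC f hf hfp ε hε) hlim⟩
  filter_upwards [hlim, ae_tendsto_poisson_enorm_sub_of_rpow hp hf hfp] with x hx hx'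
  exact tendsto_truncHilbert_of_tendsto_conjPoisson hp hf hfp hx' hx

end

/-! ### The Hilbert transform in Morrey spaces on the line -/

noncomputable section

variable {𝕜 : Type*} [RCLike 𝕜]

/-- The `p`-th powers of the integral means of `f` over balls of radius `r` grow at most like
`K r^lam`. -/
def MorreyBound (p lam : ℝ) (K : ℝ≥0∞) (f : ℝ → 𝕜) : Prop :=
  ∀ x r : ℝ, 0 < r → ∫⁻ t in Metric.ball x r, ‖f t‖ₑ ^ p ≤ K * ENNReal.ofReal (r ^ lam)

theorem MorreyBound.lintegral_ball_le {p lam : ℝ} (hp : 1 < p) {K : ℝ≥0∞} {f : ℝ → 𝕜}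
    (hf : AEStronglyMeasurable f) (hK : MorreyBound p lam K f) (x : ℝ) {ρ : ℝ} (hρ : 0 < ρ) :
    ∫⁻ t in Metric.ball x ρ, ‖f t‖ₑ ≤
      ENNReal.ofReal (2 ^ (1 - 1 / p) * ρ ^ (1 - (1 - lam) / p)) * K ^ (1 / p) := by
  have hp0 : 0 < p := by linarith
  have h := lintegral_mul_rpow_le (μ := volume.restrict (Metric.ball x ρ)) hp
    (w := fun _ => 1) aemeasurable_const hf.enorm.restrict
  simp only [one_mul, lintegral_const, Measure.restrict_apply_univ, Real.volume_ball] at h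
  rw [← ENNReal.rpow_le_rpow_iff hp0]
  refine h.trans ((mul_le_mul' le_rfl (hK x ρ hρ)).trans (le_of_eq ?_))
  rw [ENNReal.mul_rpow_of_nonneg _ _ hp0.le, ← ENNReal.rpow_mul, one_div_mul_cancel hp0.ne',
    ENNReal.rpow_one, ENNReal.ofReal_rpow_of_nonneg (by positivity) (by linarith),
    ENNReal.ofReal_rpow_of_nonneg (by positivity) hp0.le, mul_left_comm, mul_comm K,
    ← ENNReal.ofReal_mul (by positivity), Real.mul_rpow (by norm_num) hρ.le,
    Real.mul_rpow (by positivity) (by positivity), ← Real.rpow_mul (by norm_num),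
    ← Real.rpow_mul hρ.le, mul_assoc, ← Real.rpow_add hρ]
  congr 4
  · field_simp
  · field_simp; ring

/-- On the k-th dyadic ring the kernel is of size (2^k r)^(-1), and by Hölder the mass is of order
(2^k r)^(1-γ). The products form a geometric series of ratio 2^(-γ), which is less than 1 exactly
because λ < 1. -/
theorem exists_lintegral_tail_le {p lam : ℝ} (hp : 1 < p) (hlam1 : lam < 1) :
    ∃ T : ℝ≥0, ∀ (f : ℝ → 𝕜) (K : ℝ≥0∞), AEStronglyMeasurable f → MorreyBound p lam K f →
      ∀ x r : ℝ, 0 < r → ∫⁻ t in {t | r ≤ |t - x|}, ‖(t - x)⁻¹ • f t‖ₑ ≤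
        T * K ^ (1 / p) * ENNReal.ofReal (r ^ (-((1 - lam) / p))) := by
  have hp0 : 0 < p := by linarith
  set γ := (1 - lam) / p with hγ
  have hγ0 : 0 < γ := div_pos (by linarith) hp0
  set a : ℝ := 2 ^ (-γ) with ha
  have ha0 : 0 < a := by positivity
  have ha1 : a < 1 := Real.rpow_lt_one_of_one_lt_of_neg (by norm_num) (by linarith)
  set T : ℝ≥0 := (2 * 2 ^ (1 - 1 / p) * a * (1 - a)⁻¹ : ℝ).toNNReal with hT
  refine ⟨T, fun f K hf hK x r hr => ?_⟩
  calc ∫⁻ t in {t | r ≤ |t - x|}, ‖(t - x)⁻¹ • f t‖ₑ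
      = ∫⁻ t in {t | r ≤ |t - x|}, ENNReal.ofReal |t - x|⁻¹ * ‖f t‖ₑ := by
        refine lintegral_congr fun t => ?_
        rw [enorm_smul, Real.enorm_eq_ofReal_abs, abs_inv]
    _ ≤ _ := lintegral_tail_le hr x _ hf.enorm
    _ ≤ ∑' k : ℕ, ENNReal.ofReal (2 * 2 ^ (1 - 1 / p) * a * a ^ k * r ^ (-γ)) * K ^ (1 / p) := by
        refine ENNReal.tsum_le_tsum fun k => ?_
        refine (mul_le_mul' le_rfl (hK.lintegral_ball_le hp hf x (by positivity))).trans
          (le_of_eq ?_)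
        rw [← mul_assoc, ← ENNReal.ofReal_mul (by positivity)]
        congr 2
        have hρ : (0 : ℝ) < 2 ^ (k + 1) * r := by positivity
        have e1 : (2 ^ k * r : ℝ)⁻¹ = 2 * (2 ^ (k + 1) * r) ^ (-1 : ℝ) := by
          rw [Real.rpow_neg_one, pow_succ]; field_simp
        have e2 : a * a ^ k * r ^ (-γ) = (2 ^ (k + 1) * r) ^ (-γ) := by
          rw [Real.mul_rpow (by positivity) hr.le, ← Real.rpow_natCast_mul (by norm_num),
            mul_comm (((k + 1 : ℕ) : ℝ)), Real.rpow_mul_natCast (by norm_num), ← ha, pow_succ]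
          ring
        have e3 : (2 ^ (k + 1) * r) ^ (-γ) =
            (2 ^ (k + 1) * r) ^ (-1 : ℝ) * (2 ^ (k + 1) * r) ^ (1 - γ) := by
          rw [← Real.rpow_add hρ]; congr 1; ring
        rw [e1]
        linear_combination (-2 * 2 ^ (1 - 1 / p)) * (e2.trans e3)
    _ = T * K ^ (1 / p) * ENNReal.ofReal (r ^ (-γ)) := by
        rw [ENNReal.tsum_mul_right, ← ENNReal.ofReal_tsum_of_nonneg (fun k => by positivity)
          (((summable_geometric_of_lt_one ha0.le ha1).mul_left _).mul_right _), tsum_mul_right,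
          tsum_mul_left, tsum_geometric_of_lt_one ha0.le ha1, mul_right_comm (T : ℝ≥0∞),
          ENNReal.ofReal_mul (mul_nonneg (by positivity) (inv_nonneg.2 (by linarith)))]
        rfl

theorem MorreyBound.integrableOn_tail {p lam : ℝ} (hp : 1 < p) (hlam1 : lam < 1) {K : ℝ≥0∞}
    (hKt : K ≠ ∞) {f : ℝ → 𝕜} (hf : AEStronglyMeasurable f) (hK : MorreyBound p lam K f) (x : ℝ)
    {r : ℝ} (hr : 0 < r) : IntegrableOn (fun t => (t - x)⁻¹ • f t) {t | r ≤ |t - x|} := by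
  obtain ⟨T, hT⟩ := exists_lintegral_tail_le (𝕜 := 𝕜) hp hlam1
  refine ⟨((measurable_id.sub_const x).inv.aestronglyMeasurable.smul hf).restrict, ?_⟩
  refine (hT f K hf hK x r hr).trans_lt (ENNReal.mul_lt_top (ENNReal.mul_lt_top ENNReal.coe_lt_top ?_)
    ENNReal.ofReal_lt_top)
  exact ENNReal.rpow_lt_top_of_nonneg (one_div_nonneg.2 (by linarith)) hKt

theorem aestronglyMeasurable_truncHilbert {f : ℝ → 𝕜} (hf : AEStronglyMeasurable f) (ε : ℝ) :
    AEStronglyMeasurable (truncHilbert ε f) := by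
  have hS : MeasurableSet {z : ℝ × ℝ | ε < |z.2 - z.1|} :=
    measurableSet_lt measurable_const (continuous_abs.measurable.comp
      (measurable_snd.sub measurable_fst))
  have h : AEStronglyMeasurable ({z : ℝ × ℝ | ε < |z.2 - z.1|}.indicator
      fun z : ℝ × ℝ => (z.2 - z.1)⁻¹ • f z.2) (volume.prod volume) :=
    (((measurable_snd.sub measurable_fst).inv.aestronglyMeasurable).smul hf.comp_snd).indicator hS
  refine h.integral_prod_right'.congr (.of_forall fun x => ?_)
  simp only [truncHilbert]
  rw [← integral_indicator (measurableSet_lt_abs_sub ε x)]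
  rfl

/-- A point outside the double ball is more than r away from x, so a truncation with ε < r does not
affect it. The far part is therefore independent of ε, and only the near part needs a principal
value. -/
theorem truncHilbert_eq_add {p lam : ℝ} (hp : 1 < p) (hlam1 : lam < 1) {K : ℝ≥0∞}
    (hKt : K ≠ ∞) {f : ℝ → 𝕜} (hf : AEStronglyMeasurable f) (hK : MorreyBound p lam K f)
    {c r x ε : ℝ} (hx : x ∈ Metric.ball c r) (hε : 0 < ε) (hεr : ε < r) :
    truncHilbert ε f x = truncHilbert ε ((Metric.ball c (2 * r)).indicator f) x +
      ∫ t in (Metric.ball c (2 * r))ᶜ, (t - x)⁻¹ • f t := by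
  have hB : MeasurableSet (Metric.ball c (2 * r)) := Metric.isOpen_ball.measurableSet
  have hi : IntegrableOn (fun t => (t - x)⁻¹ • f t) {t | ε < |t - x|} :=
    (hK.integrableOn_tail hp hlam1 hKt hf x hε).mono_set fun t ht => le_of_lt (Set.mem_ofPred.1 ht)
  unfold truncHilbert
  have e1 : (fun t => (t - x)⁻¹ • (Metric.ball c (2 * r)).indicator f t) =
      (Metric.ball c (2 * r)).indicator fun t => (t - x)⁻¹ • f t := by
    ext t
    by_cases h : t ∈ Metric.ball c (2 * r)
    · rw [Set.indicator_of_mem h, Set.indicator_of_mem h]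
    · rw [Set.indicator_of_notMem h, Set.indicator_of_notMem h, smul_zero]
  have e2 : {t | ε < |t - x|} \ Metric.ball c (2 * r) = (Metric.ball c (2 * r))ᶜ := by
    ext t
    refine ⟨fun h => h.2, fun h => ⟨?_, h⟩⟩
    rw [Set.mem_compl_iff, Metric.mem_ball, not_lt] at h
    rw [Metric.mem_ball] at hx
    have := dist_triangle t x c
    change ε < |t - x|
    rw [← Real.dist_eq]
    linarith
  rw [e1, setIntegral_indicator hB, ← e2, integral_inter_add_sdiff hB hi]

/-- Local form of the boundedness of the Hilbert transform in Morrey spaces. -/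
theorem exists_local_hilbert_morrey {p lam : ℝ} (hp : 1 < p) (hlam1 : lam < 1) :
    ∃ C : ℝ≥0, ∀ (f : ℝ → 𝕜) (K : ℝ≥0∞), K ≠ ∞ → AEStronglyMeasurable f → MorreyBound p lam K f →
      ∀ c r : ℝ, 0 < r → ∃ h : ℝ → 𝕜,
        (∀ᵐ x ∂(volume.restrict (Metric.ball c r)),
          Tendsto (fun ε => truncHilbert ε f x) (𝓝[>] 0) (𝓝 (h x))) ∧
        ∫⁻ x in Metric.ball c r, ‖h x‖ₑ ^ p ≤ C * K * ENNReal.ofReal (r ^ lam) := by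
  have hp0 : 0 < p := by linarith
  obtain ⟨C, hC⟩ := exists_truncHilbert_limit 𝕜 hp
  obtain ⟨T, hT⟩ := exists_lintegral_tail_le (𝕜 := 𝕜) hp hlam1
  refine ⟨2 ^ (p - 1) * (C * ((2 : ℝ) ^ lam).toNNReal + T ^ p * 2), fun f K hKt hf hK c r hr => ?_⟩
  have hB : MeasurableSet (Metric.ball c (2 * r)) := Metric.isOpen_ball.measurableSet
  set f₁ := (Metric.ball c (2 * r)).indicator f with hf₁
  have hf₁m : AEStronglyMeasurable f₁ := hf.indicator hB
  have hf₁p : ∫⁻ t, ‖f₁ t‖ₑ ^ p ≤ K * ENNReal.ofReal ((2 * r) ^ lam) := by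
    refine le_trans (le_of_eq ?_) (hK c (2 * r) (by positivity))
    rw [← lintegral_indicator hB]
    refine lintegral_congr fun t => ?_
    by_cases h : t ∈ Metric.ball c (2 * r)
    · rw [hf₁, Set.indicator_of_mem h, Set.indicator_of_mem h]
    · rw [hf₁, Set.indicator_of_notMem h, Set.indicator_of_notMem h, enorm_zero,
        ENNReal.zero_rpow_of_pos hp0]
  obtain ⟨h₁, hh₁, hlim, hle⟩ := hC f₁ hf₁m
    (hf₁p.trans_lt (ENNReal.mul_lt_top hKt.lt_top ENNReal.ofReal_lt_top))
  set g : ℝ → 𝕜 := fun x => ∫ t in (Metric.ball c (2 * r))ᶜ, (t - x)⁻¹ • f t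
  refine ⟨fun x => h₁ x + g x, ?_, ?_⟩
  · filter_upwards [ae_restrict_of_ae hlim, ae_restrict_mem Metric.isOpen_ball.measurableSet]
      with x hx hxB
    refine (hx.add_const (g x)).congr' ?_
    filter_upwards [Ioo_mem_nhdsGT hr] with ε hε
    exact (truncHilbert_eq_add hp hlam1 hKt hf hK hxB hε.1 hε.2).symm
  -- The far part is bounded pointwise by a multiple of r^(-γ); its p-th power r^(λ-1) times the
  -- length 2r of the ball gives the required r^λ.
  · have hg : ∀ x ∈ Metric.ball c r, ‖g x‖ₑ ^ p ≤
        T ^ p * K * ENNReal.ofReal (r ^ (lam - 1)) := fun x hx => by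
      have h1 : ‖g x‖ₑ ≤ T * K ^ (1 / p) * ENNReal.ofReal (r ^ (-((1 - lam) / p))) := by
        refine (enorm_integral_le_lintegral_enorm _).trans ((lintegral_mono_set ?_).trans
          (hT f K hf hK x r hr))
        intro t ht
        rw [Set.mem_compl_iff, Metric.mem_ball, not_lt] at ht
        rw [Metric.mem_ball] at hx
        have := dist_triangle t x c
        change r ≤ |t - x|
        rw [← Real.dist_eq]
        linarith
      refine (ENNReal.rpow_le_rpow h1 hp0.le).trans (le_of_eq ?_)
      rw [ENNReal.mul_rpow_of_nonneg _ _ hp0.le, ENNReal.mul_rpow_of_nonneg _ _ hp0.le,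
        ← ENNReal.rpow_mul, one_div_mul_cancel hp0.ne', ENNReal.rpow_one,
        ENNReal.ofReal_rpow_of_nonneg (by positivity) hp0.le, ← Real.rpow_mul hr.le]
      congr 3
      field_simp
      ring
    have hsplit : ENNReal.ofReal ((2 * r) ^ lam) =
        (((2 : ℝ) ^ lam).toNNReal : ℝ≥0∞) * ENNReal.ofReal (r ^ lam) := by
      rw [Real.mul_rpow (by norm_num) hr.le, ENNReal.ofReal_mul (by positivity)]
      rfl
    have hrr : ENNReal.ofReal (r ^ (lam - 1)) * ENNReal.ofReal (2 * r) =
        2 * ENNReal.ofReal (r ^ lam) := by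
      rw [← ENNReal.ofReal_mul (by positivity), ← ENNReal.ofReal_ofNat,
        ← ENNReal.ofReal_mul (by norm_num)]
      congr 1
      rw [Real.rpow_sub_one hr.ne']
      field_simp
    calc ∫⁻ x in Metric.ball c r, ‖h₁ x + g x‖ₑ ^ p
        ≤ ∫⁻ x in Metric.ball c r, 2 ^ (p - 1) * (‖h₁ x‖ₑ ^ p +
            T ^ p * K * ENNReal.ofReal (r ^ (lam - 1))) := by
          refine setLIntegral_mono' Metric.isOpen_ball.measurableSet fun x hx => ?_
          refine (ENNReal.rpow_le_rpow (enorm_add_le _ _) hp0.le).trans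
            ((ENNReal.rpow_add_le_mul_rpow_add_rpow _ _ hp.le).trans ?_)
          gcongr
          exact hg x hx
      _ = 2 ^ (p - 1) * ((∫⁻ x in Metric.ball c r, ‖h₁ x‖ₑ ^ p) +
            T ^ p * K * ENNReal.ofReal (r ^ (lam - 1)) * ENNReal.ofReal (2 * r)) := by
          rw [lintegral_const_mul' _ _ (by finiteness), lintegral_add_right _ measurable_const,
            setLIntegral_const, Real.volume_ball]
      _ ≤ 2 ^ (p - 1) * (C * (K * ENNReal.ofReal ((2 * r) ^ lam)) +
            T ^ p * K * ENNReal.ofReal (r ^ (lam - 1)) * ENNReal.ofReal (2 * r)) := by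
          gcongr
          exact (lintegral_mono' Measure.restrict_le_self le_rfl).trans (hle.trans (by gcongr))
      _ = _ := by
          rw [mul_assoc (T ^ p * K : ℝ≥0∞), hrr, hsplit]
          push_cast [ENNReal.coe_rpow_of_nonneg _ hp0.le,
            ENNReal.coe_rpow_of_nonneg _ (by linarith : 0 ≤ p - 1)]
          ring

variable (𝕜) in
/-- The Hilbert transform is bounded in Morrey spaces on the line. -/
theorem exists_hilbert_morrey {p lam : ℝ} (hp : 1 < p) (hlam1 : lam < 1) :
    ∃ C : ℝ≥0, ∀ (f : ℝ → 𝕜) (K : ℝ≥0∞), K ≠ ∞ → AEStronglyMeasurable f → MorreyBound p lam K f →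
      ∃ h : ℝ → 𝕜, AEStronglyMeasurable h ∧
        (∀ᵐ x, Tendsto (fun ε => truncHilbert ε f x) (𝓝[>] 0) (𝓝 (h x))) ∧
        MorreyBound p lam (C * K) h := by
  obtain ⟨C, hC⟩ := exists_local_hilbert_morrey (𝕜 := 𝕜) hp hlam1
  refine ⟨C, fun f K hKt hf hK => ?_⟩
  have hloc := hC f K hKt hf hK
  -- The local limits depend on the chosen ball only through a null set. Defining h by the limit
  -- itself makes one function serve all balls.
  set h : ℝ → 𝕜 := fun x => limUnder (𝓝[>] 0) fun ε => truncHilbert ε f x with hh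
  have hlim : ∀ᵐ x, Tendsto (fun ε => truncHilbert ε f x) (𝓝[>] 0) (𝓝 (h x)) := by
    have : ∀ n : ℕ, ∀ᵐ x, x ∈ Metric.ball (0 : ℝ) (n + 1) →
        Tendsto (fun ε => truncHilbert ε f x) (𝓝[>] 0) (𝓝 (h x)) := fun n => by
      obtain ⟨h', h1, -⟩ := hloc 0 (n + 1) (by positivity)
      rw [ae_restrict_iff' Metric.isOpen_ball.measurableSet] at h1
      filter_upwards [h1] with x hx hxB
      exact tendsto_nhds_limUnder ⟨_, hx hxB⟩
    filter_upwards [ae_all_iff.2 this] with x hx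
    obtain ⟨n, hn⟩ := exists_nat_gt |x|
    exact hx n (by rw [mem_ball_zero_iff, Real.norm_eq_abs]; linarith)
  refine ⟨h, ?_, hlim, fun c r hr => ?_⟩
  · refine aestronglyMeasurable_of_tendsto_ae atTop
      (fun n : ℕ => aestronglyMeasurable_truncHilbert hf (1 / ((n : ℝ) + 1))) ?_
    filter_upwards [hlim] with x hx using hx.comp tendsto_one_div_add_one_nhdsGT_zero
  · obtain ⟨h', h1, h2⟩ := hloc c r hr
    refine le_trans (le_of_eq (lintegral_congr_ae ?_)) h2
    filter_upwards [h1, ae_restrict_of_ae hlim] with x hx hx'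
    rw [tendsto_nhds_unique hx hx']

end

/-! ### The homogeneous difference kernel -/

noncomputable section

/-- The kernel `k` with `|(x/t)^α - 1| / |t - x| = k (t/x) / x`. -/
def weightKer (α s : ℝ) : ℝ := |s ^ (-α) - 1| * |s - 1|⁻¹

theorem weightKer_nonneg (α s : ℝ) : 0 ≤ weightKer α s := by unfold weightKer; positivity

theorem measurable_weightKer (α : ℝ) : Measurable (weightKer α) :=
  (continuous_abs.measurable.comp ((measurable_id.pow_const _).sub_const 1)).mul
    (continuous_abs.measurable.comp (measurable_id.sub_const 1)).inv

/-- The mean value inequality for s^(-α): the quotient stays bounded across s = 1, so the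
singularities of the two kernels cancel on the diagonal. -/
theorem exists_weightKer_le (α : ℝ) : ∃ M : ℝ, ∀ s ∈ Set.Icc (1 / 2 : ℝ) 2, weightKer α s ≤ M := by
  have hpos : ∀ s ∈ Set.Icc (1 / 2 : ℝ) 2, s ≠ 0 := fun s hs => by
    have := hs.1
    intro h
    rw [h] at this
    norm_num at this
  have hcont : ContinuousOn (fun s : ℝ => -α * s ^ (-α - 1)) (Set.Icc (1 / 2 : ℝ) 2) :=
    continuousOn_const.mul (continuousOn_id.rpow_const fun s hs => Or.inl (hpos s hs))
  obtain ⟨M, hM⟩ := isCompact_Icc.exists_bound_of_continuousOn hcont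
  have hM0 : 0 ≤ M := (norm_nonneg _).trans (hM 1 ⟨by norm_num, by norm_num⟩)
  refine ⟨M, fun s hs => ?_⟩
  have h := (convex_Icc (1 / 2 : ℝ) 2).norm_image_sub_le_of_norm_hasDerivWithin_le
    (f := fun s : ℝ => s ^ (-α)) (f' := fun s : ℝ => -α * s ^ (-α - 1)) (C := M)
    (fun y hy => (Real.hasDerivAt_rpow_const (Or.inl (hpos y hy))).hasDerivWithinAt) hM
    (x := 1) (y := s) ⟨by norm_num, by norm_num⟩ hs
  rw [Real.one_rpow, Real.norm_eq_abs, Real.norm_eq_abs] at h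
  unfold weightKer
  rcases eq_or_ne (|s - 1|) 0 with h0 | h0
  · rw [h0, inv_zero, mul_zero]; exact hM0
  · have : 0 < |s - 1| := lt_of_le_of_ne (abs_nonneg _) (Ne.symm h0)
    rwa [← div_eq_mul_inv, div_le_iff₀ this]

theorem abs_rpow_sub_one_le {s : ℝ} (hs : 0 < s) (α : ℝ) : |s ^ (-α) - 1| ≤ s ^ (-α) + 1 := by
  have := Real.rpow_pos_of_pos hs (-α)
  rw [abs_le]
  constructor <;> linarith

theorem lintegral_weightKer_lt_top {α γ : ℝ} (hγ0 : 0 < γ) (hγ1 : γ < 1) (h1 : -γ < α)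
    (h2 : α < 1 - γ) :
    ∫⁻ s in Set.Ioi (0 : ℝ), ENNReal.ofReal (weightKer α s * s ^ (-γ)) < ∞ := by
  have hsplit : Set.Ioi (0 : ℝ) = Set.Ioc 0 (1 / 2) ∪ (Set.Ioc (1 / 2) 2 ∪ Set.Ioi 2) := by
    rw [Set.Ioc_union_Ioi_eq_Ioi (by norm_num), Set.Ioc_union_Ioi_eq_Ioi (by norm_num)]
  have hrp : ∀ b : ℝ, -1 < b → IntegrableOn (fun s : ℝ => s ^ b) (Set.Ioc 0 (1 / 2)) := fun b hb =>
    (intervalIntegrable_iff_integrableOn_Ioc_of_le (by norm_num)).1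
      (intervalIntegral.intervalIntegrable_rpow' hb)
  have hrp' : ∀ b : ℝ, b < -1 → IntegrableOn (fun s : ℝ => s ^ b) (Set.Ioi 2) := fun b hb =>
    integrableOn_Ioi_rpow_of_lt hb (by norm_num)
  -- Near 0 the integrand is of order s^(-α-γ) + s^(-γ). Integrability uses α < 1 - γ and γ < 1.
  have A : ∫⁻ s in Set.Ioc (0 : ℝ) (1 / 2), ENNReal.ofReal (weightKer α s * s ^ (-γ)) < ∞ := by
    have hi : IntegrableOn (fun s : ℝ => 2 * (s ^ (-α - γ) + s ^ (-γ))) (Set.Ioc 0 (1 / 2)) :=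
      ((hrp _ (by linarith)).add (hrp _ (by linarith))).const_mul 2
    refine lt_of_le_of_lt (setLIntegral_mono' measurableSet_Ioc fun s hs => ?_) hi.lintegral_lt_top
    have hs0 := hs.1
    refine ENNReal.ofReal_le_ofReal ?_
    have e1 : |s - 1|⁻¹ ≤ 2 := by
      rw [abs_sub_comm, abs_of_pos (by linarith [hs.2]), inv_le_comm₀ (by linarith [hs.2]) two_pos]
      linarith [hs.2]
    have e2 := abs_rpow_sub_one_le hs0 α
    have e3 : s ^ (-α - γ) = s ^ (-α) * s ^ (-γ) := by rw [← Real.rpow_add hs0]; congr 1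
    unfold weightKer
    calc |s ^ (-α) - 1| * |s - 1|⁻¹ * s ^ (-γ) ≤ (s ^ (-α) + 1) * 2 * s ^ (-γ) := by gcongr
      _ = _ := by rw [e3]; ring
  have B : ∫⁻ s in Set.Ioc (1 / 2 : ℝ) 2, ENNReal.ofReal (weightKer α s * s ^ (-γ)) < ∞ := by
    obtain ⟨M, hM⟩ := exists_weightKer_le α
    refine lt_of_le_of_lt (setLIntegral_mono' (g := fun _ => ENNReal.ofReal (M * (1 / 2) ^ (-γ)))
      measurableSet_Ioc fun s hs => ?_) ?_
    · refine ENNReal.ofReal_le_ofReal (mul_le_mul (hM s ⟨hs.1.le, hs.2⟩) ?_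
        (Real.rpow_nonneg (by linarith [hs.1]) _) ((weightKer_nonneg α s).trans (hM s ⟨hs.1.le, hs.2⟩)))
      exact Real.rpow_le_rpow_of_nonpos (by norm_num) hs.1.le (by linarith)
    · rw [setLIntegral_const, Real.volume_Ioc]
      exact ENNReal.mul_lt_top ENNReal.ofReal_lt_top ENNReal.ofReal_lt_top
  -- Near infinity the integrand is of order s^(-α-γ-1) + s^(-γ-1). Integrability uses α > -γ and γ
  -- > 0.
  have C : ∫⁻ s in Set.Ioi (2 : ℝ), ENNReal.ofReal (weightKer α s * s ^ (-γ)) < ∞ := by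
    have hi : IntegrableOn (fun s : ℝ => 2 * (s ^ (-α - γ - 1) + s ^ (-γ - 1))) (Set.Ioi 2) :=
      ((hrp' _ (by linarith)).add (hrp' _ (by linarith))).const_mul 2
    refine lt_of_le_of_lt (setLIntegral_mono' measurableSet_Ioi fun s hs => ?_) hi.lintegral_lt_top
    have hs2 : (2 : ℝ) < s := hs
    have hs0 : 0 < s := by linarith
    refine ENNReal.ofReal_le_ofReal ?_
    have e1 : |s - 1|⁻¹ ≤ 2 * s ^ (-1 : ℝ) := by
      rw [abs_of_pos (by linarith), Real.rpow_neg_one, ← div_eq_mul_inv, le_div_iff₀ hs0,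
        inv_mul_le_iff₀ (by linarith)]
      linarith
    have e2 := abs_rpow_sub_one_le hs0 α
    have e3 : s ^ (-α - γ - 1) = s ^ (-α) * s ^ (-γ) * s ^ (-1 : ℝ) := by
      rw [← Real.rpow_add hs0, ← Real.rpow_add hs0]; congr 1
    have e4 : s ^ (-γ - 1) = s ^ (-γ) * s ^ (-1 : ℝ) := by
      rw [← Real.rpow_add hs0]; congr 1
    unfold weightKer
    calc |s ^ (-α) - 1| * |s - 1|⁻¹ * s ^ (-γ)
        ≤ (s ^ (-α) + 1) * (2 * s ^ (-1 : ℝ)) * s ^ (-γ) := by gcongr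
      _ = _ := by rw [e3, e4]; ring
  rw [hsplit]
  refine (lintegral_union_le _ _ _).trans_lt (ENNReal.add_lt_top.2 ⟨A, ?_⟩)
  exact (lintegral_union_le _ _ _).trans_lt (ENNReal.add_lt_top.2 ⟨B, C⟩)

theorem lintegral_comp_mul_left_real {a : ℝ} (ha : 0 < a) (G : ℝ → ℝ≥0∞) :
    ∫⁻ t, G t = ENNReal.ofReal a * ∫⁻ s, G (a * s) := by
  have h := lintegral_map_equiv G (Homeomorph.mulLeft₀ a ha.ne').toMeasurableEquiv (μ := volume)
  have h2 : Measure.map (Homeomorph.mulLeft₀ a ha.ne').toMeasurableEquiv (volume : Measure ℝ) =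
      ENNReal.ofReal |a⁻¹| • volume := Real.map_volume_mul_left ha.ne'
  rw [h2, lintegral_smul_measure, smul_eq_mul] at h
  change _ = ∫⁻ s, G (a * s) at h
  rw [← h, ← mul_assoc, ← ENNReal.ofReal_mul ha.le, abs_of_pos (inv_pos.2 ha),
    mul_inv_cancel₀ ha.ne', ENNReal.ofReal_one, one_mul]

variable {𝕜 : Type*} [RCLike 𝕜]

/-- The kernel of the difference between the weighted and the unweighted singular operator. -/
def diffKer (α x t : ℝ) : ℝ := ((x / t) ^ α - 1) * (t - x)⁻¹

theorem measurable_diffKer (α : ℝ) : Measurable fun z : ℝ × ℝ => diffKer α z.1 z.2 :=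
  (((measurable_fst.div measurable_snd).pow_const α).sub_const 1).mul
    (measurable_snd.sub measurable_fst).inv

/-- The operator with kernel `|diffKer|`. -/
def diffMajorant (α : ℝ) (f : ℝ → 𝕜) (x : ℝ) : ℝ≥0∞ :=
  ∫⁻ t in Set.Ioi 0, ‖diffKer α x t • f t‖ₑ

theorem abs_diffKer_mul {α x s : ℝ} (hx : 0 < x) (hs : 0 < s) :
    x * |diffKer α x (x * s)| = weightKer α s := by
  have e1 : x / (x * s) = s⁻¹ := by field_simp
  have e2 : x * s - x = x * (s - 1) := by ring
  unfold diffKer weightKer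
  rw [e1, e2, Real.inv_rpow hs.le, ← Real.rpow_neg hs.le, abs_mul, abs_inv, abs_mul, abs_of_pos hx]
  field_simp

/-- The substitution t = xs, together with homogeneity of degree -1, turns the operator into an
average of the dilates f(xs) with a weight independent of x. -/
theorem diffMajorant_eq {α : ℝ} (f : ℝ → 𝕜) {x : ℝ} (hx : 0 < x) :
    diffMajorant α f x = ∫⁻ s in Set.Ioi 0, ENNReal.ofReal (weightKer α s) * ‖f (x * s)‖ₑ := by
  unfold diffMajorant
  rw [← lintegral_indicator measurableSet_Ioi, ← lintegral_indicator measurableSet_Ioi,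
    lintegral_comp_mul_left_real hx, ← lintegral_const_mul' _ _ ENNReal.ofReal_ne_top]
  refine lintegral_congr fun s => ?_
  by_cases hs : 0 < s
  · rw [Set.indicator_of_mem (Set.mem_Ioi.2 (mul_pos hx hs)), Set.indicator_of_mem (Set.mem_Ioi.2 hs),
      enorm_smul, ← mul_assoc, Real.enorm_eq_ofReal_abs, ← ENNReal.ofReal_mul hx.le,
      abs_diffKer_mul hx hs]
  · rw [Set.indicator_of_notMem (by rw [Set.mem_Ioi, mul_pos_iff_of_pos_left hx]; exact hs),
      Set.indicator_of_notMem (by exact hs), mul_zero]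

/-- The difference operator is bounded in Morrey spaces. -/
theorem lintegral_diffMajorant_rpow_le {p lam α : ℝ} (hp : 1 < p) {K : ℝ≥0∞} {f : ℝ → 𝕜}
    (hf : StronglyMeasurable f) (hK : MorreyBound p lam K f)
    (hDt : ∫⁻ s in Set.Ioi (0 : ℝ), ENNReal.ofReal (weightKer α s * s ^ (-((1 - lam) / p))) ≠ ∞)
    (c : ℝ) {r : ℝ} (hr : 0 < r) :
    ∫⁻ x in Metric.ball c r ∩ Set.Ioi 0, diffMajorant α f x ^ p ≤
      (∫⁻ s in Set.Ioi (0 : ℝ), ENNReal.ofReal (weightKer α s * s ^ (-((1 - lam) / p)))) ^ p *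
        K * ENNReal.ofReal (r ^ lam) := by
  have hp0 : 0 < p := by linarith
  set γ := (1 - lam) / p with hγ
  -- The factor s^(-γ) goes into the weight, and s^γ stays with f(xs). Then Hölder with total mass D
  -- loses nothing, since s^γ f(s·) obeys the same Morrey bound as f.
  set w : ℝ → ℝ≥0∞ := fun s => ENNReal.ofReal (weightKer α s * s ^ (-γ)) with hw
  have hwm : Measurable w := ((measurable_weightKer α).mul (measurable_id.pow_const _)).ennreal_ofReal
  set D := ∫⁻ s in Set.Ioi (0 : ℝ), w s with hD
  have hmeas : Measurable (Function.uncurry fun x s : ℝ =>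
      w s * (ENNReal.ofReal (s ^ γ) * ‖f (x * s)‖ₑ) ^ p) := by
    have h1 : Measurable fun z : ℝ × ℝ => ENNReal.ofReal (z.2 ^ γ) * ‖f (z.1 * z.2)‖ₑ :=
      (measurable_snd.pow_const γ).ennreal_ofReal.mul
        (hf.measurable.comp (measurable_fst.mul measurable_snd)).enorm
    exact (hwm.comp measurable_snd).mul (h1.pow_const p)
  have hpt : ∀ x : ℝ, 0 < x → diffMajorant α f x ^ p ≤
      D ^ (p - 1) * ∫⁻ s in Set.Ioi 0, w s * (ENNReal.ofReal (s ^ γ) * ‖f (x * s)‖ₑ) ^ p := by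
    intro x hx
    have e : diffMajorant α f x = ∫⁻ s in Set.Ioi 0, w s * (ENNReal.ofReal (s ^ γ) * ‖f (x * s)‖ₑ) := by
      rw [diffMajorant_eq f hx]
      refine setLIntegral_congr_fun measurableSet_Ioi fun s hs => ?_
      have hs0 : 0 < s := hs
      simp only [hw]
      rw [← mul_assoc, ← ENNReal.ofReal_mul (mul_nonneg (weightKer_nonneg _ _) (by positivity)),
        mul_assoc (weightKer α s), ← Real.rpow_add hs0, neg_add_cancel, Real.rpow_zero, mul_one]
    rw [e]
    refine lintegral_mul_rpow_le hp hwm.aemeasurable (Measurable.aemeasurable ?_)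
    exact (measurable_id.pow_const γ).ennreal_ofReal.mul
      (hf.measurable.comp (measurable_const.mul measurable_id)).enorm
  have hinner : ∀ s : ℝ, 0 < s → ∫⁻ x in Metric.ball c r ∩ Set.Ioi 0,
      w s * (ENNReal.ofReal (s ^ γ) * ‖f (x * s)‖ₑ) ^ p ≤ w s * (K * ENNReal.ofReal (r ^ lam)) := by
    intro s hs
    have hscale : ∫⁻ x in Metric.ball c r, ‖f (x * s)‖ₑ ^ p ≤
        ENNReal.ofReal s⁻¹ * (K * ENNReal.ofReal ((s * r) ^ lam)) := by
      have h := hK (s * c) (s * r) (by positivity)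
      rw [← lintegral_indicator Metric.isOpen_ball.measurableSet, lintegral_comp_mul_left_real hs] at h
      have e : ∀ x, (Metric.ball (s * c) (s * r)).indicator (fun t => ‖f t‖ₑ ^ p) (s * x) =
          (Metric.ball c r).indicator (fun x => ‖f (x * s)‖ₑ ^ p) x := fun x => by
        have hiff : s * x ∈ Metric.ball (s * c) (s * r) ↔ x ∈ Metric.ball c r := by
          rw [Metric.mem_ball, Metric.mem_ball, Real.dist_eq, Real.dist_eq, ← mul_sub, abs_mul,
            abs_of_pos hs, mul_lt_mul_iff_right₀ hs]
        by_cases hx : x ∈ Metric.ball c r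
        · rw [Set.indicator_of_mem hx, Set.indicator_of_mem (hiff.2 hx), mul_comm s x]
        · rw [Set.indicator_of_notMem hx, Set.indicator_of_notMem (fun h => hx (hiff.1 h))]
      simp_rw [e] at h
      rw [lintegral_indicator Metric.isOpen_ball.measurableSet] at h
      calc _ = ENNReal.ofReal s⁻¹ * (ENNReal.ofReal s * ∫⁻ x in Metric.ball c r, ‖f (x * s)‖ₑ ^ p) := by
            rw [← mul_assoc, ← ENNReal.ofReal_mul (by positivity), inv_mul_cancel₀ hs.ne',
              ENNReal.ofReal_one, one_mul]
        _ ≤ _ := by gcongr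
    calc _ ≤ ∫⁻ x in Metric.ball c r, w s * ENNReal.ofReal (s ^ γ) ^ p * ‖f (x * s)‖ₑ ^ p := by
          refine (lintegral_mono_set Set.inter_subset_left).trans (lintegral_mono fun x => ?_)
          rw [ENNReal.mul_rpow_of_nonneg _ _ hp0.le, mul_assoc]
      _ = w s * ENNReal.ofReal (s ^ γ) ^ p * ∫⁻ x in Metric.ball c r, ‖f (x * s)‖ₑ ^ p :=
          lintegral_const_mul' _ _ (ENNReal.mul_ne_top ENNReal.ofReal_ne_top
            (ENNReal.rpow_ne_top_of_nonneg hp0.le ENNReal.ofReal_ne_top))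
      _ ≤ w s * ENNReal.ofReal (s ^ γ) ^ p *
            (ENNReal.ofReal s⁻¹ * (K * ENNReal.ofReal ((s * r) ^ lam))) := by gcongr
      _ = w s * (K * (ENNReal.ofReal (s ^ γ) ^ p * ENNReal.ofReal s⁻¹ *
            ENNReal.ofReal ((s * r) ^ lam))) := by ring
      _ = _ := by
          congr 2
          rw [ENNReal.ofReal_rpow_of_nonneg (by positivity) hp0.le,
            ← ENNReal.ofReal_mul (by positivity), ← ENNReal.ofReal_mul (by positivity),
            Real.mul_rpow hs.le hr.le, ← Real.rpow_mul hs.le, ← Real.rpow_neg_one, ← mul_assoc,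
            ← Real.rpow_add hs, ← Real.rpow_add hs]
          -- This cancellation of the powers of s is what singles out γ = (1 - λ)/p.
          have : γ * p + -1 + lam = 0 := by rw [hγ]; field_simp; ring
          rw [this, Real.rpow_zero, one_mul]
  have hms : MeasurableSet (Metric.ball c r ∩ Set.Ioi 0) :=
    Metric.isOpen_ball.measurableSet.inter measurableSet_Ioi
  calc _ ≤ ∫⁻ x in Metric.ball c r ∩ Set.Ioi 0, D ^ (p - 1) *
        ∫⁻ s in Set.Ioi 0, w s * (ENNReal.ofReal (s ^ γ) * ‖f (x * s)‖ₑ) ^ p :=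
        setLIntegral_mono' hms fun x hx => hpt x hx.2
    _ = D ^ (p - 1) * ∫⁻ s in Set.Ioi 0, ∫⁻ x in Metric.ball c r ∩ Set.Ioi 0,
          w s * (ENNReal.ofReal (s ^ γ) * ‖f (x * s)‖ₑ) ^ p := by
        rw [lintegral_const_mul' _ _ (ENNReal.rpow_ne_top_of_nonneg (by linarith) hDt),
          lintegral_lintegral_swap hmeas.aemeasurable]
    _ ≤ D ^ (p - 1) * ∫⁻ s in Set.Ioi 0, w s * (K * ENNReal.ofReal (r ^ lam)) := by
        exact mul_le_mul' le_rfl (setLIntegral_mono' measurableSet_Ioi fun s hs => hinner s hs)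
    _ = _ := by
        rw [lintegral_mul_const _ hwm, ← hD, ← mul_assoc, ← mul_assoc]
        congr 2
        -- The law D^(p-1) D = D^p is taken from `ENNReal.rpow_add`, which needs D ≠ 0.
        rcases eq_or_ne D 0 with h0 | h0
        · rw [h0, mul_zero, ENNReal.zero_rpow_of_pos hp0]
        · conv_lhs => enter [2]; rw [← ENNReal.rpow_one D]
          rw [← ENNReal.rpow_add _ _ h0 hDt, sub_add_cancel]

end

/-! ### Transfer to the segment and sufficiency -/

noncomputable section

variable {𝕜 : Type*} [RCLike 𝕜]

theorem measurableSet_segment0 (ℓ : EReal) : MeasurableSet (segment0 ℓ) :=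
  measurableSet_Ici.inter (measurableSet_le measurable_coe_real_ereal measurable_const)

theorem lintegral_le_morreyNorm {p lam : ℝ} (hp : 0 < p) {ℓ : EReal} (f : ℝ → 𝕜) {x r : ℝ}
    (hx : x ∈ segment0 ℓ) (hr : 0 < r) :
    ∫⁻ y in Metric.ball x r ∩ segment0 ℓ, ‖f y‖ₑ ^ p ≤
      morreyNorm p lam ℓ f ^ p * ENNReal.ofReal (r ^ lam) := by
  have h : (ENNReal.ofReal (r ^ (-lam)) *
      ∫⁻ y in Metric.ball x r ∩ segment0 ℓ, ‖f y‖ₑ ^ p) ^ (1 / p) ≤ morreyNorm p lam ℓ f :=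
    (le_iSup₂ (f := fun r (_ : r ∈ Set.Ioi (0 : ℝ)) => (ENNReal.ofReal (r ^ (-lam)) *
      ∫⁻ y in Metric.ball x r ∩ segment0 ℓ, ‖f y‖ₑ ^ p) ^ (1 / p)) r hr).trans
      (le_iSup₂ (f := fun x (_ : x ∈ segment0 ℓ) => ⨆ r ∈ Set.Ioi (0 : ℝ),
        (ENNReal.ofReal (r ^ (-lam)) *
        ∫⁻ y in Metric.ball x r ∩ segment0 ℓ, ‖f y‖ₑ ^ p) ^ (1 / p)) x hx)
  have h2 := ENNReal.rpow_le_rpow h hp.le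
  rw [← ENNReal.rpow_mul, one_div_mul_cancel hp.ne', ENNReal.rpow_one] at h2
  calc _ = ENNReal.ofReal (r ^ lam) * (ENNReal.ofReal (r ^ (-lam)) *
        ∫⁻ y in Metric.ball x r ∩ segment0 ℓ, ‖f y‖ₑ ^ p) := by
        rw [← mul_assoc, ← ENNReal.ofReal_mul (by positivity), ← Real.rpow_add hr, add_neg_cancel,
          Real.rpow_zero, ENNReal.ofReal_one, one_mul]
    _ ≤ _ := by rw [mul_comm]; gcongr

theorem morreyNorm_le {p lam : ℝ} (hp : 0 < p) {ℓ : EReal} {f : ℝ → 𝕜} {K : ℝ≥0∞}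
    (h : ∀ x r : ℝ, 0 < r →
      ∫⁻ y in Metric.ball x r ∩ segment0 ℓ, ‖f y‖ₑ ^ p ≤ K * ENNReal.ofReal (r ^ lam)) :
    morreyNorm p lam ℓ f ≤ K ^ (1 / p) := by
  refine iSup₂_le fun x _ => iSup₂_le fun r hr => ENNReal.rpow_le_rpow ?_ (by positivity)
  have hr0 : 0 < r := hr
  calc _ ≤ ENNReal.ofReal (r ^ (-lam)) * (K * ENNReal.ofReal (r ^ lam)) := by
        gcongr
        exact h x r hr
    _ = K := by
        rw [mul_left_comm, ← ENNReal.ofReal_mul (by positivity), ← Real.rpow_add hr0,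
          neg_add_cancel, Real.rpow_zero, ENNReal.ofReal_one, mul_one]

/-- The Morrey norm on the segment sees only centres in the segment. A ball about an arbitrary x
that meets the segment at y lies in the ball of radius 2r about y, which costs the factor 2^λ. -/
theorem morreyBound_indicator {p lam : ℝ} (hp : 0 < p) {ℓ : EReal} {f g : ℝ → 𝕜}
    (hfg : f =ᵐ[volume.restrict (segment0 ℓ)] g) :
    MorreyBound p lam (morreyNorm p lam ℓ f ^ p * ENNReal.ofReal (2 ^ lam))
      ((segment0 ℓ ∩ Set.Ioi 0).indicator g) := by
  intro x r hr
  have hI := measurableSet_segment0 ℓ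
  have h1 : ∫⁻ t in Metric.ball x r, ‖(segment0 ℓ ∩ Set.Ioi 0).indicator g t‖ₑ ^ p ≤
      ∫⁻ t in Metric.ball x r ∩ segment0 ℓ, ‖f t‖ₑ ^ p := by
    calc _ ≤ ∫⁻ t in Metric.ball x r, (segment0 ℓ).indicator (fun t => ‖g t‖ₑ ^ p) t := by
          refine lintegral_mono fun t => ?_
          by_cases ht : t ∈ segment0 ℓ ∩ Set.Ioi 0
          · rw [Set.indicator_of_mem ht, Set.indicator_of_mem ht.1]
          · rw [Set.indicator_of_notMem ht, enorm_zero, ENNReal.zero_rpow_of_pos hp]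
            exact zero_le
      _ = ∫⁻ t in Metric.ball x r ∩ segment0 ℓ, ‖g t‖ₑ ^ p := by
          rw [lintegral_indicator hI, Measure.restrict_restrict hI, Set.inter_comm]
      _ = _ := by
          refine lintegral_congr_ae ?_
          filter_upwards [ae_restrict_of_ae_restrict_of_subset Set.inter_subset_right hfg] with t ht
          rw [ht]
  refine h1.trans ?_
  rcases (Metric.ball x r ∩ segment0 ℓ).eq_empty_or_nonempty with h | ⟨y, hyB, hyI⟩
  · rw [h, setLIntegral_empty]; exact zero_le
  · refine (lintegral_mono_set (Set.inter_subset_inter_left _ ?_)).trans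
      ((lintegral_le_morreyNorm (lam := lam) hp f hyI (r := 2 * r) (by positivity)).trans (le_of_eq ?_))
    · refine Metric.ball_subset_ball' ?_
      rw [Metric.mem_ball, dist_comm] at hyB
      linarith
    · rw [Real.mul_rpow (by norm_num) hr.le, ENNReal.ofReal_mul (by positivity), mul_assoc]

theorem truncatedSegment_eq (ℓ : EReal) (x ε : ℝ) :
    truncatedSegment ℓ x ε = segment0 ℓ ∩ {t | ε < |t - x|} := rfl

/-- On positive functions the weighted singular kernel is a perturbation of the Hilbert kernel. -/
theorem singularIntegrand_eq {α x t : ℝ} (hx : 0 < x) (ht : 0 < t) (f : ℝ → 𝕜) :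
    singularIntegrand α f x t = x ^ (-α) • ((t - x)⁻¹ • f t + diffKer α x t • f t) := by
  unfold singularIntegrand diffKer
  rw [← add_smul, smul_smul]
  congr 1
  rw [Real.div_rpow hx.le ht.le, mul_inv, Real.rpow_neg hx.le]
  have h1 := (Real.rpow_pos_of_pos hx α).ne'
  have h2 := (Real.rpow_pos_of_pos ht α).ne'
  rcases eq_or_ne (t - x) 0 with h | h
  · simp [h]
  · field_simp
    ring

/-- After the powers of x are factored out, the truncation splits into a Hilbert part, which
converges by assumption, and a part with absolutely integrable kernel, where dominated convergence
removes the truncation. -/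
theorem tendsto_truncatedSingularOperator {α p lam : ℝ} (hp : 1 < p) (hlam1 : lam < 1) {ℓ : EReal}
    {f g : ℝ → 𝕜} (hfg : f =ᵐ[volume.restrict (segment0 ℓ)] g) {x : ℝ} (hx : 0 < x)
    {K : ℝ≥0∞} (hKt : K ≠ ∞)
    (hG : AEStronglyMeasurable ((segment0 ℓ ∩ Set.Ioi 0).indicator g))
    (hK : MorreyBound p lam K ((segment0 ℓ ∩ Set.Ioi 0).indicator g))
    (hT : diffMajorant α ((segment0 ℓ ∩ Set.Ioi 0).indicator g) x < ∞) {v : 𝕜}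
    (hv : Tendsto (fun ε => truncHilbert ε ((segment0 ℓ ∩ Set.Ioi 0).indicator g) x)
      (𝓝[>] 0) (𝓝 v)) :
    (∀ ε : ℝ, 0 < ε → IntegrableOn (singularIntegrand α f x) (truncatedSegment ℓ x ε)) ∧
    Tendsto (truncatedSingularOperator α ℓ f x) (𝓝[>] 0) (𝓝 (Real.pi⁻¹ • (v +
      ∫ t in Set.Ioi 0, diffKer α x t • (segment0 ℓ ∩ Set.Ioi 0).indicator g t))) := by
  set J := segment0 ℓ ∩ Set.Ioi 0 with hJ
  have hJm : MeasurableSet J := (measurableSet_segment0 ℓ).inter measurableSet_Ioi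
  set G := J.indicator g with hGdef
  have hG0 : ∀ t, t ∉ J → G t = 0 := fun t ht => Set.indicator_of_notMem ht _
  -- Only the point 0 is dropped, so that the power identities for t > 0 are available.
  have hJI : J =ᵐ[volume] segment0 ℓ := by
    have h1 : segment0 ℓ ∩ Set.Ici 0 = segment0 ℓ := Set.inter_eq_left.2 fun t ht => ht.1
    rw [hJ]
    conv_rhs => rw [← h1]
    exact (EventuallyEq.refl _ _).inter Ioi_ae_eq_Ici
  have hS := fun ε : ℝ => measurableSet_lt_abs_sub ε x
  have htr : ∀ ε : ℝ, (J ∩ {t | ε < |t - x|} : Set ℝ) =ᵐ[volume] truncatedSegment ℓ x ε := fun ε => by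
    rw [truncatedSegment_eq]
    exact hJI.inter (EventuallyEq.refl _ _)
  have i1 : ∀ ε : ℝ, 0 < ε → IntegrableOn (fun t => (t - x)⁻¹ • G t) {t | ε < |t - x|} := fun ε hε =>
    (hK.integrableOn_tail hp hlam1 hKt hG x hε).mono_set fun t ht => le_of_lt (Set.mem_ofPred.1 ht)
  have i2 : IntegrableOn (fun t => diffKer α x t • G t) (Set.Ioi 0) :=
    ⟨((((measurable_diffKer α).comp (measurable_const.prodMk measurable_id)).aestronglyMeasurable
      (μ := volume)).smul hG).restrict, hT⟩
  have hcongr : ∀ ε : ℝ, ∀ᵐ t ∂(volume.restrict (J ∩ {t | ε < |t - x|})),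
      x ^ (-α) • ((t - x)⁻¹ • G t + diffKer α x t • G t) = singularIntegrand α f x t := fun ε => by
    have h1 : ∀ᵐ t ∂(volume.restrict (J ∩ {t | ε < |t - x|})), f t = g t :=
      ae_restrict_of_ae_restrict_of_subset (Set.inter_subset_left.trans Set.inter_subset_left) hfg
    filter_upwards [h1, ae_restrict_mem (hJm.inter (hS ε))] with t ht htm
    rw [singularIntegrand_eq hx htm.1.2, ht, hGdef, Set.indicator_of_mem htm.1]
  have hIoi : ∀ ε : ℝ, J ∩ {t | ε < |t - x|} ⊆ Set.Ioi 0 ∩ {t | ε < |t - x|} := fun ε =>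
    Set.inter_subset_inter_left _ Set.inter_subset_right
  have hint : ∀ ε : ℝ, 0 < ε → IntegrableOn (singularIntegrand α f x) (truncatedSegment ℓ x ε) := by
    intro ε hε
    rw [← integrableOn_congr_set_ae (htr ε)]
    exact Integrable.congr (f := fun t => x ^ (-α) • ((t - x)⁻¹ • G t + diffKer α x t • G t))
      ((((i1 ε hε).mono_set Set.inter_subset_right).add
        (i2.mono_set ((hIoi ε).trans Set.inter_subset_left))).smul (x ^ (-α))) (hcongr ε)
  refine ⟨hint, ?_⟩
  have heq : ∀ ε : ℝ, 0 < ε → truncatedSingularOperator α ℓ f x ε =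
      Real.pi⁻¹ • (truncHilbert ε G x +
        ∫ t in Set.Ioi 0, {t | ε < |t - x|}.indicator (fun t => diffKer α x t • G t) t) := by
    intro ε hε
    have e1 : ∫ t in truncatedSegment ℓ x ε, singularIntegrand α f x t =
        x ^ (-α) • ((∫ t in J ∩ {t | ε < |t - x|}, (t - x)⁻¹ • G t) +
          ∫ t in J ∩ {t | ε < |t - x|}, diffKer α x t • G t) := by
      rw [← setIntegral_congr_set (htr ε), ← integral_congr_ae (hcongr ε), integral_smul,
        integral_add ((i1 ε hε).mono_set Set.inter_subset_right)
          (i2.mono_set ((hIoi ε).trans Set.inter_subset_left))]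
    have e2 : ∫ t in J ∩ {t | ε < |t - x|}, (t - x)⁻¹ • G t = truncHilbert ε G x := by
      unfold truncHilbert
      refine (setIntegral_eq_of_subset_of_forall_sdiff_eq_zero (hS ε) Set.inter_subset_right
        fun t ht => ?_).symm
      rw [hG0 t fun h => ht.2 ⟨h, ht.1⟩, smul_zero]
    have e3 : ∫ t in J ∩ {t | ε < |t - x|}, diffKer α x t • G t =
        ∫ t in Set.Ioi 0, {t | ε < |t - x|}.indicator (fun t => diffKer α x t • G t) t := by
      rw [setIntegral_indicator (hS ε)]
      refine (setIntegral_eq_of_subset_of_forall_sdiff_eq_zero (measurableSet_Ioi.inter (hS ε))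
        (hIoi ε) fun t ht => ?_).symm
      rw [hG0 t fun h => ht.2 ⟨h, ht.1.2⟩, smul_zero]
    unfold truncatedSingularOperator
    rw [e1, e2, e3, smul_smul]
    congr 1
    rw [div_mul_eq_mul_div, ← Real.rpow_add hx, add_neg_cancel, Real.rpow_zero, one_div]
  have hlim : Tendsto (fun ε : ℝ => ∫ t in Set.Ioi 0,
      {t | ε < |t - x|}.indicator (fun t => diffKer α x t • G t) t) (𝓝[>] 0)
      (𝓝 (∫ t in Set.Ioi 0, diffKer α x t • G t)) := by
    refine tendsto_integral_filter_of_dominated_convergence (fun t => ‖diffKer α x t • G t‖)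
      (.of_forall fun ε => i2.1.indicator (hS ε))
      (.of_forall fun ε => .of_forall fun t => norm_indicator_le_norm_self _ _) i2.norm ?_
    filter_upwards [ae_restrict_of_ae (Measure.ae_ne volume x)] with t ht
    refine tendsto_const_nhds.congr' ?_
    have : 0 < |t - x| := abs_pos.2 (sub_ne_zero.2 ht)
    filter_upwards [Ioo_mem_nhdsGT this] with ε hε
    rw [Set.indicator_of_mem (by exact hε.2)]
  refine ((hv.add hlim).const_smul Real.pi⁻¹).congr' ?_
  filter_upwards [self_mem_nhdsWithin] with ε hε
  exact (heq ε hε).symm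

theorem aestronglyMeasurable_truncatedSingularOperator {α : ℝ} {ℓ : EReal} {f : ℝ → 𝕜}
    (hf : AEStronglyMeasurable f (volume.restrict (segment0 ℓ))) (ε : ℝ) :
    AEStronglyMeasurable (fun x => truncatedSingularOperator α ℓ f x ε)
      (volume.restrict (segment0 ℓ)) := by
  have hS : MeasurableSet {z : ℝ × ℝ | ε < |z.2 - z.1|} :=
    measurableSet_lt measurable_const (continuous_abs.measurable.comp
      (measurable_snd.sub measurable_fst))
  have hm : Measurable fun z : ℝ × ℝ => (z.2 ^ α * (z.2 - z.1))⁻¹ :=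
    ((measurable_snd.pow_const α).mul (measurable_snd.sub measurable_fst)).inv
  have h : AEStronglyMeasurable ({z : ℝ × ℝ | ε < |z.2 - z.1|}.indicator
      fun z : ℝ × ℝ => singularIntegrand α f z.1 z.2)
      ((volume.restrict (segment0 ℓ)).prod (volume.restrict (segment0 ℓ))) :=
    (hm.aestronglyMeasurable.smul hf.comp_snd).indicator hS
  have h2 : AEStronglyMeasurable (fun x : ℝ => x ^ α / Real.pi) (volume.restrict (segment0 ℓ)) :=
    ((measurable_id.pow_const α).div_const _).aestronglyMeasurable
  refine (h2.smul h.integral_prod_right').congr (.of_forall fun x => ?_)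
  simp only [truncatedSingularOperator, Pi.smul_apply', truncatedSegment_eq]
  rw [← setIntegral_indicator (measurableSet_lt_abs_sub ε x)]
  rfl

/-- The sufficiency half of the boundedness criterion. -/
theorem singularOperatorIsBounded_of_lt {α p lam : ℝ} {ℓ : EReal} (hp : 1 < p)
    (hlam0 : 0 ≤ lam) (hlam1 : lam < 1) (h1 : -((1 - lam) / p) < α) (h2 : α < 1 - (1 - lam) / p) :
    SingularOperatorIsBounded 𝕜 α p lam ℓ := by
  have hp0 : 0 < p := by linarith
  have hγ0 : 0 < (1 - lam) / p := div_pos (by linarith) hp0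
  have hγ1 : (1 - lam) / p < 1 := by rw [div_lt_one hp0]; linarith
  obtain ⟨C, hC⟩ := exists_hilbert_morrey 𝕜 hp hlam1
  have hD := lintegral_weightKer_lt_top hγ0 hγ1 h1 h2
  set D := ∫⁻ s in Set.Ioi (0 : ℝ), ENNReal.ofReal (weightKer α s * s ^ (-((1 - lam) / p)))
  set B : ℝ≥0∞ := 2 ^ (p - 1) * (C + D ^ p) with hB
  have hBt : B ≠ ∞ := ENNReal.mul_ne_top (by finiteness) (ENNReal.add_ne_top.2
    ⟨ENNReal.coe_ne_top, ENNReal.rpow_ne_top_of_nonneg hp0.le hD.ne⟩)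
  set A : ℝ≥0∞ := (B * ENNReal.ofReal (2 ^ lam)) ^ (1 / p) with hA
  have hAt : A ≠ ∞ := ENNReal.rpow_ne_top_of_nonneg (by positivity)
    (ENNReal.mul_ne_top hBt ENNReal.ofReal_ne_top)
  refine ⟨A.toNNReal, fun f hf => ?_⟩
  rw [ENNReal.coe_toNNReal hAt]
  have hI := measurableSet_segment0 ℓ
  set N := morreyNorm p lam ℓ f with hN
  have hNt : N < ∞ := hf.2
  set K : ℝ≥0∞ := N ^ p * ENNReal.ofReal (2 ^ lam) with hKdef
  have hKt : K ≠ ∞ := ENNReal.mul_ne_top (ENNReal.rpow_ne_top_of_nonneg hp0.le hNt.ne)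
    ENNReal.ofReal_ne_top
  set g := hf.1.mk f
  have hfg : f =ᵐ[volume.restrict (segment0 ℓ)] g := hf.1.ae_eq_mk
  set G := (segment0 ℓ ∩ Set.Ioi 0).indicator g with hGdef
  have hGm : StronglyMeasurable G := hf.1.stronglyMeasurable_mk.indicator (hI.inter measurableSet_Ioi)
  have hGK : MorreyBound p lam K G := morreyBound_indicator hp0 hfg
  obtain ⟨h, hhm, hlim, hhK⟩ := hC G K hKt hGm.aestronglyMeasurable hGK
  have hTK := fun c r hr => lintegral_diffMajorant_rpow_le (α := α) hp hGm hGK hD.ne c (r := r) hr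
  have hTm : AEMeasurable (diffMajorant α G) := by
    have : Measurable (Function.uncurry fun x t : ℝ => ‖diffKer α x t • G t‖ₑ) :=
      ((measurable_diffKer α).smul (hGm.measurable.comp measurable_snd)).enorm
    exact this.lintegral_prod_right'.aemeasurable
  -- Finite p-th moments on an exhausting sequence of balls give finiteness almost everywhere, hence
  -- absolute convergence of the correction term.
  have hTfin : ∀ᵐ x, 0 < x → diffMajorant α G x < ∞ := by
    have hn : ∀ n : ℕ, ∀ᵐ x, x ∈ Metric.ball (0 : ℝ) (n + 1) ∩ Set.Ioi 0 →
        diffMajorant α G x < ∞ := fun n => by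
      have hfin : ∫⁻ x in Metric.ball (0 : ℝ) (n + 1) ∩ Set.Ioi 0, diffMajorant α G x ^ p ≠ ∞ := by
        refine ((hTK 0 (n + 1) (by positivity)).trans_lt ?_).ne
        exact ENNReal.mul_lt_top (ENNReal.mul_lt_top
          (ENNReal.rpow_lt_top_of_nonneg hp0.le hD.ne) hKt.lt_top) ENNReal.ofReal_lt_top
      have := ae_lt_top' (hTm.pow_const p).restrict hfin
      rw [ae_restrict_iff' (Metric.isOpen_ball.measurableSet.inter measurableSet_Ioi)] at this
      filter_upwards [this] with x hx hxm
      exact (ENNReal.rpow_lt_top_iff_of_pos hp0).1 (hx hxm)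
    filter_upwards [ae_all_iff.2 hn] with x hx hx0
    obtain ⟨n, hn⟩ := exists_nat_gt |x|
    exact hx n ⟨by rw [mem_ball_zero_iff, Real.norm_eq_abs]; linarith, hx0⟩
  set R : ℝ → 𝕜 := fun x => ∫ t in Set.Ioi 0, diffKer α x t • G t with hR
  have hRT : ∀ x, ‖R x‖ₑ ≤ diffMajorant α G x := fun x => enorm_integral_le_lintegral_enorm _
  have hpos : ∀ᵐ x ∂(volume.restrict (segment0 ℓ)), 0 < x := by
    filter_upwards [ae_restrict_mem hI, ae_restrict_of_ae (Measure.ae_ne volume (0 : ℝ))]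
      with x hx hx0
    exact lt_of_le_of_ne hx.1 (Ne.symm hx0)
  have hex : ∀ᵐ x ∂(volume.restrict (segment0 ℓ)),
      (∀ ε : ℝ, 0 < ε → IntegrableOn (singularIntegrand α f x) (truncatedSegment ℓ x ε)) ∧
      Tendsto (truncatedSingularOperator α ℓ f x) (𝓝[>] 0) (𝓝 (Real.pi⁻¹ • (h x + R x))) := by
    filter_upwards [hpos, ae_restrict_of_ae hlim, ae_restrict_of_ae hTfin] with x hx hxl hxT
    exact tendsto_truncatedSingularOperator hp hlam1 hfg hx hKt hGm.aestronglyMeasurable hGK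
      (hxT hx) hxl
  have hval : ∀ᵐ x ∂(volume.restrict (segment0 ℓ)),
      singularOperator α ℓ f x = Real.pi⁻¹ • (h x + R x) := by
    filter_upwards [hex] with x hx using hx.2.limUnder_eq
  have hmeas : AEStronglyMeasurable (singularOperator α ℓ f) (volume.restrict (segment0 ℓ)) := by
    refine aestronglyMeasurable_of_tendsto_ae atTop
      (fun n : ℕ => aestronglyMeasurable_truncatedSingularOperator (α := α) hf.1 (1 / ((n : ℝ) + 1))) ?_
    filter_upwards [hex, hval] with x hx hxv
    rw [hxv]
    exact hx.2.comp tendsto_one_div_add_one_nhdsGT_zero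
  have hnorm : morreyNorm p lam ℓ (singularOperator α ℓ f) ≤ A * N := by
    have hAN : A * N = (B * K) ^ (1 / p) := by
      have e : N = (N ^ p) ^ (1 / p) := by
        rw [← ENNReal.rpow_mul, mul_one_div_cancel hp0.ne', ENNReal.rpow_one]
      conv_lhs => rw [e]
      rw [hA, hKdef, ← ENNReal.mul_rpow_of_nonneg _ _ (by positivity)]
      congr 1
      ring
    rw [hAN]
    refine morreyNorm_le hp0 fun c r hr => ?_
    have hms : MeasurableSet (Metric.ball c r ∩ segment0 ℓ) := Metric.isOpen_ball.measurableSet.inter hI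
    calc ∫⁻ y in Metric.ball c r ∩ segment0 ℓ, ‖singularOperator α ℓ f y‖ₑ ^ p
        ≤ ∫⁻ y in Metric.ball c r ∩ segment0 ℓ, 2 ^ (p - 1) *
            (‖h y‖ₑ ^ p + (Set.Ioi 0).indicator (fun y => diffMajorant α G y ^ p) y) := by
          refine lintegral_mono_ae ?_
          filter_upwards [ae_restrict_of_ae_restrict_of_subset Set.inter_subset_right hval,
            ae_restrict_of_ae_restrict_of_subset Set.inter_subset_right hpos] with y hy hy0
          rw [hy, Set.indicator_of_mem (Set.mem_Ioi.2 hy0)]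
          refine le_trans (ENNReal.rpow_le_rpow ?_ hp0.le)
            (ENNReal.rpow_add_le_mul_rpow_add_rpow _ _ hp.le)
          rw [enorm_smul]
          have hπ : ‖Real.pi⁻¹‖ₑ ≤ 1 := by
            rw [Real.enorm_of_nonneg (by positivity), ENNReal.ofReal_le_one]
            exact inv_le_one_of_one_le₀ (by linarith [Real.pi_gt_three])
          calc _ ≤ 1 * (‖h y‖ₑ + ‖R y‖ₑ) := mul_le_mul' hπ (enorm_add_le _ _)
            _ ≤ _ := by rw [one_mul]; gcongr; exact hRT y
      _ = 2 ^ (p - 1) * ((∫⁻ y in Metric.ball c r ∩ segment0 ℓ, ‖h y‖ₑ ^ p) +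
            ∫⁻ y in Metric.ball c r ∩ segment0 ℓ,
              (Set.Ioi 0).indicator (fun y => diffMajorant α G y ^ p) y) := by
          rw [lintegral_const_mul' _ _ (by finiteness), lintegral_add_left']
          exact (hhm.enorm.pow_const p).restrict
      _ ≤ 2 ^ (p - 1) * (C * K * ENNReal.ofReal (r ^ lam) + D ^ p * K * ENNReal.ofReal (r ^ lam)) := by
          gcongr
          · exact (lintegral_mono_set Set.inter_subset_left).trans (hhK c r hr)
          · rw [lintegral_indicator measurableSet_Ioi, Measure.restrict_restrict measurableSet_Ioi]
            refine (lintegral_mono_set fun y hy => ?_).trans (hTK c r hr)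
            exact ⟨hy.2.1, hy.1⟩
      _ = _ := by rw [hB]; ring
  refine ⟨?_, ⟨hmeas, hnorm.trans_lt (ENNReal.mul_lt_top hAt.lt_top hNt)⟩, hnorm⟩
  filter_upwards [hex] with x hx using ⟨hx.1, _, hx.2⟩

end

/-! ### Truncated powers and necessity -/

noncomputable section

variable {𝕜 : Type*} [RCLike 𝕜]

variable (𝕜) in
/-- The power `t^{-γ}` restricted to `(δ, a]`. -/
def truncPower (γ δ a t : ℝ) : 𝕜 := (Set.Ioc δ a).indicator (fun t => ((t ^ (-γ) : ℝ) : 𝕜)) t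

theorem measurable_truncPower (γ δ a : ℝ) : Measurable (truncPower 𝕜 γ δ a) :=
  (RCLike.continuous_ofReal.measurable.comp (measurable_id.pow_const _)).indicator measurableSet_Ioc

theorem enorm_truncPower_rpow {γ δ a p : ℝ} (hp : 0 < p) (hδ : 0 < δ) (t : ℝ) :
    ‖truncPower 𝕜 γ δ a t‖ₑ ^ p =
      (Set.Ioc δ a).indicator (fun t => ENNReal.ofReal (t ^ (-(γ * p)))) t := by
  unfold truncPower
  by_cases ht : t ∈ Set.Ioc δ a
  · have ht0 : 0 < t := hδ.trans ht.1
    rw [Set.indicator_of_mem ht, Set.indicator_of_mem ht, ← ofReal_norm, RCLike.norm_ofReal,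
      abs_of_pos (by positivity), ENNReal.ofReal_rpow_of_nonneg (by positivity) hp.le,
      ← Real.rpow_mul ht0.le, neg_mul]
  · rw [Set.indicator_of_notMem ht, Set.indicator_of_notMem ht, enorm_zero,
      ENNReal.zero_rpow_of_pos hp]

theorem integral_inv_Ioc {δ a : ℝ} (hδ : 0 < δ) (hδa : δ < a) :
    ∫ t in Set.Ioc δ a, t⁻¹ = Real.log (a / δ) := by
  rw [← intervalIntegral.integral_of_le hδa.le, integral_inv_of_pos hδ (hδ.trans hδa)]

theorem integrableOn_inv_Ioc {δ a : ℝ} (hδ : 0 < δ) : IntegrableOn (fun t : ℝ => t⁻¹) (Set.Ioc δ a) :=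
  (ContinuousOn.integrableOn_Icc (continuousOn_inv₀.mono fun _ ht => (hδ.trans_le ht.1).ne')).mono_set
    Set.Ioc_subset_Icc_self

/-- The p-th power of the test function is t^(λ-1) on (δ, a]. For λ = 0 its integral is the
logarithm; for λ > 0 the bound (1/λ + 2) r^λ holds uniformly in δ and a, and the logarithm only
unifies the two cases. -/
theorem exists_lintegral_truncPower_le {p lam : ℝ} (hp : 0 < p) (hlam0 : 0 ≤ lam) (hlam1 : lam < 1) :
    ∃ M : ℝ, 0 ≤ M ∧ ∀ δ a : ℝ, 0 < δ → δ < a → ∀ x r : ℝ, 0 < r →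
      ∫⁻ t in Metric.ball x r, ‖truncPower 𝕜 ((1 - lam) / p) δ a t‖ₑ ^ p ≤
        ENNReal.ofReal (M * (1 + Real.log (a / δ))) * ENNReal.ofReal (r ^ lam) := by
  rcases hlam0.eq_or_lt with rfl | hlam
  · refine ⟨1, zero_le_one, fun δ a hδ hδa x r hr => ?_⟩
    have hL : 0 ≤ Real.log (a / δ) := Real.log_nonneg (by rw [le_div_iff₀ hδ]; linarith)
    simp_rw [enorm_truncPower_rpow hp hδ, Real.rpow_zero, ENNReal.ofReal_one, mul_one, one_mul]
    refine (lintegral_mono' Measure.restrict_le_self le_rfl).trans ?_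
    rw [lintegral_indicator measurableSet_Ioc]
    calc _ = ∫⁻ t in Set.Ioc δ a, ENNReal.ofReal t⁻¹ := by
          refine setLIntegral_congr_fun measurableSet_Ioc fun t _ => ?_
          rw [sub_zero, one_div_mul_cancel hp.ne', Real.rpow_neg_one]
      _ = ENNReal.ofReal (Real.log (a / δ)) := by
          rw [← integral_inv_Ioc hδ hδa, ofReal_integral_eq_lintegral_ofReal (integrableOn_inv_Ioc hδ)]
          filter_upwards [ae_restrict_mem measurableSet_Ioc] with t ht
          exact inv_nonneg.2 (hδ.trans ht.1).le
      _ ≤ _ := ENNReal.ofReal_le_ofReal (by linarith)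
  · refine ⟨1 / lam + 2, by positivity, fun δ a hδ hδa x r hr => ?_⟩
    have hL : 0 ≤ Real.log (a / δ) := Real.log_nonneg (by rw [le_div_iff₀ hδ]; linarith)
    have hint : IntegrableOn (fun t : ℝ => t ^ (lam - 1)) (Set.Ioc 0 r) :=
      (intervalIntegrable_iff_integrableOn_Ioc_of_le hr.le).1
        (intervalIntegral.intervalIntegrable_rpow' (by linarith))
    have hγp : (1 - lam) / p * p = 1 - lam := by field_simp
    -- For t ≤ r the power is kept and integrated from 0 to r; for t > r it is at most r^(λ-1),
    -- which is integrated over a ball of length 2r.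
    have hpt : ∀ t ∈ Metric.ball x r, ‖truncPower 𝕜 ((1 - lam) / p) δ a t‖ₑ ^ p ≤
        (Set.Ioc 0 r).indicator (fun t => ENNReal.ofReal (t ^ (lam - 1))) t +
          ENNReal.ofReal (r ^ (lam - 1)) := fun t _ => by
      rw [enorm_truncPower_rpow hp hδ, hγp, neg_sub]
      by_cases ht : t ∈ Set.Ioc δ a
      · rw [Set.indicator_of_mem ht]
        have ht0 : 0 < t := hδ.trans ht.1
        rcases le_or_gt t r with h | h
        · rw [Set.indicator_of_mem (Set.mem_Ioc.2 ⟨ht0, h⟩)]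
          exact le_self_add
        · refine le_trans (ENNReal.ofReal_le_ofReal ?_) le_add_self
          exact Real.rpow_le_rpow_of_nonpos hr h.le (by linarith)
      · rw [Set.indicator_of_notMem ht]; exact zero_le
    calc _ ≤ ∫⁻ t in Metric.ball x r,
          ((Set.Ioc 0 r).indicator (fun t => ENNReal.ofReal (t ^ (lam - 1))) t +
            ENNReal.ofReal (r ^ (lam - 1))) := setLIntegral_mono' Metric.isOpen_ball.measurableSet hpt
      _ = (∫⁻ t in Metric.ball x r,
          (Set.Ioc 0 r).indicator (fun t => ENNReal.ofReal (t ^ (lam - 1))) t) +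
            ENNReal.ofReal (r ^ (lam - 1)) * ENNReal.ofReal (2 * r) := by
          rw [lintegral_add_right _ measurable_const, setLIntegral_const, Real.volume_ball]
      _ ≤ ENNReal.ofReal (r ^ lam / lam) + ENNReal.ofReal (r ^ (lam - 1)) * ENNReal.ofReal (2 * r) := by
          gcongr
          refine (lintegral_mono' Measure.restrict_le_self le_rfl).trans (le_of_eq ?_)
          rw [lintegral_indicator measurableSet_Ioc, ← ofReal_integral_eq_lintegral_ofReal hint,
            ← intervalIntegral.integral_of_le hr.le, integral_rpow (Or.inl (by linarith)),
            sub_add_cancel, Real.zero_rpow hlam.ne', sub_zero]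
          filter_upwards [ae_restrict_mem measurableSet_Ioc] with t ht
          exact Real.rpow_nonneg ht.1.le _
      _ = ENNReal.ofReal ((1 / lam + 2) * r ^ lam) := by
          rw [← ENNReal.ofReal_mul (by positivity), ← ENNReal.ofReal_add (by positivity) (by positivity)]
          congr 1
          rw [Real.rpow_sub_one hr.ne']
          field_simp
      _ ≤ _ := by
          rw [← ENNReal.ofReal_mul (by positivity)]
          refine ENNReal.ofReal_le_ofReal ?_
          have h0 : 0 < (1 / lam + 2) * r ^ lam := by positivity
          nlinarith

/-- Off its support, the singular operator of a truncated power is an ordinary integral. -/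
theorem le_norm_singularOperator_truncPower {α γ δ a x c : ℝ} {ℓ : EReal} (hδ : 0 < δ) (hδa : δ < a)
    (hI : Set.Ioc δ a ⊆ segment0 ℓ) (hx : 0 < x) (hxs : x < δ ∨ a < x)
    (hc : ∀ t ∈ Set.Ioc δ a, c * t⁻¹ ≤ t ^ (-α - γ) * |t - x|⁻¹) :
    x ^ α / Real.pi * (c * Real.log (a / δ)) ≤ ‖singularOperator α ℓ (truncPower 𝕜 γ δ a) x‖ := by
  -- The point x has positive distance from the support, so truncations below η have no effect and
  -- the limit is an absolutely convergent integral.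
  obtain ⟨η, hη, hηt⟩ : ∃ η > 0, ∀ t ∈ Set.Ioc δ a, η ≤ |t - x| := by
    rcases hxs with h | h
    · exact ⟨δ - x, by linarith, fun t ht => le_trans (by linarith [ht.1]) (le_abs_self _)⟩
    · exact ⟨x - a, by linarith, fun t ht => le_trans (by linarith [ht.2]) (neg_le_abs _)⟩
  have hne : ∀ t ∈ Set.Icc δ a, t - x ≠ 0 := fun t ht h0 => by
    rcases hxs with h | h
    · linarith [ht.1]
    · linarith [ht.2]
  have hcont : ContinuousOn (fun t : ℝ => (t ^ α * (t - x))⁻¹ * t ^ (-γ)) (Set.Icc δ a) := by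
    have h1 : ∀ b : ℝ, ContinuousOn (fun t : ℝ => t ^ b) (Set.Icc δ a) := fun b =>
      continuousOn_id.rpow_const fun t ht => Or.inl (hδ.trans_le ht.1).ne'
    exact (((h1 α).mul (by fun_prop)).inv₀ fun t ht => mul_ne_zero
      (Real.rpow_pos_of_pos (hδ.trans_le ht.1) _).ne' (hne t ht)).mul (h1 _)
  have hint : IntegrableOn (fun t : ℝ => (t ^ α * (t - x))⁻¹ * t ^ (-γ)) (Set.Ioc δ a) :=
    (hcont.integrableOn_Icc (μ := volume)).mono_set Set.Ioc_subset_Icc_self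
  set J := ∫ t in Set.Ioc δ a, (t ^ α * (t - x))⁻¹ * t ^ (-γ) with hJ
  have hconst : ∀ ε : ℝ, 0 < ε → ε < η → truncatedSingularOperator α ℓ (truncPower 𝕜 γ δ a) x ε =
      (x ^ α / Real.pi) • (J : 𝕜) := by
    intro ε hε hεη
    unfold truncatedSingularOperator
    congr 1
    have hsub : Set.Ioc δ a ⊆ truncatedSegment ℓ x ε := fun t ht =>
      ⟨hI ht, hεη.trans_le (hηt t ht)⟩
    have hmeas : MeasurableSet (truncatedSegment ℓ x ε) :=
      (measurableSet_segment0 ℓ).inter (measurableSet_lt_abs_sub ε x)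
    rw [setIntegral_eq_of_subset_of_forall_sdiff_eq_zero hmeas hsub fun t ht => ?_, hJ,
      ← integral_ofReal]
    · refine setIntegral_congr_fun measurableSet_Ioc fun t ht => ?_
      simp only [singularIntegrand, truncPower]
      rw [Set.indicator_of_mem ht, RCLike.real_smul_eq_coe_mul, ← RCLike.ofReal_mul]
    · simp only [singularIntegrand, truncPower]
      rw [Set.indicator_of_notMem ht.2, smul_zero]
  have hlim : Tendsto (truncatedSingularOperator α ℓ (truncPower 𝕜 γ δ a) x) (𝓝[>] 0)
      (𝓝 ((x ^ α / Real.pi) • (J : 𝕜))) := by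
    refine tendsto_const_nhds.congr' ?_
    filter_upwards [Ioo_mem_nhdsGT hη] with ε hε
    exact (hconst ε hε.1 hε.2).symm
  rw [singularOperator, hlim.limUnder_eq, norm_smul, RCLike.norm_ofReal,
    Real.norm_of_nonneg (by positivity)]
  refine mul_le_mul_of_nonneg_left ?_ (by positivity)
  have habs : ∀ t ∈ Set.Ioc δ a, |(t ^ α * (t - x))⁻¹ * t ^ (-γ)| = t ^ (-α - γ) * |t - x|⁻¹ :=
    fun t ht => by
      have ht0 : 0 < t := hδ.trans ht.1
      rw [abs_mul, abs_inv, abs_mul, abs_of_pos (Real.rpow_pos_of_pos ht0 α),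
        abs_of_pos (Real.rpow_pos_of_pos ht0 (-γ)), mul_inv, ← Real.rpow_neg ht0.le,
        sub_eq_add_neg (-α), Real.rpow_add ht0]
      ring
  -- The integrand has constant sign, as x lies entirely on one side of the support, so there is no
  -- cancellation.
  have hJabs : |J| = ∫ t in Set.Ioc δ a, |(t ^ α * (t - x))⁻¹ * t ^ (-γ)| := by
    rcases hxs with h | h
    · rw [hJ, abs_of_nonneg]
      · refine setIntegral_congr_fun measurableSet_Ioc fun t ht => (abs_of_nonneg ?_).symm
        have ht0 : 0 < t := hδ.trans ht.1
        have : 0 < t - x := by linarith [ht.1]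
        positivity
      · refine setIntegral_nonneg measurableSet_Ioc fun t ht => ?_
        have ht0 : 0 < t := hδ.trans ht.1
        have : 0 < t - x := by linarith [ht.1]
        positivity
    · have hnp : ∀ t ∈ Set.Ioc δ a, (t ^ α * (t - x))⁻¹ * t ^ (-γ) ≤ 0 := fun t ht => by
        have ht0 : 0 < t := hδ.trans ht.1
        refine mul_nonpos_of_nonpos_of_nonneg (inv_nonpos.2 ?_) (by positivity)
        exact mul_nonpos_of_nonneg_of_nonpos (by positivity) (by linarith [ht.2])
      rw [hJ, abs_of_nonpos (setIntegral_nonpos measurableSet_Ioc hnp), ← integral_neg]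
      exact setIntegral_congr_fun measurableSet_Ioc fun t ht => (abs_of_nonpos (hnp t ht)).symm
  rw [hJabs, ← integral_inv_Ioc hδ hδa, ← integral_const_mul]
  refine setIntegral_mono_on ((integrableOn_inv_Ioc hδ).const_mul c) hint.abs measurableSet_Ioc
    fun t ht => ?_
  rw [habs t ht]
  exact hc t ht

/-- Testing the boundedness of the singular operator on truncated powers. -/
theorem SingularOperatorIsBounded.exists_test {α p lam : ℝ} {ℓ : EReal} (hp : 1 < p)
    (hlam0 : 0 ≤ lam) (hlam1 : lam < 1) (h : SingularOperatorIsBounded 𝕜 α p lam ℓ) :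
    ∃ M : ℝ, ∀ δ a : ℝ, 0 < δ → δ < a → ∀ y r b : ℝ, 0 < r → 0 ≤ b → y ∈ segment0 ℓ →
      Metric.ball y r ⊆ segment0 ℓ →
      (∀ x ∈ Metric.ball y r, b ≤ ‖singularOperator α ℓ (truncPower 𝕜 ((1 - lam) / p) δ a) x‖) →
      2 * r * b ^ p ≤ M * (1 + Real.log (a / δ)) * r ^ lam := by
  have hp0 : 0 < p := by linarith
  obtain ⟨C, hC⟩ := h
  obtain ⟨M, hM0, hM⟩ := exists_lintegral_truncPower_le (𝕜 := 𝕜) hp0 hlam0 hlam1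
  refine ⟨(C : ℝ) ^ p * M, fun δ a hδ hδa y r b hr hb hy hball hle => ?_⟩
  have hL : 0 ≤ Real.log (a / δ) := Real.log_nonneg (by rw [le_div_iff₀ hδ]; linarith)
  set f : ℝ → 𝕜 := truncPower 𝕜 ((1 - lam) / p) δ a
  set K := ENNReal.ofReal (M * (1 + Real.log (a / δ))) with hK
  have hfn : morreyNorm p lam ℓ f ≤ K ^ (1 / p) := morreyNorm_le hp0 fun x r hr =>
    (lintegral_mono_set Set.inter_subset_left).trans (hM δ a hδ hδa x r hr)
  have hf : MemMorrey p lam ℓ f := ⟨(measurable_truncPower _ _ _).aestronglyMeasurable,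
    hfn.trans_lt (ENNReal.rpow_lt_top_of_nonneg (by positivity) ENNReal.ofReal_ne_top)⟩
  have hS := (hC f hf).2.2.trans (mul_le_mul' le_rfl hfn)
  have h1 := lintegral_le_morreyNorm (lam := lam) hp0 (singularOperator α ℓ f) hy hr
  rw [Set.inter_eq_left.2 hball] at h1
  have h2 : ENNReal.ofReal b ^ p * ENNReal.ofReal (2 * r) ≤
      ∫⁻ x in Metric.ball y r, ‖singularOperator α ℓ f x‖ₑ ^ p := by
    rw [← Real.volume_ball, ← setLIntegral_const]
    refine setLIntegral_mono' Metric.isOpen_ball.measurableSet fun x hx => ?_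
    refine ENNReal.rpow_le_rpow ?_ hp0.le
    rw [← ofReal_norm]
    exact ENNReal.ofReal_le_ofReal (hle x hx)
  have h3 : morreyNorm p lam ℓ (singularOperator α ℓ f) ^ p ≤ ENNReal.ofReal ((C : ℝ) ^ p) * K := by
    refine (ENNReal.rpow_le_rpow hS hp0.le).trans (le_of_eq ?_)
    rw [ENNReal.mul_rpow_of_nonneg _ _ hp0.le, ← ENNReal.rpow_mul, one_div_mul_cancel hp0.ne',
      ENNReal.rpow_one, ← ENNReal.ofReal_rpow_of_nonneg C.coe_nonneg hp0.le, ENNReal.ofReal_coe_nnreal]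
  have h4 := h2.trans (h1.trans (mul_le_mul' h3 le_rfl))
  rw [hK, ENNReal.ofReal_rpow_of_nonneg hb hp0.le, ← ENNReal.ofReal_mul (by positivity),
    ← ENNReal.ofReal_mul (by positivity), ← ENNReal.ofReal_mul (by positivity),
    ENNReal.ofReal_le_ofReal_iff (by positivity)] at h4
  linarith

theorem not_forall_rpow_le {p M : ℝ} (hp : 1 < p) : ¬ ∀ L : ℝ, 0 < L → L ^ p ≤ M * (1 + L) := by
  intro h
  have h1 := tendsto_rpow_atTop (by linarith : 0 < p - 1)
  obtain ⟨L, hL, hL1⟩ := ((h1.eventually_gt_atTop (2 * |M|)).and (eventually_ge_atTop 1)).exists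
  have hL0 : 0 < L := by linarith
  have h2 := h L hL0
  have h3 : L ^ p = L ^ (p - 1) * L := by
    rw [← Real.rpow_add_one hL0.ne', sub_add_cancel]
  have h4 : M * (1 + L) ≤ 2 * |M| * L := by
    nlinarith [le_abs_self M, abs_nonneg M]
  nlinarith

/-- The length 4a leaves room for the support (0, a] of the test functions and for the test interval
(2a, 4a) to its right. -/
theorem exists_Icc_subset_segment0 {ℓ : EReal} (hℓ : 0 < ℓ) :
    ∃ a : ℝ, 0 < a ∧ Set.Icc 0 (4 * a) ⊆ segment0 ℓ := by
  obtain ⟨b, hb0, hbℓ⟩ := EReal.lt_iff_exists_real_btwn.1 hℓ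
  have hb : 0 < b := by exact_mod_cast hb0
  refine ⟨b / 4, by positivity, fun t ht => ⟨ht.1, le_trans ?_ hbℓ.le⟩⟩
  have : t ≤ b := by linarith [ht.2]
  exact_mod_cast this

/-- The necessity of the upper bound for the exponent. -/
theorem SingularOperatorIsBounded.lt_one_sub {α p lam : ℝ} {ℓ : EReal} (hℓ : 0 < ℓ) (hp : 1 < p)
    (hlam0 : 0 ≤ lam) (hlam1 : lam < 1) (h : SingularOperatorIsBounded 𝕜 α p lam ℓ) :
    α < 1 - (1 - lam) / p := by
  by_contra! hα
  have hp0 : 0 < p := by linarith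
  set γ := (1 - lam) / p with hγ
  have hγ1 : γ < 1 := by rw [hγ, div_lt_one hp0]; linarith
  have hα0 : 0 < α := by linarith
  obtain ⟨a, ha, haI⟩ := exists_Icc_subset_segment0 hℓ
  obtain ⟨M, hM⟩ := h.exists_test hp hlam0 hlam1
  -- Here 1 - α - γ ≤ 0, so on t ≤ a the power t^(-α-γ) is at least a^(1-α-γ) t^(-1); moreover |t -
  -- x| ≤ 4a on the test interval.
  set c : ℝ := a ^ (1 - α - γ) * (4 * a)⁻¹ with hc
  have hc0 : 0 < c := by positivity
  set d : ℝ := (2 * a) ^ α / Real.pi * c with hd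
  have hd0 : 0 < d := by positivity
  -- The test inequality 2a (dL)^p ≤ M (1 + L) a^λ solved for L^p. The choice δ = a e^(-L) realises
  -- every L > 0 as log(a/δ).
  refine not_forall_rpow_le (M := M * a ^ lam / (2 * a * d ^ p)) hp fun L hL => ?_
  set δ := a * Real.exp (-L) with hδ
  have hδ0 : 0 < δ := by positivity
  have hδa : δ < a := by
    rw [hδ]
    exact mul_lt_of_lt_one_right ha (Real.exp_lt_one_iff.2 (by linarith))
  have hlog : Real.log (a / δ) = L := by
    rw [hδ, div_mul_cancel_left₀ ha.ne', ← Real.exp_neg, neg_neg, Real.log_exp]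
  have hball : ∀ x ∈ Metric.ball (3 * a) a, 2 * a < x ∧ x < 4 * a := fun x hx => by
    rw [Metric.mem_ball, Real.dist_eq, abs_lt] at hx
    constructor <;> linarith
  have := hM δ a hδ0 hδa (3 * a) a (d * L) ha (by positivity)
    (haI ⟨by linarith, by linarith⟩)
    (fun x hx => haI ⟨by linarith [(hball x hx).1], (hball x hx).2.le⟩)
    fun x hx => by
      obtain ⟨hx1, hx2⟩ := hball x hx
      refine le_trans ?_ (le_norm_singularOperator_truncPower (c := c) hδ0 hδa
        (fun t ht => haI ⟨(hδ0.trans ht.1).le, by linarith [ht.2]⟩) (by linarith)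
        (Or.inr (by linarith)) fun t ht => ?_)
      · rw [hlog, hd, mul_assoc]
        have : (2 * a) ^ α ≤ x ^ α := by gcongr
        gcongr
      · have ht0 : 0 < t := hδ0.trans ht.1
        have e1 : t ^ (-α - γ) = t ^ (1 - α - γ) * t⁻¹ := by
          rw [← Real.rpow_neg_one, ← Real.rpow_add ht0]; congr 1; ring
        have e2 : a ^ (1 - α - γ) ≤ t ^ (1 - α - γ) :=
          Real.rpow_le_rpow_of_nonpos ht0 ht.2 (by linarith)
        have e3 : (4 * a)⁻¹ ≤ |t - x|⁻¹ := by
          have : 0 < |t - x| := abs_pos.2 (by linarith [ht.2])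
          refine inv_anti₀ this ?_
          rw [abs_sub_comm, abs_of_pos (by linarith [ht.2])]
          linarith
        rw [e1, hc, mul_right_comm]
        gcongr
  rw [hlog, Real.mul_rpow hd0.le hL.le] at this
  rw [div_mul_eq_mul_div, le_div_iff₀ (by positivity)]
  linarith

/-- The necessity of the lower bound for the exponent. -/
theorem SingularOperatorIsBounded.neg_lt {α p lam : ℝ} {ℓ : EReal} (hℓ : 0 < ℓ) (hp : 1 < p)
    (hlam0 : 0 ≤ lam) (hlam1 : lam < 1) (h : SingularOperatorIsBounded 𝕜 α p lam ℓ) :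
    -((1 - lam) / p) < α := by
  by_contra! hα
  have hp0 : 0 < p := by linarith
  set γ := (1 - lam) / p with hγ
  have hγ0 : 0 < γ := div_pos (by linarith) hp0
  obtain ⟨a, ha, haI⟩ := exists_Icc_subset_segment0 hℓ
  obtain ⟨M, hM⟩ := h.exists_test hp hlam0 hlam1
  refine not_forall_rpow_le (M := 2 * (1 / 4) ^ lam * M * Real.pi ^ p) hp fun L hL => ?_
  set δ := a * Real.exp (-L) with hδ
  have hδ0 : 0 < δ := by positivity
  have hδa : δ < a := by
    rw [hδ]
    exact mul_lt_of_lt_one_right ha (Real.exp_lt_one_iff.2 (by linarith))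
  have hlog : Real.log (a / δ) = L := by
    rw [hδ, div_mul_cancel_left₀ ha.ne', ← Real.exp_neg, neg_neg, Real.log_exp]
  have hball : ∀ x ∈ Metric.ball (δ / 4) (δ / 4), 0 < x ∧ x < δ := fun x hx => by
    rw [Metric.mem_ball, Real.dist_eq, abs_lt] at hx
    constructor <;> linarith
  -- The test interval (0, δ/2) shrinks with the support. For α ≤ -γ both x^α ≥ δ^α and t^(-α-γ) ≥
  -- δ^(-α-γ) hold, and their product is δ^(-γ).
  have := hM δ a hδ0 hδa (δ / 4) (δ / 4) (δ ^ (-γ) / Real.pi * L) (by positivity) (by positivity)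
    (haI ⟨by linarith, by linarith⟩)
    (fun x hx => haI ⟨(hball x hx).1.le, by linarith [(hball x hx).2]⟩)
    fun x hx => by
      obtain ⟨hx1, hx2⟩ := hball x hx
      refine le_trans ?_ (le_norm_singularOperator_truncPower (c := δ ^ (-α - γ)) hδ0 hδa
        (fun t ht => haI ⟨(hδ0.trans ht.1).le, by linarith [ht.2]⟩) hx1
        (Or.inl hx2) fun t ht => ?_)
      · have e1 : δ ^ (-γ) = δ ^ α * δ ^ (-α - γ) := by
          rw [← Real.rpow_add hδ0]; congr 1; ring
        have e2 : δ ^ α ≤ x ^ α := Real.rpow_le_rpow_of_nonpos hx1 hx2.le (by linarith)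
        rw [hlog, e1]
        calc _ = δ ^ α / Real.pi * (δ ^ (-α - γ) * L) := by ring
          _ ≤ _ := by gcongr
      · have ht0 : 0 < t := hδ0.trans ht.1
        have h1 : δ ^ (-α - γ) ≤ t ^ (-α - γ) :=
          Real.rpow_le_rpow hδ0.le ht.1.le (by linarith)
        have h2 : t⁻¹ ≤ |t - x|⁻¹ := by
          have h3 : 0 < t - x := by linarith [ht.1]
          rw [abs_of_pos h3]
          exact inv_anti₀ h3 (by linarith)
        gcongr
  -- Since -γp = λ - 1, the factor δ^λ δ^(-1) times the length δ/2 matches δ^λ on the other side,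
  -- and δ drops out of the test inequality except through L.
  have e1 : (δ ^ (-γ) / Real.pi * L) ^ p = δ ^ lam * δ⁻¹ * L ^ p / Real.pi ^ p := by
    rw [Real.mul_rpow (by positivity) hL.le, Real.div_rpow (by positivity) Real.pi_pos.le,
      ← Real.rpow_mul hδ0.le]
    have : -γ * p = lam + -1 := by rw [hγ]; field_simp; ring
    rw [this, Real.rpow_add hδ0, Real.rpow_neg_one]
    ring
  have e2 : (δ / 4) ^ lam = (1 / 4) ^ lam * δ ^ lam := by
    rw [← Real.mul_rpow (by norm_num) hδ0.le]; congr 1; ring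
  rw [hlog, e1, e2] at this
  have e3 : 2 * (δ / 4) * (δ ^ lam * δ⁻¹ * L ^ p / Real.pi ^ p) =
      δ ^ lam * (L ^ p / (2 * Real.pi ^ p)) := by
    field_simp; ring
  rw [e3, show M * (1 + L) * ((1 / 4) ^ lam * δ ^ lam) = δ ^ lam * (M * (1 + L) * (1 / 4) ^ lam) by ring]
    at this
  have h5 := le_of_mul_le_mul_left this (by positivity)
  rw [div_le_iff₀ (by positivity)] at h5
  linarith

end

theorem mainTheorem4 (𝕜 : Type*) [RCLike 𝕜] (α p lam : ℝ) (ℓ : EReal)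
    (hℓ : 0 < ℓ) (hp : 1 < p) (hlam0 : 0 ≤ lam) (hlam1 : lam < 1) :
    SingularOperatorIsBounded 𝕜 α p lam ℓ ↔
      -(1 / p) < α - lam / p ∧ α - lam / p < 1 / Real.conjExponent p := by
  have hp0 : 0 < p := by linarith
  have e1 : (1 - lam) / p = 1 / p - lam / p := sub_div _ _ _
  have e2 : 1 / Real.conjExponent p = 1 - 1 / p := by
    have h1 : p - 1 ≠ 0 := by linarith
    unfold Real.conjExponent
    field_simp
  constructor
  · intro h
    have h1 := h.neg_lt hℓ hp hlam0 hlam1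
    have h2 := h.lt_one_sub hℓ hp hlam0 hlam1
    rw [e1] at h1 h2
    rw [e2]
    constructor <;> linarith
  · rintro ⟨h1, h2⟩
    rw [e2] at h2
    exact singularOperatorIsBounded_of_lt hp hlam0 hlam1 (by rw [e1]; linarith)
      (by rw [e1]; linarith)
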